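/- Let $q\ge 2$ be an integer. For even $N=2n\ge 2$ consider the $N$-site one-dimensional brickwork random circuit with periodic boundary conditions and local dimension $q$: each period consists of two layers, the first applying independent Haar-random gates from $U(q^2)$ on the pairs of sites $\{2j,2j+1\}$ and the second on the pairs $\{2j-1,2j\}$ (site labels modulo $N$). Let $T=T_{N}$ be its transfer matrix for $t=2$, i.e. the operator on the $2t$-fold tensor power of $(\mathbb C^q)^{\otimes N}$ obtained from one period of the circuit by replacing every gate $U$ by its average $\int U^{\otimes t}\otimes (U^*)^{\otimes t}\,dU$. Let $\lambda_*(N)$ be the largest modulus of an eigenvalue of $T_N$ other than $1$, let $s_*(N)$ be the largest singular value of $T_N$ other than $1$, and let $P_1$ be the orthogonal projection onto the eigenspace of $T_N$ for the eigenvalue $1$. Put $\lambda_1=\left(\frac{2q}{q^2+1}\right)^4$. For a permutation $\sigma\in S_t$ let $|\sigma\rangle=q^{-t/2}\sum_{\vec i}|\vec i\rangle|\sigma(\vec i)\rangle$, the sum being over $t$-tuples $\vec i$ of basis labels, and for $\vec X=(X_1,\dots,X_N)\in S_2^N$ let $|\vec X\rangle=\bigotimes_i|X_i\rangle$. A probability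 measure $\nu$ on $U(q^N)$ is an $\varepsilon$-approximate $t$-design if $\|\Phi_\nu-\Phi_{\rm Haar}\|_\diamond\le\varepsilon$, where $\Phi_\nu(\rho)=\int U^{\otimes t}\rho\,(U^\dagger)^{\otimes t}d\nu(U)$. Let $C(N,q,t)$ be the infimum of the constants $C\ge 0$ such that the $N$-site brickwork circuit forms an $\varepsilon$-approximate $t$-design after at most $C\log\frac1\varepsilon+o\!\left(\log\frac1\varepsilon\right)$ periods as $\varepsilon\to0$ (and remains one for every larger number of periods), and let $C(q,t)=\sup_N C(N,q,t)$, the supremum being over even $N\ge2$. Then the following hold. (a) For every even $N\ge 2$ and all $\vec X,\vec X'\in S_2^N$ there is a constant $c_{X'X}$ such that for all integers $p>\frac{\log N}{-\log\lambda_1}+1$ $$\langle \vec X'|T^{p}|\vec X\rangle\le\langle\vec X'|P_1|\vec X\rangle+c_{X'X}\,\lambda_1^{p}.$$ (b) For every even $N\ge 2$, every eigenvalue $\mu\neq1$ of $T_N$ satisfies $|\mu|\le\lambda_1=\left(\frac{2q}{q^2+1}\right)^4$, and this is sharp over all system sizes: $\sup_N\lambda_*(N)=\left(\frac{2q}{q^2+1}\right)^4$.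 (c) $s_*:=\sup_N s_*(N)=\left(\frac{2q}{q^2+1}\right)^2$. (d) For every even $N\ge 2$ the $N$-site periodic brickwork forms an $\varepsilon$-approximate $2$-design after at most $C\log\frac1\varepsilon+o\!\left(\log\frac1\varepsilon\right)$ periods with $C=\left(4\log\frac{q^2+1}{2q}\right)^{-1}$, and $$C(q,2)=\left(4\log\frac{q^2+1}{2q}\right)^{-1}.$$ -/

import Mathlib

open MeasureTheory Matrix Filter Asymptotics
open scoped Kronecker ENNReal NNReal Topology ComplexOrder

noncomputable section

namespace RandomCircuit

/-! ### The unitary group and its Haar measure -/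

section Haar

variable {ι : Type*} [Fintype ι] [DecidableEq ι]

instance : MeasurableSpace (unitaryGroup ι ℂ) := borel _

instance : BorelSpace (unitaryGroup ι ℂ) := ⟨rfl⟩

instance : CompactSpace (unitaryGroup ι ℂ) := by
  suffices h : IsCompact ((unitaryGroup ι ℂ : Submonoid (Matrix ι ι ℂ)) : Set (Matrix ι ι ℂ)) from
    isCompact_iff_compactSpace.1 h
  have hK : IsCompact (Set.univ.pi fun _ : ι => Set.univ.pi fun _ : ι =>
      Metric.closedBall (0 : ℂ) 1) :=
    isCompact_univ_pi fun _ => isCompact_univ_pi fun _ => isCompact_closedBall _ _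
  have hc : IsClosed ((unitaryGroup ι ℂ : Submonoid (Matrix ι ι ℂ)) : Set (Matrix ι ι ℂ)) := by
    have h : ((unitaryGroup ι ℂ : Submonoid (Matrix ι ι ℂ)) : Set (Matrix ι ι ℂ))
        = {A | star A * A = 1} := by
      ext A
      exact mem_unitaryGroup_iff'
    rw [h]
    exact isClosed_eq (continuous_star.mul continuous_id) continuous_const
  refine IsCompact.of_isClosed_subset (t := (unitaryGroup ι ℂ : Set (Matrix ι ι ℂ))) hK hc ?_
  intro A hA i _ j _
  simpa using entry_norm_bound_of_unitary hA i j

variable (ι) in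
/-- The Haar probability measure on the unitary group `U(ι)`. -/
def haarU : Measure (unitaryGroup ι ℂ) := Measure.haarMeasure ⊤

instance : IsProbabilityMeasure (haarU ι) :=
  ⟨by simpa [haarU] using Measure.haarMeasure_self (K₀ := (⊤ : TopologicalSpace.PositiveCompacts
    (unitaryGroup ι ℂ)))⟩

/-- The tensor power `A^{⊗ t}`, as a matrix indexed by `t`-tuples. -/
def tensorPow (t : ℕ) (A : Matrix ι ι ℂ) : Matrix (Fin t → ι) (Fin t → ι) ℂ :=
  Matrix.of fun x y => ∏ k, A (x k) (y k)

/-- `U^{⊗ t,t} = U^{⊗ t} ⊗ (U^*)^{⊗ t}`, where `U^*` is the entrywise complex conjugate. -/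
def momentRep (t : ℕ) (U : Matrix ι ι ℂ) :
    Matrix ((Fin t → ι) × (Fin t → ι)) ((Fin t → ι) × (Fin t → ι)) ℂ :=
  tensorPow t U ⊗ₖ tensorPow t (U.map star)

lemma continuous_tensorPow (t : ℕ) :
    Continuous fun U : unitaryGroup ι ℂ => tensorPow t (U : Matrix ι ι ℂ) := by
  refine continuous_matrix fun x y => ?_
  change Continuous fun U : unitaryGroup ι ℂ => ∏ k, (U : Matrix ι ι ℂ) (x k) (y k)
  exact continuous_finsetProd _ fun k _ =>
    (continuous_subtype_val (p := fun A : Matrix ι ι ℂ => A ∈ unitaryGroup ι ℂ)).matrix_elem _ _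

lemma integrable_channel (t : ℕ) (ν : Measure (unitaryGroup ι ℂ)) [IsFiniteMeasure ν]
    (ρ : Matrix (Fin t → ι) (Fin t → ι) ℂ) (i j : Fin t → ι) :
    Integrable (fun U : unitaryGroup ι ℂ =>
      (tensorPow t (U : Matrix ι ι ℂ) * ρ * (tensorPow t (U : Matrix ι ι ℂ))ᴴ) i j) ν := by
  have hc : Continuous (fun U : unitaryGroup ι ℂ =>
      (tensorPow t (U : Matrix ι ι ℂ) * ρ * (tensorPow t (U : Matrix ι ι ℂ))ᴴ) i j) :=
    (((continuous_tensorPow t).matrix_mul continuous_const).matrix_mul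
      (continuous_tensorPow t).matrix_conjTranspose).matrix_elem i j
  exact hc.integrable_of_hasCompactSupport (HasCompactSupport.of_compactSpace _)

/-- The `t`-fold channel `ρ ↦ ∫ U^{⊗ t} ρ (U^†)^{⊗ t} dν(U)` of a measure `ν` on the unitary
group. -/
def channel (t : ℕ) (ν : Measure (unitaryGroup ι ℂ)) [IsFiniteMeasure ν] :
    Matrix (Fin t → ι) (Fin t → ι) ℂ →ₗ[ℂ] Matrix (Fin t → ι) (Fin t → ι) ℂ where
  toFun ρ := Matrix.of fun i j => ∫ U : unitaryGroup ι ℂ,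
    (tensorPow t (U : Matrix ι ι ℂ) * ρ * (tensorPow t (U : Matrix ι ι ℂ))ᴴ) i j ∂ν
  map_add' ρ σ := by
    ext i j
    simp only [Matrix.of_apply, Matrix.add_apply, Matrix.mul_add, Matrix.add_mul]
    exact integral_add (integrable_channel t ν ρ i j) (integrable_channel t ν σ i j)
  map_smul' c ρ := by
    ext i j
    simp only [Matrix.of_apply, Matrix.smul_apply, Matrix.mul_smul, Matrix.smul_mul,
      RingHom.id_apply]
    exact integral_smul c _

end Haar

/-! ### Diamond norm and approximate designs -/

section Diamond

variable {κ : Type*} [Fintype κ] [DecidableEq κ]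

/-- The trace norm: the sum of the singular values. -/
def traceNorm (X : Matrix κ κ ℂ) : ℝ := (toEuclideanLin X).singularValues.sum fun _ s => s

/-- `(Φ ⊗ id)(X)`: the map `Φ` is applied to each block of `X` (the second tensor factor labels
the blocks). -/
def tensorId (Φ : Matrix κ κ ℂ →ₗ[ℂ] Matrix κ κ ℂ) (X : Matrix (κ × κ) (κ × κ) ℂ) :
    Matrix (κ × κ) (κ × κ) ℂ :=
  Matrix.of fun p r => Φ (Matrix.of fun i j => X (i, p.2) (j, r.2)) p.1 r.1

/-- The diamond norm `sup { ‖(Φ ⊗ id)(X)‖₁ : ‖X‖₁ ≤ 1 }`, the ancilla having the dimension of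
the system. -/
def diamondNorm (Φ : Matrix κ κ ℂ →ₗ[ℂ] Matrix κ κ ℂ) : ℝ≥0∞ :=
  ⨆ (X : Matrix (κ × κ) (κ × κ) ℂ) (_ : traceNorm X ≤ 1),
    ENNReal.ofReal (traceNorm (tensorId Φ X))

/-- `ν` is an `ε`-approximate unitary `t`-design. -/
def IsApproxDesign {ι : Type*} [Fintype ι] [DecidableEq ι] (t : ℕ) (ε : ℝ)
    (ν : Measure (unitaryGroup ι ℂ)) [IsFiniteMeasure ν] : Prop :=
  diamondNorm (channel t ν - channel t (haarU ι)) ≤ ENNReal.ofReal ε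

end Diamond

/-! ### The periodic brickwork on `N = 2 n` sites of local dimension `q` -/

section Brickwork

/-- Computational basis labels of `N` sites of local dimension `q`. -/
abbrev Config (N q : ℕ) : Type := Fin N → Fin q

/-- Two-site unitary gates, `U(q²)`. -/
abbrev Gate (q : ℕ) : Type := unitaryGroup (Fin q × Fin q) ℂ

/-- `(ℂ^q)^{⊗ N}` split as (site `a`, site `b`) ⊗ (all other sites). -/
def splitSites {N : ℕ} (q : ℕ) {a b : Fin N} (hab : a ≠ b) :
    Config N q ≃ (Fin q × Fin q) × ({i : Fin N // i ≠ a ∧ i ≠ b} → Fin q) where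
  toFun x := ((x a, x b), fun i => x i)
  invFun y i := if ha : i = a then y.1.1 else if hb : i = b then y.1.2 else y.2 ⟨i, ha, hb⟩
  left_inv x := by
    funext i
    by_cases ha : i = a
    · simp [ha]
    · by_cases hb : i = b
      · subst hb
        simp [ha]
      · simp [ha, hb]
  right_inv y := by
    obtain ⟨⟨y1, y2⟩, r⟩ := y
    refine Prod.ext (Prod.ext ?_ ?_) ?_
    · simp
    · simp [hab.symm]
    · funext i
      simp [i.2.1, i.2.2]

/-- The unitary on `N` sites that applies the gate `u` to the sites `a`, `b` and the identity to
all other sites. -/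
def gateOn {N q : ℕ} {a b : Fin N} (hab : a ≠ b) (u : Gate q) :
    unitaryGroup (Config N q) ℂ :=
  ⟨((u : Matrix (Fin q × Fin q) (Fin q × Fin q) ℂ) ⊗ₖ
      (1 : Matrix ({i : Fin N // i ≠ a ∧ i ≠ b} → Fin q) _ ℂ)).submatrix
        (splitSites q hab) (splitSites q hab), by
    have hu := mem_unitaryGroup_iff.1 u.2
    rw [star_eq_conjTranspose] at hu
    rw [mem_unitaryGroup_iff, star_eq_conjTranspose, conjTranspose_submatrix,
      submatrix_mul_equiv, conjTranspose_kronecker, conjTranspose_one, ← mul_kronecker_mul, hu,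
      one_mul, one_kronecker_one, submatrix_one_equiv]⟩

/-- The site with label `k` modulo `N = 2 n`. -/
def site (n : ℕ+) (k : ℕ) : Fin (2 * n) :=
  ⟨k % (2 * n), Nat.mod_lt _ (Nat.mul_pos two_pos n.pos)⟩

lemma site_ne (n : ℕ+) (k : ℕ) : site n k ≠ site n (k + 1) := by
  have hn := n.pos
  intro h
  have h2 : (k % (2 * n)) = (k + 1) % (2 * n) := congrArg Fin.val h
  have h3 : k ≡ k + 1 [MOD 2 * n] := h2
  have h4 := (Nat.modEq_iff_dvd' (Nat.le_succ k)).1 h3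
  simp at h4

/-- The left site of the `j`-th gate of a layer; the gate acts on this site and the next one
(modulo `N`). In layer `0`, the first one, the gates act on `{2 j, 2 j + 1}`; in layer `1` they act
on `{2 j + 1, 2 j + 2}`. -/
def gateSite (n : ℕ+) (l : Fin 2) (j : Fin n) : ℕ := 2 * j + l

/-- One layer of gates. -/
def layerUnitary (n : ℕ+) (q : ℕ) (l : Fin 2) (u : Fin n → Gate q) :
    unitaryGroup (Config (2 * n) q) ℂ :=
  (List.ofFn fun j => gateOn (site_ne n (gateSite n l j)) (u j)).prod

/-- The circuit of `k` periods with gates `u`; later layers multiply from the left. -/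
def circuitUnitary (n : ℕ+) (q k : ℕ) (u : Fin k → Fin 2 → Fin n → Gate q) :
    unitaryGroup (Config (2 * n) q) ℂ :=
  (List.ofFn fun i => layerUnitary n q 1 (u i 1) * layerUnitary n q 0 (u i 0)).reverse.prod

/-- The law of the random circuit of `k` periods, all of whose gates are independent and
Haar-distributed on `U(q²)`. -/
def brickworkEnsemble (n : ℕ+) (q k : ℕ) : Measure (unitaryGroup (Config (2 * n) q) ℂ) :=
  Measure.map (circuitUnitary n q k)
    (Measure.pi fun _ : Fin k => Measure.pi fun _ : Fin 2 => Measure.pi fun _ : Fin n =>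
      haarU (Fin q × Fin q))

instance (n : ℕ+) (q k : ℕ) : IsFiniteMeasure (brickworkEnsemble n q k) := by
  unfold brickworkEnsemble
  infer_instance

/-- Index set of the `2 t` copies of the `N` sites. -/
abbrev MomentIndex (N q t : ℕ) : Type := (Fin t → Config N q) × (Fin t → Config N q)

/-- The averaged gate `G = ∫ u^{⊗ t,t} du` acting on the sites `a`, `b` of the `2 t` copies. -/
def averagedGate {N q : ℕ} (t : ℕ) {a b : Fin N} (hab : a ≠ b) :
    Matrix (MomentIndex N q t) (MomentIndex N q t) ℂ :=
  Matrix.of fun x y => ∫ u : Gate q,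
    momentRep t (gateOn hab u : Matrix (Config N q) (Config N q) ℂ) x y ∂(haarU (Fin q × Fin q))

/-- One layer of averaged gates. -/
def averagedLayer (n : ℕ+) (q t : ℕ) (l : Fin 2) :
    Matrix (MomentIndex (2 * n) q t) (MomentIndex (2 * n) q t) ℂ :=
  (List.ofFn fun j : Fin n => averagedGate t (site_ne n (gateSite n l j))).prod

/-- The transfer matrix `T` of one period. -/
def transferMatrix (n : ℕ+) (q t : ℕ) :
    EuclideanSpace ℂ (MomentIndex (2 * n) q t) →ₗ[ℂ]
      EuclideanSpace ℂ (MomentIndex (2 * n) q t) :=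
  toEuclideanLin (averagedLayer n q t 1 * averagedLayer n q t 0)

/-- The orthogonal projection onto the unit eigenspace of `T`. -/
def unitProjection (n : ℕ+) (q t : ℕ) :
    EuclideanSpace ℂ (MomentIndex (2 * n) q t) →L[ℂ]
      EuclideanSpace ℂ (MomentIndex (2 * n) q t) :=
  (Module.End.eigenspace (transferMatrix n q t) 1).starProjection

/-- The product state `⨂_i |σ_i⟩` of normalized single-site permutation states
`|σ⟩ = q^{-t/2} ∑_x |x⟩ |σ(x)⟩`, where `x` ranges over `t`-tuples and `σ` permutes the entries
of a tuple. -/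
def permState {N : ℕ} (q : ℕ) {t : ℕ} (σ : Fin N → Equiv.Perm (Fin t)) :
    EuclideanSpace ℂ (MomentIndex N q t) :=
  WithLp.toLp 2 fun x => ∏ i : Fin N,
    if ∀ k : Fin t, x.2 k i = x.1 ((σ i)⁻¹ k) i then (((√(q : ℝ) ^ t)⁻¹ : ℝ) : ℂ) else 0

/-- The largest modulus of an eigenvalue of `A` other than `1`. -/
def subleadingEigenvalue {E : Type*} [NormedAddCommGroup E] [InnerProductSpace ℂ E]
    (A : E →ₗ[ℂ] E) : ℝ :=
  sSup {r : ℝ | ∃ μ : ℂ, Module.End.HasEigenvalue A μ ∧ μ ≠ 1 ∧ r = ‖μ‖}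

/-- The largest singular value of `A` other than `1`. -/
def subleadingSingularValue {E : Type*} [NormedAddCommGroup E] [InnerProductSpace ℂ E]
    [FiniteDimensional ℂ E] (A : E →ₗ[ℂ] E) : ℝ :=
  sSup (Set.range A.singularValues \ {1})

/-- The brickwork on `2 n` sites forms an `ε`-approximate `t`-design after at most
`C log (1/ε) + o(log (1/ε))` periods, as `ε → 0`. -/
def IsDesignConstant (q t : ℕ) (n : ℕ+) (C : ℝ) : Prop :=
  ∃ r : ℝ → ℝ, r =o[𝓝[>] 0] (fun ε => Real.log (1 / ε)) ∧
    ∀ ε : ℝ, 0 < ε → ε < 1 → ∃ K : ℕ, (K : ℝ) ≤ C * Real.log (1 / ε) + r ε ∧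
      ∀ k : ℕ, K ≤ k → IsApproxDesign t ε (brickworkEnsemble n q k)

/-- `C(N,q,t)` for `N = 2 n`: the optimal constant. -/
def designConstantAt (q t : ℕ) (n : ℕ+) : ℝ≥0∞ :=
  ⨅ (C : ℝ≥0) (_ : IsDesignConstant q t n C), (C : ℝ≥0∞)

/-- `C(q,t) = sup_N C(N,q,t)`. -/
def designConstant (q t : ℕ) : ℝ≥0∞ := ⨆ n : ℕ+, designConstantAt q t n

end Brickwork

end RandomCircuit

end

open RandomCircuit

set_option linter.unusedSectionVars false

open RandomCircuit

/-! For `t = 2` the averaged gate is the orthogonal projection onto the span of two vectors, the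
permutation states of the identity and of the swap (`invariant_eq_permDelta`,
`momentMatrix_haarU_mulVec`). After one layer the state is thus a combination of configurations that
assign one element of `S₂` to each gate. In the next layer a gate sees two neighbouring values. If
they agree it keeps them; if they differ, at a domain wall, it outputs either value with weight
`q/(q²+1)`. So a layer is a nonnegative matrix on configurations, and each wall costs a factor `w =
2q/(q²+1)` in total weight.

On a ring a nonconstant configuration has at least two walls, while constant configurations are
fixed. Hence the `ℓ¹` norm of the coefficients of nonconstant configurations shrinks by `w²` per
layer and `w⁴` per period, for every system size (`wallNorm_periodCoeff_le`). This bounds the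
eigenvalues (`norm_eigenvalue_le`). Since fixed vectors of `T` are fixed by both layers, it also
gives convergence of `T^p` to the orthogonal projection `P₁` at rate `w^{4p}`, with no polynomial
loss (`exists_norm_transferMatrix_pow_sub_le`). With `T = P₁'P₀'` a product of two orthogonal
projections, nonzero squared singular values are eigenvalues of `T`, so the singular values other
than `1` are at most `w²`.

For sharpness, sum a single domain of length `d` over its positions. A layer acts on the length by
the stencil `(w/2)²(1,2,1)`, and the lengths `0` and `n` are fixed. The Dirichlet sine mode,
corrected by constant configurations, is multiplied by `w²(1+cos(π/n))/2` in each layer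
(`layerOp_slowState`), which tends to `w²`.

Under vectorization the moment matrix of `k` periods is `T^k` and that of Haar measure is `P₁`. The
diamond distance lies between fixed multiples of the `k`-th powers of the squared sine-mode factor
and of `w⁴`; logarithms then give the design constant. -/

namespace RandomCircuit

/-! ### Moment representations and moment matrices -/

section Moment

variable {ι : Type*} [Fintype ι] [DecidableEq ι]

lemma tensorPow_mul (t : ℕ) (A B : Matrix ι ι ℂ) :
    tensorPow t (A * B) = tensorPow t A * tensorPow t B := by
  ext x y
  simp only [tensorPow, Matrix.of_apply, Matrix.mul_apply, Finset.prod_univ_sum,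
    Fintype.piFinset_univ, Finset.prod_mul_distrib]

lemma momentRep_mul (t : ℕ) (A B : Matrix ι ι ℂ) :
    momentRep t (A * B) = momentRep t A * momentRep t B := by
  have h : (A * B).map star = A.map star * B.map star := by
    ext i j
    simp [Matrix.mul_apply]
  rw [momentRep, momentRep, momentRep, h, tensorPow_mul, tensorPow_mul, mul_kronecker_mul]

lemma momentRep_apply (t : ℕ) (A : Matrix ι ι ℂ) (x y : (Fin t → ι) × (Fin t → ι)) :
    momentRep t A x y = (∏ k, A (x.1 k) (y.1 k)) * ∏ k, star (A (x.2 k) (y.2 k)) := by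
  obtain ⟨x1, x2⟩ := x
  obtain ⟨y1, y2⟩ := y
  simp [momentRep, tensorPow]

lemma momentRep_one (t : ℕ) : momentRep t (1 : Matrix ι ι ℂ) = 1 := by
  ext x y
  rw [momentRep_apply]
  simp only [Matrix.one_apply, Prod.ext_iff, funext_iff]
  by_cases h1 : ∀ k, x.1 k = y.1 k
  · by_cases h2 : ∀ k, x.2 k = y.2 k
    · simp [h1, h2]
    · have h3 := h2
      push Not at h3
      obtain ⟨k, hk⟩ := h3
      rw [Finset.prod_eq_zero (i := k) (f := fun k => star (if x.2 k = y.2 k then (1 : ℂ) else 0))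
        (Finset.mem_univ k) (by simp [hk])]
      simp [h2]
  · have h3 := h1
    push Not at h3
    obtain ⟨k, hk⟩ := h3
    rw [Finset.prod_eq_zero (i := k) (f := fun k => (if x.1 k = y.1 k then (1 : ℂ) else 0))
        (Finset.mem_univ k) (by simp [hk])]
    simp [h1]

lemma conjTranspose_momentRep (t : ℕ) (A : Matrix ι ι ℂ) :
    (momentRep t A)ᴴ = momentRep t Aᴴ := by
  ext x y
  simp [momentRep_apply, Matrix.conjTranspose_apply, star_mul']

/-- The unnormalized permutation state `∑_x |x⟩ |σ(x)⟩`. -/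
def permDelta (ι : Type*) [DecidableEq ι] {t : ℕ} (σ : Equiv.Perm (Fin t)) :
    (Fin t → ι) × (Fin t → ι) → ℂ :=
  fun x => if ∀ k, x.2 k = x.1 (σ⁻¹ k) then 1 else 0

/-- This is the commutation of `U^{⊗ t}` with permutations of the copies. Reindexing the conjugated
factors by `σ` makes the sum over tuples factor into inner products of rows of `U`. -/
lemma momentRep_mulVec_permDelta {t : ℕ} (U : unitaryGroup ι ℂ) (σ : Equiv.Perm (Fin t)) :
    momentRep t (U : Matrix ι ι ℂ) *ᵥ permDelta ι σ = permDelta ι σ := by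
  funext x
  have hU : ∀ i j, ∑ y, (U : Matrix ι ι ℂ) i y * star ((U : Matrix ι ι ℂ) j y)
      = if i = j then 1 else 0 := by
    intro i j
    have h := congrFun (congrFun (mem_unitaryGroup_iff.1 U.2) i) j
    rw [Matrix.mul_apply, Matrix.one_apply] at h
    simpa [Matrix.star_apply] using h
  have h1 : (momentRep t (U : Matrix ι ι ℂ) *ᵥ permDelta ι σ) x
      = ∑ y : Fin t → ι, ∏ k, ((U : Matrix ι ι ℂ) (x.1 k) (y k) *
          star ((U : Matrix ι ι ℂ) (x.2 (σ k)) (y k))) := by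
    rw [Matrix.mulVec, dotProduct, Fintype.sum_prod_type]
    refine Finset.sum_congr rfl fun y _ => ?_
    rw [Finset.sum_eq_single (fun k => y (σ⁻¹ k))]
    · rw [momentRep_apply, permDelta]
      simp only [implies_true, if_true, mul_one, Finset.prod_mul_distrib]
      congr 1
      rw [← Equiv.prod_comp σ]
      simp
    · intro z _ hz
      rw [permDelta, if_neg, mul_zero]
      intro h
      exact hz (funext h)
    · simp
  rw [h1, ← Fintype.piFinset_univ, ← Finset.prod_univ_sum (fun _ => Finset.univ)
    (fun k y => (U : Matrix ι ι ℂ) (x.1 k) y * star ((U : Matrix ι ι ℂ) (x.2 (σ k)) y))]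
  simp only [hU, permDelta]
  rw [Finset.prod_ite_zero]
  simp only [Finset.mem_univ, true_imp_iff, Finset.prod_const_one]
  refine if_congr ⟨fun h k => ?_, fun h k => ?_⟩ rfl rfl
  · simpa using (h (σ⁻¹ k)).symm
  · simpa using (h (σ k)).symm

lemma permDelta_vecMul_momentRep {t : ℕ} (U : unitaryGroup ι ℂ) (σ : Equiv.Perm (Fin t)) :
    permDelta ι σ ᵥ* momentRep t (U : Matrix ι ι ℂ) = permDelta ι σ := by
  have h := momentRep_mulVec_permDelta (star U) σ
  have h2 : ((star U : unitaryGroup ι ℂ) : Matrix ι ι ℂ) = (U : Matrix ι ι ℂ)ᴴ := rfl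
  rw [h2, ← conjTranspose_momentRep] at h
  have h3 : star (permDelta ι σ) = permDelta ι σ := by
    funext x
    simp only [permDelta, Pi.star_apply]
    split_ifs <;> simp
  have h4 := congrArg star h
  rw [star_mulVec, conjTranspose_conjTranspose, h3] at h4
  exact h4

lemma continuous_momentRep (t : ℕ) (x y : (Fin t → ι) × (Fin t → ι)) :
    Continuous fun U : unitaryGroup ι ℂ => momentRep t (U : Matrix ι ι ℂ) x y := by
  simp only [momentRep_apply]
  have h : ∀ i j, Continuous fun U : unitaryGroup ι ℂ => (U : Matrix ι ι ℂ) i j := fun i j =>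
    (continuous_subtype_val (p := fun A : Matrix ι ι ℂ => A ∈ unitaryGroup ι ℂ)).matrix_elem _ _
  exact (continuous_finsetProd _ fun k _ => h _ _).mul
    (continuous_finsetProd _ fun k _ => (h _ _).star)

lemma integrable_momentRep (t : ℕ) (ν : Measure (unitaryGroup ι ℂ)) [IsFiniteMeasure ν]
    (x y : (Fin t → ι) × (Fin t → ι)) :
    Integrable (fun U : unitaryGroup ι ℂ => momentRep t (U : Matrix ι ι ℂ) x y) ν :=
  (continuous_momentRep t x y).integrable_of_hasCompactSupport
    (HasCompactSupport.of_compactSpace _)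

/-- The `t`-th moment matrix `∫ U^{⊗ t,t} dν(U)`. -/
noncomputable def momentMatrix (t : ℕ) (ν : Measure (unitaryGroup ι ℂ)) :
    Matrix ((Fin t → ι) × (Fin t → ι)) ((Fin t → ι) × (Fin t → ι)) ℂ :=
  Matrix.of fun x y => ∫ U : unitaryGroup ι ℂ, momentRep t (U : Matrix ι ι ℂ) x y ∂ν

instance : Measure.IsMulLeftInvariant (haarU ι) := by
  unfold haarU
  infer_instance

/-- Left invariance of Haar measure: everything in the range of the moment matrix is an invariant
vector. -/
lemma momentRep_mul_momentMatrix_haarU (t : ℕ) (V : unitaryGroup ι ℂ) :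
    momentRep t (V : Matrix ι ι ℂ) * momentMatrix t (haarU ι) = momentMatrix t (haarU ι) := by
  ext x y
  rw [Matrix.mul_apply]
  simp only [momentMatrix, Matrix.of_apply]
  rw [← integral_mul_left_eq_self
    (fun U : unitaryGroup ι ℂ => momentRep t (U : Matrix ι ι ℂ) x y) V]
  simp only [← integral_const_mul]
  rw [← integral_finsetSum _ fun z _ => (integrable_momentRep t _ z y).const_mul _]
  refine integral_congr_ae (Eventually.of_forall fun U => ?_)
  simp only [Submonoid.coe_mul, momentRep_mul]
  rw [Matrix.mul_apply]

lemma permDelta_vecMul_momentMatrix {t : ℕ} (ν : Measure (unitaryGroup ι ℂ))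
    [IsProbabilityMeasure ν] (σ : Equiv.Perm (Fin t)) :
    permDelta ι σ ᵥ* momentMatrix t ν = permDelta ι σ := by
  funext y
  simp only [Matrix.vecMul, dotProduct, momentMatrix, Matrix.of_apply, ← integral_const_mul]
  rw [← integral_finsetSum _ fun z _ => (integrable_momentRep t _ z y).const_mul _]
  have h : ∀ U : unitaryGroup ι ℂ, ∑ x, permDelta ι σ x * momentRep t (U : Matrix ι ι ℂ) x y
      = permDelta ι σ y := fun U => congrFun (permDelta_vecMul_momentRep U σ) y
  simp [h]

end Moment

/-! ### Invariant vectors of `U ⊗ U ⊗ U^* ⊗ U^*` -/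

section Commutant

variable {ι : Type*} [Fintype ι] [DecidableEq ι]

/-- The sums are nested so that for a sparse `A` they collapse one after the other. -/
lemma momentRep_two_mulVec (A : Matrix ι ι ℂ) (w : (Fin 2 → ι) × (Fin 2 → ι) → ℂ)
    (i j k l : ι) :
    (momentRep 2 A *ᵥ w) (![i, j], ![k, l])
      = ∑ a, A i a * ∑ b, A j b * ∑ c, star (A k c) * ∑ d, star (A l d) *
          w (![a, b], ![c, d]) := by
  simp only [Matrix.mulVec, dotProduct, Fintype.sum_prod_type, momentRep_apply, Fin.prod_univ_two]
  have e : ∀ f : (Fin 2 → ι) → ℂ, ∑ x, f x = ∑ a, ∑ b, f ![a, b] := by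
    intro f
    rw [← (finTwoArrowEquiv ι).symm.sum_comp, Fintype.sum_prod_type]
    rfl
  simp only [e, Finset.mul_sum]
  refine Finset.sum_congr rfl fun a _ => Finset.sum_congr rfl fun b _ =>
    Finset.sum_congr rfl fun c _ => Finset.sum_congr rfl fun d _ => ?_
  simp
  ring

lemma diagonal_mem_unitaryGroup (v : ι → ℂ) (hv : ∀ i, v i * star (v i) = 1) :
    diagonal v ∈ unitaryGroup ι ℂ := by
  rw [mem_unitaryGroup_iff, star_eq_conjTranspose, diagonal_conjTranspose, diagonal_mul_diagonal,
    ← diagonal_one]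
  congr 1
  funext i
  exact hv i

lemma permutation_mem_unitaryGroup (π : Equiv.Perm ι) :
    (Matrix.of fun i j => if π i = j then (1 : ℂ) else 0) ∈ unitaryGroup ι ℂ := by
  rw [mem_unitaryGroup_iff]
  ext i j
  simp [Matrix.mul_apply, Matrix.star_apply, Matrix.one_apply, eq_comm]

/-- The rotation `|p⟩ ↦ (|p⟩ + |q⟩)/√2`, `|q⟩ ↦ (|p⟩ - |q⟩)/√2`. -/
noncomputable def planeRotation (p q : ι) : Matrix ι ι ℂ :=
  Matrix.of fun i a =>
    if i = p then ((√2 : ℝ) : ℂ)⁻¹ * ((if p = a then 1 else 0) + (if q = a then 1 else 0))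
    else if i = q then ((√2 : ℝ) : ℂ)⁻¹ * ((if p = a then 1 else 0) - (if q = a then 1 else 0))
    else if i = a then 1 else 0

lemma inv_sqrt_two_mul_self : (((√2 : ℝ) : ℂ)⁻¹) * ((√2 : ℝ) : ℂ)⁻¹ = 1 / 2 := by
  rw [← mul_inv, ← Complex.ofReal_mul, Real.mul_self_sqrt (by norm_num)]
  norm_num

lemma planeRotation_mem_unitaryGroup {p q : ι} (hpq : p ≠ q) :
    planeRotation p q ∈ unitaryGroup ι ℂ := by
  have h2 := inv_sqrt_two_mul_self
  have hrow : ∀ (i : ι) (f : ι → ℂ), ∑ a, planeRotation p q i a * f a =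
      if i = p then ((√2 : ℝ) : ℂ)⁻¹ * (f p + f q)
      else if i = q then ((√2 : ℝ) : ℂ)⁻¹ * (f p - f q) else f i := by
    intro i f
    simp only [planeRotation, Matrix.of_apply]
    split_ifs <;> simp [mul_assoc, add_mul, sub_mul, ← Finset.mul_sum, Finset.sum_add_distrib]
  have hr : (starRingEnd ℂ) (((√2 : ℝ) : ℂ)⁻¹) = ((√2 : ℝ) : ℂ)⁻¹ := by simp
  rw [mem_unitaryGroup_iff]
  ext i j
  rw [Matrix.mul_apply, Matrix.one_apply, hrow]
  simp only [Matrix.star_apply, planeRotation, Matrix.of_apply]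
  by_cases hip : i = p
  · subst hip
    by_cases hjp : j = i
    · subst hjp
      simp [hpq.symm, hpq]
      linear_combination 2 * h2
    · by_cases hjq : j = q
      · subst hjq
        simp [hpq.symm, hpq]
      · simp [hjp, hjq, Ne.symm hjp]
  · by_cases hiq : i = q
    · subst hiq
      by_cases hjp : j = p
      · subst hjp
        simp [hpq.symm, hpq]
      · by_cases hjq : j = i
        · subst hjq
          simp [hpq.symm, hpq]
          linear_combination 2 * h2
        · simp [hjp, hjq, Ne.symm hjq, hpq.symm]
    · by_cases hjp : j = p
      · subst hjp
        simp [hip, hiq, Ne.symm hip, Ne.symm hiq]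
      · by_cases hjq : j = q
        · subst hjq
          simp [hip, hiq, Ne.symm hip, Ne.symm hiq, hjp]
        · simp [hip, hiq, hjp, hjq, eq_comm]

variable {w : (Fin 2 → ι) × (Fin 2 → ι) → ℂ}

lemma invariant_permutation (hw : ∀ V : unitaryGroup ι ℂ, momentRep 2 (V : Matrix ι ι ℂ) *ᵥ w = w)
    (π : Equiv.Perm ι) (i j k l : ι) :
    w (![π i, π j], ![π k, π l]) = w (![i, j], ![k, l]) := by
  have h := congrFun (hw ⟨_, permutation_mem_unitaryGroup π⟩) (![i, j], ![k, l])
  rw [momentRep_two_mulVec] at h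
  simpa using h

lemma invariant_diagonal (hw : ∀ V : unitaryGroup ι ℂ, momentRep 2 (V : Matrix ι ι ℂ) *ᵥ w = w)
    (v : ι → ℂ) (hv : ∀ i, v i * star (v i) = 1) (i j k l : ι) :
    v i * (v j * (star (v k) * (star (v l) * w (![i, j], ![k, l])))) = w (![i, j], ![k, l]) := by
  have h := congrFun (hw ⟨_, diagonal_mem_unitaryGroup v hv⟩) (![i, j], ![k, l])
  rw [momentRep_two_mulVec] at h
  simpa [diagonal_apply, apply_ite] using h

/-- A diagonal unitary multiplies the entry by a phase, so the entry vanishes unless every label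
occurs equally often in `{i, j}` and in `{k, l}`. -/
lemma invariant_support (hw : ∀ V : unitaryGroup ι ℂ, momentRep 2 (V : Matrix ι ι ℂ) *ᵥ w = w)
    {i j k l : ι} (h1 : ¬(i = k ∧ j = l)) (h2 : ¬(i = l ∧ j = k)) :
    w (![i, j], ![k, l]) = 0 := by
  -- With phase `I` on label `m` alone the entry picks up `I^d`, where `d` is the difference of the
  -- two multiplicities of `m`. As `|d| ≤ 2`, this is `1` only for `d = 0`; testing `m = i` and `m =
  -- j` suffices.
  have hm : ∀ m, _ := fun m => invariant_diagonal hw (fun a => if a = m then Complex.I else 1)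
    (by intro a; split_ifs <;> simp) i j k l
  have key : ∀ c : ℂ, c ≠ 1 → c * w (![i, j], ![k, l]) = w (![i, j], ![k, l]) →
      w (![i, j], ![k, l]) = 0 := by
    intro c hc h
    have : (c - 1) * w (![i, j], ![k, l]) = 0 := by rw [sub_mul, h]; ring
    exact (mul_eq_zero.1 this).resolve_left (sub_ne_zero.2 hc)
  have hi := hm i
  have hj := hm j
  simp only [← mul_assoc] at hi hj
  by_contra h0
  have hi' := fun h => h0 (key _ h hi)
  have hj' := fun h => h0 (key _ h hj)
  apply hi'
  intro hi1
  apply hj'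
  intro hj1
  replace h1 : ¬(k = i ∧ l = j) := fun h => h1 ⟨h.1.symm, h.2.symm⟩
  replace h2 : ¬(l = i ∧ k = j) := fun h => h2 ⟨h.1.symm, h.2.symm⟩
  clear hi' hj' h0 hi hj hm key hw
  have e1 : (-1 : ℂ) ≠ 1 := by norm_num
  have e2 : Complex.I ≠ 1 := by simp [Complex.ext_iff]
  have e3 : -Complex.I ≠ 1 := by simp [Complex.ext_iff]
  rcases eq_or_ne i j with rfl | hij
  · by_cases hik : k = i <;> by_cases hil : l = i <;> simp_all
  · by_cases hik : k = i <;> by_cases hil : l = i <;> by_cases hjk : k = j <;>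
      by_cases hjl : l = j <;> simp_all [hij.symm]

/-- Of the sixteen terms produced by the rotation only six survive the support condition, and
swapping `p` and `q` pairs them up: `x = (2x + 2y + 2z)/4`. -/
lemma invariant_rotation (hw : ∀ V : unitaryGroup ι ℂ, momentRep 2 (V : Matrix ι ι ℂ) *ᵥ w = w)
    {p q : ι} (hpq : p ≠ q) :
    w (![p, p], ![p, p]) = w (![p, q], ![p, q]) + w (![p, q], ![q, p]) := by
  have h := congrFun (hw ⟨_, planeRotation_mem_unitaryGroup hpq⟩) (![p, p], ![p, p])
  rw [momentRep_two_mulVec] at h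
  have hs : ∀ i j k l, ¬(i = k ∧ j = l) → ¬(i = l ∧ j = k) → w (![i, j], ![k, l]) = 0 :=
    fun i j k l h1 h2 => invariant_support hw h1 h2
  have r1 := invariant_permutation hw (Equiv.swap p q) p p p p
  have r2 := invariant_permutation hw (Equiv.swap p q) p q p q
  have r3 := invariant_permutation hw (Equiv.swap p q) p q q p
  simp only [Equiv.swap_apply_left, Equiv.swap_apply_right] at r1 r2 r3
  simp only [planeRotation, Matrix.of_apply, if_true, star_mul', star_add, apply_ite star,
    star_one, star_zero, mul_assoc, add_mul, ite_mul, one_mul, zero_mul, ← Finset.mul_sum,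
    Finset.sum_add_distrib, Finset.sum_ite_eq, Finset.mem_univ] at h
  have hr : star (((√2 : ℝ) : ℂ)⁻¹) = ((√2 : ℝ) : ℂ)⁻¹ := by
    simp
  rw [hr] at h
  have h2 := inv_sqrt_two_mul_self
  rw [hs p p p q, hs p p q p, hs p p q q, hs p q p p, hs p q q q, hs q p p p, hs q p q q,
    hs q q p p, hs q q p q, hs q q q p, r1, r2, r3] at h
  · generalize ((√2 : ℝ) : ℂ)⁻¹ = r at h h2
    generalize w (![p, p], ![p, p]) = x at *
    generalize w (![p, q], ![p, q]) = y at *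
    generalize w (![p, q], ![q, p]) = z at *
    linear_combination (-2) * h + (4 * (r * r + 1 / 2) * (x + y + z)) * h2
  all_goals simp [hpq, hpq.symm]

/-- Every vector invariant under all `U ⊗ U ⊗ U^* ⊗ U^*` is a combination of the two permutation
states. -/
theorem invariant_eq_permDelta
    (hw : ∀ V : unitaryGroup ι ℂ, momentRep 2 (V : Matrix ι ι ℂ) *ᵥ w = w)
    (hι : ∃ p q : ι, p ≠ q) :
    ∃ α β : ℂ, w = α • permDelta ι 1 + β • permDelta ι (Equiv.swap 0 1) := by
  obtain ⟨p, q, hpq⟩ := hι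
  -- Both coefficients are read off at one pair of distinct labels. Permutation matrices carry every
  -- other pair of distinct labels there, and the rotation identity handles equal labels.
  refine ⟨w (![p, q], ![p, q]), w (![p, q], ![q, p]), ?_⟩
  have htrans : ∀ i j : ι, i ≠ j → ∃ π : Equiv.Perm ι, π i = p ∧ π j = q := by
    intro i j hij
    refine ⟨Equiv.swap (Equiv.swap i p j) q * Equiv.swap i p, ?_, by simp⟩
    rw [Equiv.Perm.mul_apply, Equiv.swap_apply_left, Equiv.swap_apply_of_ne_of_ne _ hpq]
    intro h
    have h2 : Equiv.swap i p i = Equiv.swap i p j := by rw [Equiv.swap_apply_left]; exact h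
    exact hij ((Equiv.swap i p).injective h2)
  funext x
  obtain ⟨x1, x2⟩ := x
  obtain ⟨i, j, rfl⟩ : ∃ i j, x1 = ![i, j] := ⟨x1 0, x1 1, by ext k; fin_cases k <;> rfl⟩
  obtain ⟨k, l, rfl⟩ : ∃ i j, x2 = ![i, j] := ⟨x2 0, x2 1, by ext k; fin_cases k <;> rfl⟩
  have hd : ∀ i j k l : ι, permDelta ι (1 : Equiv.Perm (Fin 2)) (![i, j], ![k, l])
      = if i = k ∧ j = l then 1 else 0 := by
    intro i j k l
    simp [permDelta, Fin.forall_fin_two, eq_comm]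
  have hd' : ∀ i j k l : ι, permDelta ι (Equiv.swap (0 : Fin 2) 1) (![i, j], ![k, l])
      = if i = l ∧ j = k then 1 else 0 := by
    intro i j k l
    simp [permDelta, Fin.forall_fin_two, eq_comm, and_comm]
  simp only [Pi.add_apply, Pi.smul_apply, smul_eq_mul, hd, hd']
  by_cases h1 : i = k ∧ j = l
  · obtain ⟨rfl, rfl⟩ := h1
    by_cases hij : i = j
    · subst hij
      obtain ⟨π, hπ⟩ : ∃ π : Equiv.Perm ι, π i = p := ⟨Equiv.swap i p, by simp⟩
      rw [← invariant_permutation hw π, hπ, invariant_rotation hw hpq]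
      simp
    · obtain ⟨π, h1, h2⟩ := htrans i j hij
      rw [← invariant_permutation hw π i j i j, h1, h2]
      simp [hij]
  · by_cases h2 : i = l ∧ j = k
    · obtain ⟨rfl, rfl⟩ := h2
      have hij : i ≠ j := fun h => h1 ⟨h, h.symm⟩
      obtain ⟨π, h1, h2⟩ := htrans i j hij
      rw [← invariant_permutation hw π i j j i, h1, h2]
      simp [hij]
    · rw [invariant_support hw h1 h2]
      simp [h1, h2]

end Commutant

/-! ### The Haar average for two copies -/

section Weingarten

lemma perm_two_univ : (Finset.univ : Finset (Equiv.Perm (Fin 2))) = {1, Equiv.swap 0 1} := by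
  decide

lemma perm_two_eq (σ : Equiv.Perm (Fin 2)) : σ = 1 ∨ σ = Equiv.swap 0 1 := by
  have h := Finset.mem_univ σ
  rw [perm_two_univ] at h
  simpa using h

lemma swap_ne_one : (Equiv.swap 0 1 : Equiv.Perm (Fin 2)) ≠ 1 := by decide

lemma perm_two_sum {M : Type*} [AddCommMonoid M] (f : Equiv.Perm (Fin 2) → M) :
    ∑ σ, f σ = f 1 + f (Equiv.swap 0 1) := by
  rw [perm_two_univ, Finset.sum_pair swap_ne_one.symm]

variable {ι : Type*} [Fintype ι] [DecidableEq ι]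

lemma permDelta_dotProduct (σ τ : Equiv.Perm (Fin 2)) :
    permDelta ι σ ⬝ᵥ permDelta ι τ
      = if σ = τ then (Fintype.card ι : ℂ) ^ 2 else (Fintype.card ι : ℂ) := by
  have e : ∀ f : (Fin 2 → ι) → ℂ, ∑ x, f x = ∑ a, ∑ b, f ![a, b] := by
    intro f
    rw [← (finTwoArrowEquiv ι).symm.sum_comp, Fintype.sum_prod_type]
    rfl
  have h : ∀ x : Fin 2 → ι, ∑ y, permDelta ι σ (x, y) * permDelta ι τ (x, y)
      = if ∀ k, x (σ⁻¹ k) = x (τ⁻¹ k) then 1 else 0 := by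
    intro x
    rw [Finset.sum_eq_single (fun k => x (σ⁻¹ k))]
    · simp [permDelta]
    · intro y _ hy
      rw [permDelta, if_neg (fun h => hy (funext h)), zero_mul]
    · simp
  rw [dotProduct, Fintype.sum_prod_type]
  simp only [h, e]
  rcases perm_two_eq σ with rfl | rfl <;> rcases perm_two_eq τ with rfl | rfl
  · simp [sq]
  · simp [Fin.forall_fin_two, swap_ne_one.symm, eq_comm]
  · simp [Fin.forall_fin_two, eq_comm]
  · simp [sq]

/-- The Weingarten function of `S₂`. -/
noncomputable def weingarten (d : ℝ) (σ τ : Equiv.Perm (Fin 2)) : ℝ :=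
  if σ = τ then (d ^ 2 - 1)⁻¹ else -(d * (d ^ 2 - 1))⁻¹

lemma weingarten_comm (d : ℝ) (σ τ : Equiv.Perm (Fin 2)) :
    weingarten d σ τ = weingarten d τ σ := by
  simp [weingarten, eq_comm]

/-- The averaged vector lies in the span of the two permutation states and has the same overlaps
with them as `w`. The Weingarten matrix inverts their Gram matrix, which has entries `d²` and `d`.
-/
theorem momentMatrix_haarU_mulVec (hι : 2 ≤ Fintype.card ι)
    (w : (Fin 2 → ι) × (Fin 2 → ι) → ℂ) :
    momentMatrix 2 (haarU ι) *ᵥ w = ∑ σ, (∑ τ, (weingarten (Fintype.card ι) σ τ : ℂ) *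
      (permDelta ι τ ⬝ᵥ w)) • permDelta ι σ := by
  have hinv : ∀ V : unitaryGroup ι ℂ,
      momentRep 2 (V : Matrix ι ι ℂ) *ᵥ (momentMatrix 2 (haarU ι) *ᵥ w)
        = momentMatrix 2 (haarU ι) *ᵥ w := by
    intro V
    rw [mulVec_mulVec, momentRep_mul_momentMatrix_haarU]
  have hne : ∃ p q : ι, p ≠ q := Fintype.exists_pair_of_one_lt_card hι
  obtain ⟨α, β, h⟩ := invariant_eq_permDelta hinv hne
  have hdot : ∀ σ : Equiv.Perm (Fin 2), permDelta ι σ ⬝ᵥ (momentMatrix 2 (haarU ι) *ᵥ w)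
      = permDelta ι σ ⬝ᵥ w := by
    intro σ
    rw [dotProduct_mulVec, permDelta_vecMul_momentMatrix]
  have h1 := hdot 1
  have h2 := hdot (Equiv.swap 0 1)
  rw [h] at h1 h2
  rw [h]
  simp only [dotProduct_add, dotProduct_smul, permDelta_dotProduct, smul_eq_mul, if_true,
    swap_ne_one, swap_ne_one.symm, if_false] at h1 h2
  simp only [perm_two_sum, weingarten, swap_ne_one, swap_ne_one.symm, if_true, if_false]
  rw [← h1, ← h2]
  have hd : (2 : ℝ) ≤ Fintype.card ι := by exact_mod_cast hι
  have hd0 : (Fintype.card ι : ℂ) ≠ 0 := by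
    exact_mod_cast (by linarith : (Fintype.card ι : ℝ) ≠ 0)
  have hd1 : (Fintype.card ι : ℂ) ^ 2 - 1 ≠ 0 := by
    exact_mod_cast (by nlinarith : (Fintype.card ι : ℝ) ^ 2 - 1 ≠ 0)
  push_cast
  congr 2
  · field_simp
    ring
  · field_simp
    ring

lemma momentMatrix_haarU_apply (hι : 2 ≤ Fintype.card ι) (x y : (Fin 2 → ι) × (Fin 2 → ι)) :
    momentMatrix 2 (haarU ι) x y = ∑ σ, ∑ τ, (weingarten (Fintype.card ι) σ τ : ℂ) *
      (permDelta ι σ x * permDelta ι τ y) := by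
  have h := congrFun (momentMatrix_haarU_mulVec hι (Pi.single y 1)) x
  rw [mulVec_single_one] at h
  change momentMatrix 2 (haarU ι) x y = _ at h
  rw [h, Finset.sum_apply]
  refine Finset.sum_congr rfl fun σ _ => ?_
  rw [Pi.smul_apply, smul_eq_mul, Finset.sum_mul]
  refine Finset.sum_congr rfl fun τ _ => ?_
  simp only [dotProduct_single, mul_one]
  ring

lemma momentMatrix_haarU_isHermitian (hι : 2 ≤ Fintype.card ι) :
    (momentMatrix 2 (haarU ι)).IsHermitian := by
  ext x y
  rw [conjTranspose_apply, momentMatrix_haarU_apply hι, momentMatrix_haarU_apply hι, star_sum,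
    Finset.sum_comm]
  have hr : ∀ (σ : Equiv.Perm (Fin 2)) z, star (permDelta ι σ z) = permDelta ι σ z := by
    intro σ z
    simp only [permDelta]
    split_ifs <;> simp
  rw [Finset.sum_comm]
  simp only [star_sum, star_mul', hr]
  rw [Finset.sum_comm]
  refine Finset.sum_congr rfl fun σ _ => Finset.sum_congr rfl fun τ _ => ?_
  rw [weingarten_comm]
  have : star ((weingarten (Fintype.card ι) σ τ : ℝ) : ℂ) = weingarten (Fintype.card ι) σ τ :=
    Complex.conj_ofReal _
  rw [this]
  ring

lemma momentMatrix_mulVec_permDelta {t : ℕ} (ν : Measure (unitaryGroup ι ℂ))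
    [IsProbabilityMeasure ν] (σ : Equiv.Perm (Fin t)) :
    momentMatrix t ν *ᵥ permDelta ι σ = permDelta ι σ := by
  funext y
  simp only [Matrix.mulVec, dotProduct, momentMatrix, Matrix.of_apply, ← integral_mul_const]
  rw [← integral_finsetSum _ fun z _ => (integrable_momentRep t _ y z).mul_const _]
  have h : ∀ U : unitaryGroup ι ℂ, ∑ x, momentRep t (U : Matrix ι ι ℂ) y x * permDelta ι σ x
      = permDelta ι σ y := fun U => congrFun (momentRep_mulVec_permDelta U σ) y
  simp [h]

/-- The averaged vector depends only on the overlaps with permutation states, and averaging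
preserves those. -/
lemma momentMatrix_haarU_mul_self (hι : 2 ≤ Fintype.card ι) :
    momentMatrix 2 (haarU ι) * momentMatrix 2 (haarU ι) = momentMatrix 2 (haarU ι) := by
  refine Matrix.ext_of_mulVec_single fun y => ?_
  rw [← mulVec_mulVec, momentMatrix_haarU_mulVec hι]
  simp only [dotProduct_mulVec, permDelta_vecMul_momentMatrix]
  rw [← momentMatrix_haarU_mulVec hι]

end Weingarten

/-! ### Tensor products of families of matrices -/

section PiKron

variable {J P : Type*} [Fintype J] [DecidableEq J] [Fintype P] [DecidableEq P]

/-- The tensor product of a family of matrices. -/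
noncomputable def piKron (H : J → Matrix P P ℂ) : Matrix (J → P) (J → P) ℂ :=
  Matrix.of fun x y => ∏ j, H j (x j) (y j)

lemma piKron_mul (H K : J → Matrix P P ℂ) : piKron (H * K) = piKron H * piKron K := by
  ext x y
  simp only [piKron, Matrix.of_apply, Matrix.mul_apply, Pi.mul_apply, Finset.prod_univ_sum,
    Fintype.piFinset_univ, Finset.prod_mul_distrib]

lemma piKron_one : piKron (1 : J → Matrix P P ℂ) = 1 := by
  ext x y
  simp only [piKron, Matrix.of_apply, Pi.one_apply, Matrix.one_apply]
  rw [Finset.prod_ite_zero]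
  simp [funext_iff]

lemma conjTranspose_piKron (H : J → Matrix P P ℂ) :
    (piKron H)ᴴ = piKron fun j => (H j)ᴴ := by
  ext x y
  simp [piKron, Matrix.conjTranspose_apply]

lemma piKron_mulVec (H : J → Matrix P P ℂ) (F : J → P → ℂ) :
    piKron H *ᵥ (fun x => ∏ j, F j (x j)) = fun x => ∏ j, (H j *ᵥ F j) (x j) := by
  funext x
  simp only [piKron, Matrix.mulVec, dotProduct, Matrix.of_apply, Finset.prod_univ_sum,
    Fintype.piFinset_univ, Finset.prod_mul_distrib]

/-- The tensor product, with its index set identified with another type. -/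
noncomputable def piKronHom {I : Type*} [Fintype I] [DecidableEq I] (e : I ≃ (J → P)) :
    (J → Matrix P P ℂ) →* Matrix I I ℂ where
  toFun H := (piKron H).submatrix e e
  map_one' := by rw [piKron_one, submatrix_one_equiv]
  map_mul' H K := by rw [piKron_mul, submatrix_mul_equiv]

/-- Used to recognise the ordered product of the gates of a layer as a single tensor product. -/
lemma prod_ofFn_mulSingle {M : Type*} [Monoid M] {n : ℕ} (x : Fin n → M) :
    (List.ofFn fun j => (Pi.mulSingle j (x j) : Fin n → M)).prod = x := by
  funext i
  have h := map_list_prod (Pi.evalMonoidHom (fun _ : Fin n => M) i)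
    (List.ofFn fun j => (Pi.mulSingle j (x j) : Fin n → M))
  rw [Pi.evalMonoidHom_apply] at h
  rw [h, List.map_ofFn]
  have h2 : (⇑(Pi.evalMonoidHom (fun _ : Fin n => M) i) ∘ fun j =>
      (Pi.mulSingle j (x j) : Fin n → M)) = Pi.mulSingle i (x i) := by
    funext j
    simp only [Function.comp, Pi.evalMonoidHom_apply, Pi.mulSingle_apply]
    by_cases hij : i = j
    · subst hij; simp
    · simp [hij, Ne.symm hij]
  rw [h2]
  have hn : ∀ (m : ℕ) (k : Fin m) (a : M), (List.ofFn (Pi.mulSingle k a : Fin m → M)).prod = a := by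
    intro m
    induction m with
    | zero => intro k; exact k.elim0
    | succ m ih =>
      intro k a
      rw [List.ofFn_succ, List.prod_cons]
      refine Fin.cases ?_ (fun k => ?_) k
      · have : (fun j : Fin m => (Pi.mulSingle 0 a : Fin (m + 1) → M) j.succ) = fun _ => 1 := by
          funext j
          simp
        rw [this]
        simp
      · have : (fun j : Fin m => (Pi.mulSingle k.succ a : Fin (m + 1) → M) j.succ)
            = Pi.mulSingle k a := by
          funext j
          simp [Pi.mulSingle_apply]
        rw [this, ih]
        simp [(Fin.succ_ne_zero k).symm]
  exact hn n i (x i)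

end PiKron

/-! ### A layer as a tensor product of averaged gates -/

section Layers

/-- Every site belongs to exactly one gate of a layer. -/
noncomputable def siteEquiv (n : ℕ+) (l : Fin 2) : Fin n × Fin 2 ≃ Fin (2 * n) :=
  Equiv.ofBijective (fun p => site n (gateSite n l p.1 + p.2)) <| by
    rw [Fintype.bijective_iff_injective_and_card]
    refine ⟨?_, by simp [mul_comm]⟩
    rintro ⟨⟨j, hj⟩, b⟩ ⟨⟨k, hk⟩, c⟩ h
    have h2 : (2 * j + (l : ℕ) + (b : ℕ)) % (2 * n) = (2 * k + (l : ℕ) + (c : ℕ)) % (2 * n) :=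
      congrArg Fin.val h
    have hb := b.2
    have hc := c.2
    -- Once the layer offset is cancelled, both sides are below `2 n`, so the congruence becomes an
    -- equality.
    have h3 : (2 * j + (b : ℕ)) ≡ (2 * k + (c : ℕ)) [MOD 2 * n] := by
      refine Nat.ModEq.add_right_cancel' (l : ℕ) ?_
      rw [Nat.ModEq]
      rw [add_right_comm, h2, add_right_comm]
    have h4 := Nat.ModEq.eq_of_lt_of_lt h3 (by omega) (by omega)
    simp only [Prod.mk.injEq, Fin.ext_iff]
    omega

/-- Local labels of the `2 t` copies of a pair of sites. -/
abbrev PairIndex (q t : ℕ) : Type := (Fin t → Fin q × Fin q) × (Fin t → Fin q × Fin q)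

/-- The labels of the copies of all sites, grouped by the gates of a layer. -/
noncomputable def pairEquiv (n : ℕ+) (q t : ℕ) (l : Fin 2) :
    MomentIndex (2 * n) q t ≃ (Fin n → PairIndex q t) where
  toFun x j := (fun k => (x.1 k (siteEquiv n l (j, 0)), x.1 k (siteEquiv n l (j, 1))),
    fun k => (x.2 k (siteEquiv n l (j, 0)), x.2 k (siteEquiv n l (j, 1))))
  invFun y := (fun k i => if ((siteEquiv n l).symm i).2 = 0
      then ((y ((siteEquiv n l).symm i).1).1 k).1 else ((y ((siteEquiv n l).symm i).1).1 k).2,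
    fun k i => if ((siteEquiv n l).symm i).2 = 0
      then ((y ((siteEquiv n l).symm i).1).2 k).1 else ((y ((siteEquiv n l).symm i).1).2 k).2)
  left_inv x := by
    refine Prod.ext ?_ ?_ <;>
    · funext k i
      obtain ⟨⟨j, b⟩, rfl⟩ := (siteEquiv n l).surjective i
      fin_cases b <;> simp
  right_inv y := by
    funext j
    refine Prod.ext ?_ ?_ <;>
    · funext k
      simp

lemma gateOn_apply {N q : ℕ} {a b : Fin N} (hab : a ≠ b) (u : Gate q) (X Y : Config N q) :
    (gateOn hab u : Matrix (Config N q) (Config N q) ℂ) X Y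
      = (u : Matrix (Fin q × Fin q) (Fin q × Fin q) ℂ) (X a, X b) (Y a, Y b) *
        if ∀ i, i ≠ a → i ≠ b → X i = Y i then 1 else 0 := by
  simp only [gateOn, submatrix_apply, kroneckerMap_apply, splitSites, Equiv.coe_fn_mk,
    Matrix.one_apply, funext_iff, Subtype.forall, and_imp]

/-- Away from its pair the gate is the identity, so its moment representation is a local entry times
the indicator that all other pairs agree. The indicator does not depend on `u` and leaves the
integral. -/
lemma averagedGate_eq (n : ℕ+) (q t : ℕ) (l : Fin 2) (j : Fin n) :
    averagedGate t (site_ne n (gateSite n l j)) (q := q) =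
      piKronHom (pairEquiv n q t l)
        (Pi.mulSingle j (momentMatrix t (haarU (Fin q × Fin q)))) := by
  ext x y
  have ha : siteEquiv n l (j, 0) = site n (gateSite n l j) := rfl
  have hb : siteEquiv n l (j, 1) = site n (gateSite n l j + 1) := rfl
  have hR : piKronHom (pairEquiv n q t l)
        (Pi.mulSingle j (momentMatrix t (haarU (Fin q × Fin q)))) x y
      = momentMatrix t (haarU (Fin q × Fin q)) (pairEquiv n q t l x j) (pairEquiv n q t l y j) *
        if ∀ i, i ≠ j → pairEquiv n q t l x i = pairEquiv n q t l y i then 1 else 0 := by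
    change ∏ i, (Pi.mulSingle j (momentMatrix t (haarU (Fin q × Fin q))) :
      Fin n → Matrix (PairIndex q t) (PairIndex q t) ℂ) i _ _ = _
    rw [← Finset.mul_prod_erase _ _ (Finset.mem_univ j), Pi.mulSingle_eq_same]
    congr 1
    rw [Finset.prod_congr rfl (g := fun i =>
      if pairEquiv n q t l x i = pairEquiv n q t l y i then (1 : ℂ) else 0)]
    · rw [Finset.prod_ite_zero]
      simp
    · intro i hi
      rw [Pi.mulSingle_eq_of_ne (Finset.ne_of_mem_erase hi), Matrix.one_apply]
  have hcond : (∀ i, i ≠ j → pairEquiv n q t l x i = pairEquiv n q t l y i) ↔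
      ((∀ k i, i ≠ site n (gateSite n l j) → i ≠ site n (gateSite n l j + 1) →
          x.1 k i = y.1 k i) ∧
        ∀ k i, i ≠ site n (gateSite n l j) → i ≠ site n (gateSite n l j + 1) →
          x.2 k i = y.2 k i) := by
    rw [← ha, ← hb]
    constructor
    · intro h
      constructor <;>
      · intro k i hi1 hi2
        obtain ⟨⟨m, b⟩, rfl⟩ := (siteEquiv n l).surjective i
        have hm : m ≠ j := by
          rintro rfl
          fin_cases b
          · exact hi1 rfl
          · exact hi2 rfl
        have h2 := h m hm
        simp only [pairEquiv, Equiv.coe_fn_mk, Prod.mk.injEq, funext_iff] at h2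
        fin_cases b <;> simp [h2]
    · rintro ⟨h1, h2⟩ i hi
      have hne : ∀ b c, siteEquiv n l (i, b) ≠ siteEquiv n l (j, c) := by
        intro b c h
        exact hi (congrArg Prod.fst ((siteEquiv n l).injective h))
      simp only [pairEquiv, Equiv.coe_fn_mk, Prod.mk.injEq, funext_iff]
      exact ⟨fun k => ⟨h1 _ _ (hne _ _) (hne _ _), h1 _ _ (hne _ _) (hne _ _)⟩,
        fun k => ⟨h2 _ _ (hne _ _) (hne _ _), h2 _ _ (hne _ _) (hne _ _)⟩⟩
  have hL : ∀ u : Gate q, momentRep t (gateOn (site_ne n (gateSite n l j)) u :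
        Matrix (Config (2 * n) q) (Config (2 * n) q) ℂ) x y
      = momentRep t (u : Matrix (Fin q × Fin q) (Fin q × Fin q) ℂ)
          (pairEquiv n q t l x j) (pairEquiv n q t l y j) *
        if ∀ i, i ≠ j → pairEquiv n q t l x i = pairEquiv n q t l y i then 1 else 0 := by
    intro u
    rw [momentRep_apply, momentRep_apply]
    simp only [gateOn_apply, star_mul', Finset.prod_mul_distrib, apply_ite star, star_one,
      star_zero, hcond]
    simp only [Finset.prod_ite_zero, Finset.prod_const_one]
    simp only [pairEquiv, Equiv.coe_fn_mk, ha, hb, Finset.mem_univ, true_imp_iff]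
    rw [mul_mul_mul_comm]
    congr 1
    simp only [ite_and, mul_ite, mul_one, mul_zero]
    split_ifs <;> rfl
  rw [hR, averagedGate, Matrix.of_apply]
  simp only [hL]
  rw [integral_mul_const]
  rfl

lemma averagedLayer_eq (n : ℕ+) (q t : ℕ) (l : Fin 2) :
    averagedLayer n q t l = piKronHom (pairEquiv n q t l)
      fun _ => momentMatrix t (haarU (Fin q × Fin q)) := by
  rw [averagedLayer]
  simp only [averagedGate_eq]
  rw [← prod_ofFn_mulSingle fun _ : Fin n => momentMatrix t (haarU (Fin q × Fin q)),
    map_list_prod, List.map_ofFn]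
  rfl

lemma two_le_card_pair {q : ℕ} (hq : 2 ≤ q) : 2 ≤ Fintype.card (Fin q × Fin q) := by
  simp only [Fintype.card_prod, Fintype.card_fin]
  nlinarith

lemma averagedLayer_isHermitian {q : ℕ} (hq : 2 ≤ q) (n : ℕ+) (l : Fin 2) :
    (averagedLayer n q 2 l).IsHermitian := by
  rw [averagedLayer_eq]
  change ((piKron _).submatrix _ _)ᴴ = _
  rw [conjTranspose_submatrix, conjTranspose_piKron]
  simp only [(momentMatrix_haarU_isHermitian (two_le_card_pair hq)).eq]
  rfl

lemma averagedLayer_mul_self {q : ℕ} (hq : 2 ≤ q) (n : ℕ+) (l : Fin 2) :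
    averagedLayer n q 2 l * averagedLayer n q 2 l = averagedLayer n q 2 l := by
  rw [averagedLayer_eq, ← map_mul]
  congr 1
  funext j
  exact momentMatrix_haarU_mul_self (two_le_card_pair hq)

end Layers

/-! ### The averaged gate on two-site permutation states -/

section PairStates

/-- The normalized two-site permutation state `|σ⟩|τ⟩`. -/
noncomputable def pairVec (q : ℕ) (σ τ : Equiv.Perm (Fin 2)) : PairIndex q 2 → ℂ := fun p =>
  (if ∀ k, (p.2 k).1 = (p.1 (σ⁻¹ k)).1 then (((√(q : ℝ) ^ 2)⁻¹ : ℝ) : ℂ) else 0) *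
    (if ∀ k, (p.2 k).2 = (p.1 (τ⁻¹ k)).2 then (((√(q : ℝ) ^ 2)⁻¹ : ℝ) : ℂ) else 0)

lemma pairVec_self (q : ℕ) (σ : Equiv.Perm (Fin 2)) :
    pairVec q σ σ = ((q : ℂ) ^ 2)⁻¹ • permDelta (Fin q × Fin q) σ := by
  funext p
  simp only [pairVec, Real.sq_sqrt (Nat.cast_nonneg (α := ℝ) q), Pi.smul_apply, permDelta,
    Prod.ext_iff, smul_eq_mul, forall_and, ite_and, Complex.ofReal_inv, Complex.ofReal_natCast]
  split_ifs
  · rw [sq, mul_inv, mul_one]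
  all_goals simp

/-- The overlap factors over the two sites, each factor being a Gram entry in dimension `q`. -/
lemma permDelta_dotProduct_pairVec (q : ℕ) (ρ σ τ : Equiv.Perm (Fin 2)) :
    permDelta (Fin q × Fin q) ρ ⬝ᵥ pairVec q σ τ
      = ((q : ℂ) ^ 2)⁻¹ * ((if ρ = σ then (q : ℂ) ^ 2 else q) * if ρ = τ then (q : ℂ) ^ 2 else q) := by
  have h : ∀ σ : Equiv.Perm (Fin 2), (if ρ = σ then (q : ℂ) ^ 2 else q)
      = permDelta (Fin q) ρ ⬝ᵥ permDelta (Fin q) σ := by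
    intro σ
    rw [permDelta_dotProduct, Fintype.card_fin]
  rw [h, h, dotProduct, dotProduct, dotProduct, Finset.sum_mul_sum, Finset.mul_sum]
  simp only [Finset.mul_sum]
  rw [← Fintype.sum_prod_type' (f := fun a b : (Fin 2 → Fin q) × (Fin 2 → Fin q) =>
    ((q : ℂ) ^ 2)⁻¹ * (permDelta (Fin q) ρ a * permDelta (Fin q) σ a *
      (permDelta (Fin q) ρ b * permDelta (Fin q) τ b)))]
  refine Fintype.sum_equiv
    { toFun := fun p => ((fun k => (p.1 k).1, fun k => (p.2 k).1),
        (fun k => (p.1 k).2, fun k => (p.2 k).2))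
      invFun := fun p => (fun k => (p.1.1 k, p.2.1 k), fun k => (p.1.2 k, p.2.2 k))
      left_inv := fun _ => rfl
      right_inv := fun _ => rfl } _ _ fun p => ?_
  simp only [pairVec, Real.sq_sqrt (Nat.cast_nonneg (α := ℝ) q), permDelta, Equiv.coe_fn_mk,
    Prod.ext_iff, forall_and, ite_and, Complex.ofReal_inv, Complex.ofReal_natCast]
  split_ifs <;> simp [sq]

/-- The weight with which the averaged gate maps `|σ⟩|τ⟩` to `|ρ⟩|ρ⟩`. -/
noncomputable def gateWeight (q : ℕ) (σ τ ρ : Equiv.Perm (Fin 2)) : ℝ :=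
  if σ = τ then (if ρ = σ then 1 else 0) else q / (q ^ 2 + 1)

/-- At a wall both overlaps are `q^{-2} q³ = q`, and a row of the Weingarten matrix in dimension
`q²` sums to `1/(q²(q²+1))`. Normalizing the output state contributes `q²`, which leaves `q/(q²+1)`.
-/
lemma momentMatrix_haarU_mulVec_pairVec {q : ℕ} (hq : 2 ≤ q) (σ τ : Equiv.Perm (Fin 2)) :
    momentMatrix 2 (haarU (Fin q × Fin q)) *ᵥ pairVec q σ τ
      = ∑ ρ, (gateWeight q σ τ ρ : ℂ) • pairVec q ρ ρ := by
  by_cases h : σ = τ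
  · subst h
    simp only [gateWeight, if_true]
    rw [Finset.sum_eq_single σ (fun ρ _ hρ => by simp [hρ]) (by simp), pairVec_self, mulVec_smul,
      momentMatrix_mulVec_permDelta]
    simp
  · rw [momentMatrix_haarU_mulVec (two_le_card_pair hq)]
    refine Finset.sum_congr rfl fun ρ _ => ?_
    rw [pairVec_self, smul_smul]
    congr 1
    have hq' : (2 : ℝ) ≤ q := by exact_mod_cast hq
    have e1 : (q : ℂ) ≠ 0 := by exact_mod_cast (by linarith : (q : ℝ) ≠ 0)
    have e2 : (q : ℂ) ^ 2 + 1 ≠ 0 := by exact_mod_cast (by positivity : (q : ℝ) ^ 2 + 1 ≠ 0)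
    have e3 : (q : ℂ) ^ 2 - 1 ≠ 0 := by exact_mod_cast (by nlinarith : (q : ℝ) ^ 2 - 1 ≠ 0)
    have e4 : ((q : ℂ) * q) ^ 2 - 1 = ((q : ℂ) ^ 2 + 1) * ((q : ℂ) ^ 2 - 1) := by ring
    have hprod : ∀ κ : Equiv.Perm (Fin 2),
        (if κ = σ then (q : ℂ) ^ 2 else q) * (if κ = τ then (q : ℂ) ^ 2 else q) = (q : ℂ) ^ 3 := by
      intro κ
      rcases perm_two_eq σ with rfl | rfl <;> rcases perm_two_eq τ with rfl | rfl <;>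
        rcases perm_two_eq κ with rfl | rfl <;>
        first
        | exact absurd rfl h
        | (simp [swap_ne_one.symm]; ring)
    simp only [permDelta_dotProduct_pairVec, gateWeight, h, if_false, hprod, Fintype.card_prod,
      Fintype.card_fin]
    rw [← Finset.sum_mul]
    have hw : ∑ κ, (weingarten (((q * q : ℕ) : ℝ)) ρ κ : ℂ)
        = (((q : ℂ) * q) ^ 2 - 1)⁻¹ - ((q : ℂ) * q * (((q : ℂ) * q) ^ 2 - 1))⁻¹ := by
      rcases perm_two_eq ρ with rfl | rfl <;>
        simp [perm_two_sum, weingarten, swap_ne_one.symm] <;> ring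
    rw [hw, e4]
    push_cast
    field_simp

lemma exists_momentMatrix_haarU_mulVec {q : ℕ} (hq : 2 ≤ q) (w : PairIndex q 2 → ℂ) :
    ∃ b : Equiv.Perm (Fin 2) → ℂ,
      momentMatrix 2 (haarU (Fin q × Fin q)) *ᵥ w = ∑ ρ, b ρ • pairVec q ρ ρ := by
  have e1 : (q : ℂ) ^ 2 ≠ 0 := by
    have : q ≠ 0 := by omega
    exact pow_ne_zero _ (by exact_mod_cast this)
  refine ⟨fun ρ => (∑ τ, (weingarten (Fintype.card (Fin q × Fin q)) ρ τ : ℂ) *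
    (permDelta (Fin q × Fin q) τ ⬝ᵥ w)) * (q : ℂ) ^ 2, ?_⟩
  rw [momentMatrix_haarU_mulVec (two_le_card_pair hq)]
  refine Finset.sum_congr rfl fun ρ _ => ?_
  rw [pairVec_self, smul_smul, mul_assoc, mul_inv_cancel₀ e1, mul_one]

end PairStates

/-! ### Layers acting on permutation product states -/

section LayerOp

variable {n : ℕ+} {q : ℕ}

/-- A layer of averaged gates, as an operator. -/
noncomputable def layerOp (n : ℕ+) (q : ℕ) (l : Fin 2) :
    EuclideanSpace ℂ (MomentIndex (2 * n) q 2) →ₗ[ℂ]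
      EuclideanSpace ℂ (MomentIndex (2 * n) q 2) :=
  toEuclideanLin (averagedLayer n q 2 l)

lemma layerOp_apply (l : Fin 2) (v : EuclideanSpace ℂ (MomentIndex (2 * n) q 2)) :
    layerOp n q l v = WithLp.toLp 2 (averagedLayer n q 2 l *ᵥ v.ofLp) := rfl

lemma transferMatrix_apply (v : EuclideanSpace ℂ (MomentIndex (2 * n) q 2)) :
    transferMatrix n q 2 v = layerOp n q 1 (layerOp n q 0 v) := by
  rw [layerOp_apply, layerOp_apply, mulVec_mulVec]
  rfl

lemma layerOp_layerOp (hq : 2 ≤ q) (l : Fin 2)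
    (v : EuclideanSpace ℂ (MomentIndex (2 * n) q 2)) :
    layerOp n q l (layerOp n q l v) = layerOp n q l v := by
  rw [layerOp_apply, layerOp_apply, mulVec_mulVec, averagedLayer_mul_self hq]

lemma layerOp_isSymmetric (hq : 2 ≤ q) (l : Fin 2) : (layerOp n q l).IsSymmetric :=
  Matrix.isSymmetric_toEuclideanLin_iff.2 (averagedLayer_isHermitian hq n l)

/-- The site configuration that is constant, with value `Z j`, on the `j`-th pair of sites of a
layer. -/
noncomputable def spread (l : Fin 2) (Z : Fin n → Equiv.Perm (Fin 2)) :
    Fin (2 * n) → Equiv.Perm (Fin 2) :=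
  fun i => Z ((siteEquiv n l).symm i).1

lemma spread_siteEquiv (l : Fin 2) (Z : Fin n → Equiv.Perm (Fin 2)) (j : Fin n) (b : Fin 2) :
    spread l Z (siteEquiv n l (j, b)) = Z j := by
  simp [spread]

lemma spread_injective (l : Fin 2) :
    Function.Injective (spread l : (Fin n → Equiv.Perm (Fin 2)) → _) := by
  intro Z W h
  funext j
  rw [← spread_siteEquiv l Z j 0, h, spread_siteEquiv]

lemma permState_apply_eq_prod (l : Fin 2) (X : Fin (2 * n) → Equiv.Perm (Fin 2))
    (x : MomentIndex (2 * n) q 2) :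
    permState q X x = ∏ j, pairVec q (X (siteEquiv n l (j, 0))) (X (siteEquiv n l (j, 1)))
      (pairEquiv n q 2 l x j) := by
  change (∏ i : Fin (2 * n), _) = _
  rw [← (siteEquiv n l).prod_comp, Fintype.prod_prod_type]
  refine Finset.prod_congr rfl fun j _ => ?_
  rw [Fin.prod_univ_two]
  rfl

/-- The layer acts on each pair separately; expanding the product of sums gives one term for each
choice of a permutation per gate. -/
lemma layerOp_prod {l : Fin 2} {F : Fin n → PairIndex q 2 → ℂ}
    {b : Fin n → Equiv.Perm (Fin 2) → ℂ}
    (h : ∀ j, momentMatrix 2 (haarU (Fin q × Fin q)) *ᵥ F j = ∑ ρ, b j ρ • pairVec q ρ ρ) :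
    layerOp n q l (WithLp.toLp 2 fun x => ∏ j, F j (pairEquiv n q 2 l x j))
      = ∑ Z : Fin n → Equiv.Perm (Fin 2), (∏ j, b j (Z j)) • permState q (spread l Z) := by
  have h1 : averagedLayer n q 2 l *ᵥ (fun x => ∏ j, F j (pairEquiv n q 2 l x j))
      = fun x => ∏ j, (∑ ρ, b j ρ • pairVec q ρ ρ) (pairEquiv n q 2 l x j) := by
    rw [averagedLayer_eq]
    change (piKron _).submatrix _ _ *ᵥ _ = _
    have h2 := piKron_mulVec (fun _ : Fin n => momentMatrix 2 (haarU (Fin q × Fin q))) F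
    funext x
    have h3 := congrFun h2 (pairEquiv n q 2 l x)
    simp only [h] at h3
    have h4 : (fun x => ∏ j, F j (pairEquiv n q 2 l x j)) ∘ (pairEquiv n q 2 l).symm
        = fun y => ∏ j, F j (y j) := by
      funext y
      simp
    rw [← h3, submatrix_mulVec_equiv, h4]
    rfl
  rw [layerOp_apply, h1]
  ext x
  rw [WithLp.ofLp_sum, Finset.sum_apply]
  simp only [Finset.sum_apply, Finset.prod_univ_sum, Fintype.piFinset_univ, WithLp.ofLp_smul,
    Pi.smul_apply, permState_apply_eq_prod l, spread_siteEquiv, smul_eq_mul,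
    Finset.prod_mul_distrib]

theorem layerOp_permState (hq : 2 ≤ q) (l : Fin 2) (X : Fin (2 * n) → Equiv.Perm (Fin 2)) :
    layerOp n q l (permState q X) = ∑ Z : Fin n → Equiv.Perm (Fin 2),
      (∏ j, (gateWeight q (X (siteEquiv n l (j, 0))) (X (siteEquiv n l (j, 1))) (Z j) : ℂ)) •
        permState q (spread l Z) := by
  rw [← layerOp_prod fun j => momentMatrix_haarU_mulVec_pairVec hq _ _]
  congr 1
  ext x
  exact permState_apply_eq_prod l X x

lemma layerOp_mem_span (hq : 2 ≤ q) (l : Fin 2)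
    (v : EuclideanSpace ℂ (MomentIndex (2 * n) q 2)) :
    ∃ c : (Fin n → Equiv.Perm (Fin 2)) → ℂ,
      layerOp n q l v = ∑ Z, c Z • permState q (spread l Z) := by
  choose b hb using fun w => exists_momentMatrix_haarU_mulVec hq w
  -- Basis vectors are products over the pairs, so `v` is expanded in them and the layer is applied
  -- factor by factor.
  refine ⟨fun Z => ∑ y, v y * ∏ j, b (Pi.single (pairEquiv n q 2 l y j) 1) (Z j), ?_⟩
  have hv : v = ∑ y, v y • WithLp.toLp 2
      (fun x => ∏ j, (Pi.single (pairEquiv n q 2 l y j) 1 : PairIndex q 2 → ℂ)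
        (pairEquiv n q 2 l x j)) := by
    ext x
    rw [WithLp.ofLp_sum, Finset.sum_apply, Finset.sum_eq_single x]
    · simp
    · intro y _ hy
      have : ∃ j, pairEquiv n q 2 l x j ≠ pairEquiv n q 2 l y j := by
        by_contra hcon
        push Not at hcon
        exact hy ((pairEquiv n q 2 l).injective (funext hcon)).symm
      obtain ⟨j, hj⟩ := this
      simp only [WithLp.ofLp_smul, Pi.smul_apply, smul_eq_mul]
      rw [Finset.prod_eq_zero (Finset.mem_univ j) (by rw [Pi.single_eq_of_ne hj]), mul_zero]
    · simp
  conv_lhs => rw [hv, map_sum]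
  simp only [map_smul, layerOp_prod fun j => hb _, Finset.smul_sum, smul_smul, Finset.sum_smul]
  rw [Finset.sum_comm]

end LayerOp

/-! ### Coefficients of permutation product states -/

section Evaluation

variable {n : ℕ+} {q : ℕ}

/-- A basis label on which, among all permutation product states, only the one of `X` does not
vanish. -/
def testIndex (hq : 2 ≤ q) {N : ℕ} (X : Fin N → Equiv.Perm (Fin 2)) : MomentIndex N q 2 :=
  (fun k _ => Fin.castLE hq k, fun k i => Fin.castLE hq ((X i)⁻¹ k))

/-- Copy `k` carries the label `k` at every site. The two labels differ, so the other half of the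
index determines the permutation at each site; this yields dual functionals, and coefficients are
unique. -/
lemma permState_testIndex (hq : 2 ≤ q) {N : ℕ} (X Y : Fin N → Equiv.Perm (Fin 2)) :
    permState q Y (testIndex hq X) = if X = Y then ((q : ℂ)⁻¹) ^ N else 0 := by
  change (∏ i : Fin N, _) = _
  simp only [testIndex, Real.sq_sqrt (Nat.cast_nonneg (α := ℝ) q), Complex.ofReal_inv,
    Complex.ofReal_natCast]
  have h : ∀ i, (∀ k : Fin 2, Fin.castLE hq ((X i)⁻¹ k) = Fin.castLE hq ((Y i)⁻¹ k)) ↔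
      X i = Y i := by
    intro i
    constructor
    · intro h
      have : (X i)⁻¹ = (Y i)⁻¹ := Equiv.ext fun k => Fin.castLE_injective hq (h k)
      exact inv_injective this
    · intro h k
      rw [h]
  simp only [h]
  rw [Finset.prod_ite_zero]
  simp [funext_iff]

/-- The coefficient of a permutation product state. -/
noncomputable def permCoeff (hq : 2 ≤ q) {N : ℕ} (X : Fin N → Equiv.Perm (Fin 2)) :
    EuclideanSpace ℂ (MomentIndex N q 2) →ₗ[ℂ] ℂ where
  toFun v := (q : ℂ) ^ N * v (testIndex hq X)
  map_add' v w := by simp [mul_add]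
  map_smul' c v := by simp [mul_left_comm]

lemma permCoeff_permState (hq : 2 ≤ q) {N : ℕ} (X Y : Fin N → Equiv.Perm (Fin 2)) :
    permCoeff hq X (permState q Y) = if X = Y then 1 else 0 := by
  have hq0 : (q : ℂ) ≠ 0 := by
    have : q ≠ 0 := by omega
    exact_mod_cast this
  change (q : ℂ) ^ N * permState q Y (testIndex hq X) = _
  rw [permState_testIndex]
  split_ifs
  · rw [← mul_pow, mul_inv_cancel₀ hq0, one_pow]
  · simp

lemma permCoeff_sum (hq : 2 ≤ q) (l : Fin 2) (c : (Fin n → Equiv.Perm (Fin 2)) → ℂ)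
    (W : Fin n → Equiv.Perm (Fin 2)) :
    permCoeff hq (spread l W) (∑ Z, c Z • permState q (spread l Z)) = c W := by
  simp [permCoeff_permState, (spread_injective l).eq_iff]

end Evaluation

/-! ### Domain walls and the `ℓ¹` contraction -/

section Transitions

variable {n : ℕ+} {q : ℕ}

lemma siteEquiv_zero_one (j : Fin n) : siteEquiv n 0 (j, 1) = siteEquiv n 1 (j, 0) := rfl

lemma siteEquiv_succ_zero (j : Fin n) : siteEquiv n 0 (j + 1, 0) = siteEquiv n 1 (j, 1) := by
  apply Fin.ext
  change (2 * ((j + 1 : Fin n) : ℕ) + 0 + 0) % (2 * n) = (2 * (j : ℕ) + 1 + 1) % (2 * n)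
  rw [Fin.val_add, Fin.val_one', Nat.add_mod_mod, add_zero, add_zero, ← Nat.mul_mod_mul_left,
    Nat.mod_mod]
  rfl

/-- The weight with which a layer of gates maps the half-density configuration `Z` to `W`. -/
noncomputable def layerWeight (q : ℕ) (Z W : Fin n → Equiv.Perm (Fin 2)) : ℝ :=
  ∏ j, gateWeight q (Z j) (Z (j + 1)) (W j)

/-- Translation by one pair of sites. -/
def shiftBack (Z : Fin n → Equiv.Perm (Fin 2)) : Fin n → Equiv.Perm (Fin 2) := fun j => Z (j - 1)

lemma layerOp_one_permState (hq : 2 ≤ q) (Z : Fin n → Equiv.Perm (Fin 2)) :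
    layerOp n q 1 (permState q (spread 0 Z))
      = ∑ W, (layerWeight q Z W : ℂ) • permState q (spread 1 W) := by
  rw [layerOp_permState hq]
  refine Finset.sum_congr rfl fun W _ => ?_
  simp only [← siteEquiv_zero_one, ← siteEquiv_succ_zero, spread_siteEquiv, layerWeight]
  push_cast
  rfl

/-- The pairs `j` and `j + 1` of layer `1` are straddled by gate `j + 1` of layer `0`, whereas in
the other direction it is gate `j`. The shift absorbs this offset, so both layers share one weight.
-/
lemma layerOp_zero_permState (hq : 2 ≤ q) (Z : Fin n → Equiv.Perm (Fin 2)) :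
    layerOp n q 0 (permState q (spread 1 Z))
      = ∑ W, (layerWeight q Z W : ℂ) • permState q (spread 0 (shiftBack W)) := by
  rw [layerOp_permState hq, ← (Equiv.arrowCongr (Equiv.addRight (1 : Fin n))
    (Equiv.refl (Equiv.Perm (Fin 2)))).sum_comp]
  refine Finset.sum_congr rfl fun W _ => ?_
  have h : (Equiv.arrowCongr (Equiv.addRight (1 : Fin n)) (Equiv.refl (Equiv.Perm (Fin 2)))) W
      = shiftBack W := by
    funext j
    simp [Equiv.arrowCongr, shiftBack, sub_eq_add_neg]
  rw [h, ← Equiv.prod_comp (Equiv.addRight (1 : Fin n))]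
  simp only [Equiv.coe_addRight, siteEquiv_succ_zero, siteEquiv_zero_one, spread_siteEquiv,
    layerWeight, shiftBack, add_sub_cancel_right]
  push_cast
  rfl

/-- The factor by which a layer contracts a single domain wall. -/
noncomputable def wallFactor (q : ℕ) : ℝ := 2 * q / (q ^ 2 + 1)

lemma wallFactor_nonneg (q : ℕ) : 0 ≤ wallFactor q := by
  unfold wallFactor
  positivity

lemma wallFactor_pos (hq : 2 ≤ q) : 0 < wallFactor q := by
  unfold wallFactor
  have : 0 < q := by omega
  positivity

lemma wallFactor_lt_one (hq : 2 ≤ q) : wallFactor q < 1 := by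
  have : (2 : ℝ) ≤ q := by exact_mod_cast hq
  rw [wallFactor, div_lt_one (by positivity)]
  nlinarith

lemma gateWeight_nonneg (q : ℕ) (σ τ ρ : Equiv.Perm (Fin 2)) : 0 ≤ gateWeight q σ τ ρ := by
  unfold gateWeight
  split_ifs <;> positivity

lemma sum_gateWeight (q : ℕ) (σ τ : Equiv.Perm (Fin 2)) :
    ∑ ρ, gateWeight q σ τ ρ = if σ = τ then 1 else wallFactor q := by
  unfold gateWeight
  split_ifs with h
  · simp
  · rw [perm_two_sum, wallFactor]
    ring

lemma layerWeight_nonneg (q : ℕ) (Z W : Fin n → Equiv.Perm (Fin 2)) : 0 ≤ layerWeight q Z W :=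
  Finset.prod_nonneg fun _ _ => gateWeight_nonneg _ _ _ _

lemma sum_layerWeight (q : ℕ) (Z : Fin n → Equiv.Perm (Fin 2)) :
    ∑ W, layerWeight q Z W = ∏ j, if Z j = Z (j + 1) then 1 else wallFactor q := by
  simp only [← sum_gateWeight, Finset.prod_univ_sum, Fintype.piFinset_univ, layerWeight]

/-- A configuration without domain walls. -/
def IsConst (Z : Fin n → Equiv.Perm (Fin 2)) : Prop := ∃ σ, Z = fun _ => σ

/-- Starting just after `j₀`, all sites of the ring are reached in `n - 1` steps without crossing
the bond at `j₀`. Thus a ring cannot carry exactly one wall. -/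
lemma isConst_of_forall_ne {Z : Fin n → Equiv.Perm (Fin 2)} (j₀ : Fin n)
    (h : ∀ j, j ≠ j₀ → Z j = Z (j + 1)) : IsConst Z := by
  have key : ∀ (m : ℕ) (hm : m < (n : ℕ)), Z (j₀ + 1 + ⟨m, hm⟩) = Z (j₀ + 1) := by
    intro m
    induction m with
    | zero => intro hm; exact congrArg Z (add_zero _)
    | succ m ih =>
      intro hm
      have h1 : (⟨m + 1, hm⟩ : Fin n) = ⟨m, by omega⟩ + 1 := by
        apply Fin.ext
        rw [Fin.val_add, Fin.val_one', Nat.add_mod_mod]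
        exact (Nat.mod_eq_of_lt hm).symm
      rw [h1, ← add_assoc, ← h, ih]
      intro h2
      have h3 : (⟨m + 1, hm⟩ : Fin n) = 0 := by
        rw [h1]
        rw [add_assoc, add_comm 1] at h2
        exact left_eq_add.1 h2.symm
      exact absurd (congrArg Fin.val h3) (Nat.succ_ne_zero m)
  refine ⟨Z (j₀ + 1), funext fun i => ?_⟩
  have h1 := key (i - (j₀ + 1)).val (i - (j₀ + 1)).2
  rw [Fin.eta, add_sub_cancel] at h1
  exact h1

lemma exists_two_walls {Z : Fin n → Equiv.Perm (Fin 2)} (hZ : ¬IsConst Z) :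
    ∃ i j, i ≠ j ∧ Z i ≠ Z (i + 1) ∧ Z j ≠ Z (j + 1) := by
  by_contra hcon
  push Not at hcon
  by_cases h : ∃ i, Z i ≠ Z (i + 1)
  · obtain ⟨i, hi⟩ := h
    exact hZ (isConst_of_forall_ne i fun j hj => hcon i j hj.symm hi)
  · push Not at h
    exact hZ (isConst_of_forall_ne 0 fun j _ => h j)

/-- The total weight is a product over bonds: two walls give the bound, and all other factors are at
most `1`. -/
lemma sum_layerWeight_le (hq : 2 ≤ q) {Z : Fin n → Equiv.Perm (Fin 2)} (hZ : ¬IsConst Z) :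
    ∑ W, layerWeight q Z W ≤ wallFactor q ^ 2 := by
  obtain ⟨i, j, hij, hi, hj⟩ := exists_two_walls hZ
  have h0 := wallFactor_nonneg q
  have h1 := (wallFactor_lt_one hq).le
  rw [sum_layerWeight, ← Finset.mul_prod_erase _ _ (Finset.mem_univ i),
    ← Finset.mul_prod_erase _ _ (Finset.mem_erase.2 ⟨hij.symm, Finset.mem_univ j⟩), if_neg hi,
    if_neg hj, ← mul_assoc, ← sq]
  refine mul_le_of_le_one_right (by positivity) (Finset.prod_le_one ?_ ?_)
  · intro k _
    split_ifs <;> linarith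
  · intro k _
    split_ifs <;> linarith

lemma layerWeight_const (q : ℕ) (σ : Equiv.Perm (Fin 2)) (W : Fin n → Equiv.Perm (Fin 2)) :
    layerWeight q (fun _ => σ) W = if W = fun _ => σ then 1 else 0 := by
  simp only [layerWeight, gateWeight, if_true]
  rw [Finset.prod_ite_zero]
  simp [funext_iff]

lemma isConst_shiftBack {Z : Fin n → Equiv.Perm (Fin 2)} : IsConst (shiftBack Z) ↔ IsConst Z := by
  constructor
  · rintro ⟨σ, h⟩
    refine ⟨σ, funext fun j => ?_⟩
    have := congrFun h (j + 1)
    simpa [shiftBack] using this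
  · rintro ⟨σ, rfl⟩
    exact ⟨σ, rfl⟩

/-- The weight with which one period maps the configuration `Z` to `Y`. -/
noncomputable def periodWeight (q : ℕ) (Z Y : Fin n → Equiv.Perm (Fin 2)) : ℝ :=
  ∑ W, layerWeight q Z W * layerWeight q (shiftBack W) Y

lemma periodWeight_nonneg (q : ℕ) (Z Y : Fin n → Equiv.Perm (Fin 2)) :
    0 ≤ periodWeight q Z Y :=
  Finset.sum_nonneg fun _ _ => mul_nonneg (layerWeight_nonneg _ _ _) (layerWeight_nonneg _ _ _)

lemma transferMatrix_permState (hq : 2 ≤ q) (Z : Fin n → Equiv.Perm (Fin 2)) :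
    transferMatrix n q 2 (permState q (spread 1 Z))
      = ∑ Y, (periodWeight q Z Y : ℂ) • permState q (spread 1 Y) := by
  rw [transferMatrix_apply, layerOp_zero_permState hq, map_sum]
  simp only [map_smul, layerOp_one_permState hq, Finset.smul_sum, smul_smul, periodWeight,
    Complex.ofReal_sum, Finset.sum_smul, Complex.ofReal_mul]
  rw [Finset.sum_comm]

-- An intermediate configuration that is constant stays constant and drops out of the sum; for any
-- other, each of the two layers contributes `w²`.
open Classical in
lemma sum_periodWeight_le (hq : 2 ≤ q) {Z : Fin n → Equiv.Perm (Fin 2)} (hZ : ¬IsConst Z) :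
    ∑ Y with ¬IsConst Y, periodWeight q Z Y ≤ wallFactor q ^ 4 := by
  have h0 := wallFactor_nonneg q
  have h1 : ∀ W : Fin n → Equiv.Perm (Fin 2),
      ∑ Y with ¬IsConst Y, layerWeight q (shiftBack W) Y ≤ wallFactor q ^ 2 := by
    intro W
    by_cases hW : IsConst W
    · obtain ⟨σ, h⟩ := isConst_shiftBack.2 hW
      rw [h, Finset.sum_eq_zero]
      · positivity
      · intro Y hY
        rw [layerWeight_const, if_neg]
        rintro rfl
        exact (Finset.mem_filter.1 hY).2 ⟨σ, rfl⟩
    · refine le_trans (Finset.sum_le_sum_of_subset_of_nonneg (Finset.filter_subset _ _)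
        fun _ _ _ => layerWeight_nonneg _ _ _) (sum_layerWeight_le hq ?_)
      rwa [isConst_shiftBack]
  calc ∑ Y with ¬IsConst Y, periodWeight q Z Y
      = ∑ W, layerWeight q Z W * ∑ Y with ¬IsConst Y, layerWeight q (shiftBack W) Y := by
        simp only [periodWeight, Finset.mul_sum]
        rw [Finset.sum_comm]
    _ ≤ ∑ W, layerWeight q Z W * wallFactor q ^ 2 :=
        Finset.sum_le_sum fun W _ => mul_le_mul_of_nonneg_left (h1 W) (layerWeight_nonneg _ _ _)
    _ = (∑ W, layerWeight q Z W) * wallFactor q ^ 2 := by rw [Finset.sum_mul]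
    _ ≤ wallFactor q ^ 2 * wallFactor q ^ 2 :=
        mul_le_mul_of_nonneg_right (sum_layerWeight_le hq hZ) (by positivity)
    _ = wallFactor q ^ 4 := by ring

lemma periodWeight_const (q : ℕ) (σ : Equiv.Perm (Fin 2)) (Y : Fin n → Equiv.Perm (Fin 2)) :
    periodWeight q (fun _ => σ) Y = if Y = fun _ => σ then 1 else 0 := by
  simp only [periodWeight, layerWeight_const, ite_mul, one_mul, zero_mul, Finset.sum_ite_eq',
    Finset.mem_univ, if_true]
  exact layerWeight_const q σ Y

/-- The action of one period on coefficients. -/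
noncomputable def periodCoeff (q : ℕ) (c : (Fin n → Equiv.Perm (Fin 2)) → ℂ) :
    (Fin n → Equiv.Perm (Fin 2)) → ℂ :=
  fun Y => ∑ Z, c Z * periodWeight q Z Y

lemma transferMatrix_sum_permState (hq : 2 ≤ q) (c : (Fin n → Equiv.Perm (Fin 2)) → ℂ) :
    transferMatrix n q 2 (∑ Z, c Z • permState q (spread 1 Z))
      = ∑ Y, periodCoeff q c Y • permState q (spread 1 Y) := by
  simp only [map_sum, map_smul, transferMatrix_permState hq, Finset.smul_sum, smul_smul,
    periodCoeff, Finset.sum_smul]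
  rw [Finset.sum_comm]

open Classical in
/-- The `ℓ¹` norm of the coefficients of the configurations with domain walls. -/
noncomputable def wallNorm (c : (Fin n → Equiv.Perm (Fin 2)) → ℂ) : ℝ :=
  ∑ Z with ¬IsConst Z, ‖c Z‖

lemma wallNorm_nonneg (c : (Fin n → Equiv.Perm (Fin 2)) → ℂ) : 0 ≤ wallNorm c :=
  Finset.sum_nonneg fun _ _ => norm_nonneg _

/-- Constant configurations feed nothing into nonconstant ones, so the nonconstant coefficients
evolve by a nonnegative matrix of their own, whose `ℓ¹` operator norm is controlled by the total
outgoing weight. -/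
lemma wallNorm_periodCoeff_le (hq : 2 ≤ q) (c : (Fin n → Equiv.Perm (Fin 2)) → ℂ) :
    wallNorm (periodCoeff q c) ≤ wallFactor q ^ 4 * wallNorm c := by
  classical
  have h1 : ∀ Y, ¬IsConst Y →
      ‖periodCoeff q c Y‖ ≤ ∑ Z with ¬IsConst Z, ‖c Z‖ * periodWeight q Z Y := by
    intro Y hY
    refine (norm_sum_le _ _).trans ?_
    rw [Finset.sum_filter]
    refine Finset.sum_le_sum fun Z _ => ?_
    split_ifs with hZ
    · obtain ⟨σ, rfl⟩ := hZ
      rw [periodWeight_const, if_neg]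
      · simp
      · rintro rfl
        exact hY ⟨σ, rfl⟩
    · rw [norm_mul, Complex.norm_real, Real.norm_of_nonneg (periodWeight_nonneg q Z Y)]
  calc wallNorm (periodCoeff q c)
      ≤ ∑ Y with ¬IsConst Y, ∑ Z with ¬IsConst Z, ‖c Z‖ * periodWeight q Z Y :=
        Finset.sum_le_sum fun Y hY => h1 Y (Finset.mem_filter.1 hY).2
    _ = ∑ Z with ¬IsConst Z, ‖c Z‖ * ∑ Y with ¬IsConst Y, periodWeight q Z Y := by
        rw [Finset.sum_comm]
        simp only [Finset.mul_sum]
    _ ≤ ∑ Z with ¬IsConst Z, ‖c Z‖ * wallFactor q ^ 4 :=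
        Finset.sum_le_sum fun Z hZ => mul_le_mul_of_nonneg_left
          (sum_periodWeight_le hq (Finset.mem_filter.1 hZ).2) (norm_nonneg _)
    _ = wallFactor q ^ 4 * wallNorm c := by
        rw [← Finset.sum_mul, mul_comm]
        rfl

end Transitions

/-! ### Eigenvalues and convergence to the unit projection -/

section Spectrum

variable {n : ℕ+} {q : ℕ}

lemma layerOp_permState_const (hq : 2 ≤ q) (l : Fin 2) (σ : Equiv.Perm (Fin 2)) :
    layerOp n q l (permState q fun _ => σ) = permState q fun _ => σ := by
  rw [layerOp_permState hq, Finset.sum_eq_single (fun _ => σ)]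
  · simp [gateWeight]
    rfl
  · intro Z _ hZ
    obtain ⟨j, hj⟩ := Function.ne_iff.1 hZ
    rw [Finset.prod_eq_zero (Finset.mem_univ j) (by simp [gateWeight, hj]), zero_smul]
  · simp

lemma eq_of_wallNorm_eq_zero {c : (Fin n → Equiv.Perm (Fin 2)) → ℂ} (hc : wallNorm c = 0) :
    ∀ Z, ¬IsConst Z → c Z = 0 := by
  classical
  intro Z hZ
  have := (Finset.sum_eq_zero_iff_of_nonneg fun _ _ => norm_nonneg _).1 hc Z (by simp [hZ])
  exact norm_eq_zero.1 this

lemma layerOp_sum_of_wallNorm_eq_zero (hq : 2 ≤ q) (l : Fin 2)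
    {c : (Fin n → Equiv.Perm (Fin 2)) → ℂ} (hc : wallNorm c = 0) :
    layerOp n q l (∑ Z, c Z • permState q (spread 1 Z))
      = ∑ Z, c Z • permState q (spread 1 Z) := by
  rw [map_sum]
  refine Finset.sum_congr rfl fun Z _ => ?_
  by_cases hZ : IsConst Z
  · obtain ⟨σ, rfl⟩ := hZ
    rw [map_smul]
    congr 1
    exact layerOp_permState_const hq l σ
  · rw [eq_of_wallNorm_eq_zero hc Z hZ]
    simp

/-- For `μ ≠ 0` an eigenvector lies in the range of `T`, hence is a combination of configurations.
By uniqueness its coefficients satisfy the same eigenvalue equation, to which the contraction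
applies. -/
lemma eigenvector_cases (hq : 2 ≤ q) {μ : ℂ} (hμ : μ ≠ 0)
    {v : EuclideanSpace ℂ (MomentIndex (2 * n) q 2)} (hv : transferMatrix n q 2 v = μ • v) :
    ∃ c : (Fin n → Equiv.Perm (Fin 2)) → ℂ, v = ∑ Z, c Z • permState q (spread 1 Z) ∧
      ‖μ‖ * wallNorm c ≤ wallFactor q ^ 4 * wallNorm c := by
  obtain ⟨c₀, h₀⟩ := layerOp_mem_span hq 1 (layerOp n q 0 v)
  rw [← transferMatrix_apply, hv] at h₀
  have h1 : v = ∑ Z, (μ⁻¹ * c₀ Z) • permState q (spread 1 Z) := by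
    simp only [← smul_smul, ← Finset.smul_sum]
    rw [← h₀, smul_smul, inv_mul_cancel₀ hμ, one_smul]
  refine ⟨_, h1, ?_⟩
  set c : (Fin n → Equiv.Perm (Fin 2)) → ℂ := fun Z => μ⁻¹ * c₀ Z with hc
  have h2 : periodCoeff q c = fun Z => μ * c Z := by
    funext W
    rw [← permCoeff_sum hq 1 (periodCoeff q c), ← transferMatrix_sum_permState hq, ← h1, hv, h1,
      map_smul, permCoeff_sum]
    rfl
  have h3 := wallNorm_periodCoeff_le hq c
  rw [h2] at h3
  refine le_trans (le_of_eq ?_) h3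
  simp only [wallNorm, norm_mul, Finset.mul_sum]

/-- If the nonconstant part vanishes the eigenvector is fixed and `μ = 1`; otherwise its positive
norm can be cancelled. -/
theorem norm_eigenvalue_le (hq : 2 ≤ q) {μ : ℂ}
    (hμ : Module.End.HasEigenvalue (transferMatrix n q 2) μ) (h1 : μ ≠ 1) :
    ‖μ‖ ≤ wallFactor q ^ 4 := by
  by_cases h0 : μ = 0
  · rw [h0, norm_zero]
    exact pow_nonneg (wallFactor_nonneg q) 4
  obtain ⟨v, hv⟩ := hμ.exists_hasEigenvector
  obtain ⟨c, hc, hle⟩ := eigenvector_cases hq h0 hv.apply_eq_smul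
  rcases (wallNorm_nonneg c).eq_or_lt with h | h
  · exfalso
    have h2 : transferMatrix n q 2 v = v := by
      rw [transferMatrix_apply, hc, layerOp_sum_of_wallNorm_eq_zero hq 0 h.symm,
        layerOp_sum_of_wallNorm_eq_zero hq 1 h.symm]
    rw [hv.apply_eq_smul] at h2
    have h3 : (μ - 1) • v = 0 := by rw [sub_smul, h2, one_smul, sub_self]
    exact (smul_eq_zero.1 h3).elim (sub_ne_zero.2 h1) hv.2
  · exact le_of_mul_le_mul_right hle h

lemma exists_const_of_transferMatrix_eq_self (hq : 2 ≤ q)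
    {v : EuclideanSpace ℂ (MomentIndex (2 * n) q 2)} (hv : transferMatrix n q 2 v = v) :
    ∃ c : (Fin n → Equiv.Perm (Fin 2)) → ℂ, v = ∑ Z, c Z • permState q (spread 1 Z) ∧
      wallNorm c = 0 := by
  obtain ⟨c, hc, hle⟩ := eigenvector_cases hq one_ne_zero (by rw [hv, one_smul])
  refine ⟨c, hc, ?_⟩
  have h1 : wallFactor q ^ 4 < 1 :=
    pow_lt_one₀ (wallFactor_nonneg q) (wallFactor_lt_one hq) (by norm_num)
  have h2 := wallNorm_nonneg c
  rw [norm_one, one_mul] at hle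
  nlinarith

lemma layerOp_of_transferMatrix_eq_self (hq : 2 ≤ q) (l : Fin 2)
    {v : EuclideanSpace ℂ (MomentIndex (2 * n) q 2)} (hv : transferMatrix n q 2 v = v) :
    layerOp n q l v = v := by
  obtain ⟨c, hc, h0⟩ := exists_const_of_transferMatrix_eq_self hq hv
  rw [hc, layerOp_sum_of_wallNorm_eq_zero hq l h0]

lemma unitProjection_of_transferMatrix_eq_self
    {v : EuclideanSpace ℂ (MomentIndex (2 * n) q 2)} (hv : transferMatrix n q 2 v = v) :
    unitProjection n q 2 v = v :=
  Submodule.starProjection_eq_self_iff.2 (Module.End.mem_eigenspace_iff.2 (by rw [hv, one_smul]))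

lemma transferMatrix_permState_const (hq : 2 ≤ q) (σ : Equiv.Perm (Fin 2)) :
    transferMatrix n q 2 (permState q fun _ => σ) = permState q fun _ => σ := by
  rw [transferMatrix_apply, layerOp_permState_const hq, layerOp_permState_const hq]

/-- A fixed vector of `T` is fixed by both layers, which are symmetric, so its overlaps with `T v`
and `v` agree. Thus the orthogonal projection commutes past `T` although `T` need not be normal. -/
lemma unitProjection_transferMatrix (hq : 2 ≤ q)
    (v : EuclideanSpace ℂ (MomentIndex (2 * n) q 2)) :
    unitProjection n q 2 (transferMatrix n q 2 v) = unitProjection n q 2 v := by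
  rw [← sub_eq_zero, ← map_sub]
  refine (Submodule.starProjection_apply_eq_zero_iff _).2 ?_
  rw [Submodule.mem_orthogonal]
  intro f hf
  have hf1 : transferMatrix n q 2 f = f := by
    rw [Module.End.mem_eigenspace_iff.1 hf, one_smul]
  rw [inner_sub_right, transferMatrix_apply, ← layerOp_isSymmetric hq 1,
    layerOp_of_transferMatrix_eq_self hq 1 hf1, ← layerOp_isSymmetric hq 0,
    layerOp_of_transferMatrix_eq_self hq 0 hf1, sub_self]

lemma unitProjection_transferMatrix_pow (hq : 2 ≤ q) (p : ℕ)
    (v : EuclideanSpace ℂ (MomentIndex (2 * n) q 2)) :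
    unitProjection n q 2 ((transferMatrix n q 2 ^ p) v) = unitProjection n q 2 v := by
  induction p with
  | zero => simp
  | succ p ih => rw [pow_succ', Module.End.mul_apply, unitProjection_transferMatrix hq, ih]

lemma norm_sub_unitProjection_le (v : EuclideanSpace ℂ (MomentIndex (2 * n) q 2)) :
    ‖v - unitProjection n q 2 v‖ ≤ ‖v‖ := by
  have h : v - unitProjection n q 2 v
      = (Module.End.eigenspace (transferMatrix n q 2) 1)ᗮ.starProjection v := by
    rw [Submodule.starProjection_orthogonal']
    rfl
  rw [h]
  exact Submodule.norm_starProjection_apply_le _ _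

lemma norm_sum_sub_unitProjection_le (hq : 2 ≤ q) (c : (Fin n → Equiv.Perm (Fin 2)) → ℂ) :
    ‖(∑ Z, c Z • permState q (spread 1 Z)) -
      unitProjection n q 2 (∑ Z, c Z • permState q (spread 1 Z))‖
      ≤ wallNorm c * ∑ Z : Fin n → Equiv.Perm (Fin 2), ‖permState q (spread 1 Z)‖ := by
  classical
  rw [map_sum, ← Finset.sum_sub_distrib, wallNorm, Finset.sum_mul, Finset.sum_filter]
  refine (norm_sum_le _ _).trans (Finset.sum_le_sum fun Z _ => ?_)
  split_ifs with hZ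
  · obtain ⟨σ, rfl⟩ := hZ
    rw [map_smul]
    have h := unitProjection_of_transferMatrix_eq_self (transferMatrix_permState_const (n := n) hq σ)
    have h2 : permState q (spread 1 fun _ : Fin n => σ) = permState q fun _ => σ := rfl
    rw [h2, h, sub_self, norm_zero]
  · refine (norm_sub_unitProjection_le _).trans ?_
    rw [norm_smul]
    exact mul_le_mul_of_nonneg_left (Finset.single_le_sum
      (f := fun Z : Fin n → Equiv.Perm (Fin 2) => ‖permState q (spread 1 Z)‖)
      (fun _ _ => norm_nonneg _) (Finset.mem_univ Z)) (norm_nonneg _)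

/-- Powers of the transfer matrix converge exponentially fast to the unit projection. -/
theorem exists_norm_transferMatrix_pow_sub_le (hq : 2 ≤ q) (n : ℕ+) :
    ∃ B : ℝ, 0 ≤ B ∧ ∀ (p : ℕ) (v : EuclideanSpace ℂ (MomentIndex (2 * n) q 2)),
      ‖(transferMatrix n q 2 ^ p) v - unitProjection n q 2 v‖
        ≤ B * (wallFactor q ^ 4) ^ p * ‖v‖ := by
  -- One application of `T` brings any vector into the span of configurations; the coefficients
  -- after it are bounded functionals of `v`.
  let φ : (Fin n → Equiv.Perm (Fin 2)) →
      EuclideanSpace ℂ (MomentIndex (2 * n) q 2) →L[ℂ] ℂ := fun Z =>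
    LinearMap.toContinuousLinearMap (permCoeff hq (spread 1 Z) ∘ₗ transferMatrix n q 2)
  let S := ∑ Z : Fin n → Equiv.Perm (Fin 2), ‖permState q (spread 1 Z)‖
  have hS : 0 ≤ S := Finset.sum_nonneg fun _ _ => norm_nonneg _
  have hφ0 : 0 ≤ ∑ Z, ‖φ Z‖ := Finset.sum_nonneg fun _ _ => norm_nonneg _
  have hl : 0 < wallFactor q ^ 4 := pow_pos (wallFactor_pos hq) 4
  have hφ : ∀ v Z, permCoeff hq (spread 1 Z) (transferMatrix n q 2 v) = φ Z v := fun _ _ => rfl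
  have hT : ∀ v, transferMatrix n q 2 v = ∑ Z, φ Z v • permState q (spread 1 Z) := by
    intro v
    obtain ⟨c, hc⟩ := layerOp_mem_span hq 1 (layerOp n q 0 v)
    rw [← transferMatrix_apply] at hc
    simp only [← hφ, hc, permCoeff_sum]
  have hpow : ∀ p v, ∃ c : (Fin n → Equiv.Perm (Fin 2)) → ℂ,
      (transferMatrix n q 2 ^ (p + 1)) v = ∑ Z, c Z • permState q (spread 1 Z) ∧
      wallNorm c ≤ (wallFactor q ^ 4) ^ p * ((∑ Z, ‖φ Z‖) * ‖v‖) := by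
    classical
    intro p v
    induction p with
    | zero =>
      refine ⟨fun Z => φ Z v, by rw [zero_add, pow_one, hT], ?_⟩
      rw [pow_zero, one_mul, Finset.sum_mul]
      refine le_trans (Finset.sum_le_sum_of_subset_of_nonneg (Finset.filter_subset _ _)
        fun _ _ _ => norm_nonneg _) (Finset.sum_le_sum fun Z _ => (φ Z).le_opNorm v)
    | succ p ih =>
      obtain ⟨c, h1, h2⟩ := ih
      refine ⟨periodCoeff q c, ?_, ?_⟩
      · rw [pow_succ', Module.End.mul_apply, h1, transferMatrix_sum_permState hq]
      · refine (wallNorm_periodCoeff_le hq c).trans ?_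
        rw [pow_succ' (wallFactor q ^ 4), mul_assoc]
        exact mul_le_mul_of_nonneg_left h2 hl.le
  -- The summand `1` serves `p = 0`; the inverse factor pays for the application of `T` spent on
  -- entering the span.
  refine ⟨1 + (wallFactor q ^ 4)⁻¹ * ((∑ Z, ‖φ Z‖) * S), by positivity, fun p v => ?_⟩
  rcases p with _ | p
  · rw [pow_zero, pow_zero, mul_one, Module.End.one_apply]
    refine (norm_sub_unitProjection_le v).trans (le_mul_of_one_le_left (norm_nonneg v) ?_)
    have : 0 ≤ (wallFactor q ^ 4)⁻¹ * ((∑ Z, ‖φ Z‖) * S) := by positivity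
    linarith
  · obtain ⟨c, h1, h2⟩ := hpow p v
    -- The error becomes a vector in the span minus its own projection, so only its nonconstant part
    -- contributes.
    rw [← unitProjection_transferMatrix_pow hq (p + 1) v, h1]
    refine (norm_sum_sub_unitProjection_le hq c).trans ?_
    refine (mul_le_mul_of_nonneg_right h2 hS).trans ?_
    have e : (wallFactor q ^ 4) ^ p * ((∑ Z, ‖φ Z‖) * ‖v‖) * S
        = ((wallFactor q ^ 4)⁻¹ * ((∑ Z, ‖φ Z‖) * S)) * (wallFactor q ^ 4) ^ (p + 1) * ‖v‖ := by
      rw [pow_succ (wallFactor q ^ 4) p]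
      generalize wallFactor q ^ 4 = L at hl ⊢
      field_simp
    rw [e]
    gcongr
    linarith

end Spectrum

/-! ### Single domains and the slow mode -/

section Arcs

variable {n : ℕ+} {q : ℕ}

/-- The configuration with a single domain of length `d`, starting at `i`. -/
def arc (i : Fin n) (d : ℕ) : Fin n → Equiv.Perm (Fin 2) :=
  fun j => if ((j - i : Fin n) : ℕ) < d then Equiv.swap 0 1 else 1

lemma arc_add (i : Fin n) (d : ℕ) (m : Fin n) :
    arc i d (m + i) = if (m : ℕ) < d then Equiv.swap 0 1 else 1 := by
  simp [arc]

lemma arc_sub_one_add (i : Fin n) (d : ℕ) (m : Fin n) :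
    arc (i - 1) d (m + i) = if ((m + 1 : Fin n) : ℕ) < d then Equiv.swap 0 1 else 1 := by
  have h : m + i - (i - 1) = m + 1 := by abel
  simp [arc, h]

lemma arc_add_add_one (i : Fin n) (d : ℕ) (m : Fin n) :
    arc i d (m + i + 1) = if ((m + 1 : Fin n) : ℕ) < d then Equiv.swap 0 1 else 1 := by
  have h : m + i + 1 - i = m + 1 := by abel
  simp [arc, h]

lemma val_add_one_eq (m : Fin n) :
    ((m + 1 : Fin n) : ℕ) = if (m : ℕ) + 1 = n then 0 else (m : ℕ) + 1 := by
  rw [Fin.val_add, Fin.val_one', Nat.add_mod_mod]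
  split_ifs with h
  · rw [h, Nat.mod_self]
  · have := m.2
    exact Nat.mod_eq_of_lt (by omega)

lemma prod_eq_mul_mul_prod_erase {M : Type*} [CommMonoid M] {N : ℕ} {a b : Fin N} (hab : a ≠ b)
    (f : Fin N → M) :
    ∏ m, f m = f a * (f b * ∏ m ∈ (Finset.univ.erase a).erase b, f m) := by
  rw [← Finset.mul_prod_erase _ _ (Finset.mem_univ a),
    ← Finset.mul_prod_erase _ _ (Finset.mem_erase.2 ⟨hab.symm, Finset.mem_univ b⟩)]

/-- Relative to `i`, the walls sit at the gates `e` and `n - 1`, distinct because `e + 1 < n`. Each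
has two outputs of weight `w/2`, all other gates are forced, and the four combinations are the four
arcs. -/
lemma layerWeight_arc (q : ℕ) (i : Fin n) {e : ℕ} (he : e + 1 < n)
    (W : Fin n → Equiv.Perm (Fin 2)) :
    layerWeight q (arc i (e + 1)) W = (wallFactor q / 2) ^ 2 *
      ((if W = arc i e then 1 else 0) + (if W = arc (i - 1) (e + 1) then 1 else 0) +
        (if W = arc i (e + 1) then 1 else 0) + (if W = arc (i - 1) (e + 2) then 1 else 0)) := by
  let a : Fin n := ⟨e, by omega⟩
  let b : Fin n := ⟨n - 1, by have := n.pos; omega⟩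
  have hab : a ≠ b := by
    intro h
    have h2 : e = (n : ℕ) - 1 := congrArg Fin.val h
    omega
  have hn := n.pos
  have ha : ((a + 1 : Fin n) : ℕ) = e + 1 := by
    rw [val_add_one_eq, if_neg]
    change e + 1 ≠ n
    omega
  have hb : ((b + 1 : Fin n) : ℕ) = 0 := by
    rw [val_add_one_eq, if_pos]
    change (n : ℕ) - 1 + 1 = n
    omega
  have hva : (a : ℕ) = e := rfl
  have hvb : (b : ℕ) = n - 1 := rfl
  -- The indicator at the forced gates, common to the layer weight and to all four arcs.
  let R : ℝ := ∏ m ∈ (Finset.univ.erase a).erase b,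
    if W (m + i) = (if (m : ℕ) < e then Equiv.swap 0 1 else 1) then 1 else 0
  have hmem : ∀ m ∈ (Finset.univ.erase a).erase b,
      (m : ℕ) ≠ e ∧ ((m + 1 : Fin n) : ℕ) = (m : ℕ) + 1 := by
    intro m hm
    rw [Finset.mem_erase, Finset.mem_erase] at hm
    refine ⟨fun h => hm.2.1 (Fin.ext h), ?_⟩
    rw [val_add_one_eq, if_neg]
    intro h
    exact hm.1 (Fin.ext (by rw [hvb]; omega))
  have hind : ∀ A : Fin n → Equiv.Perm (Fin 2),
      (∀ m : Fin n, m ∈ (Finset.univ.erase a).erase b →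
        A (m + i) = if (m : ℕ) < e then Equiv.swap 0 1 else 1) →
      (if W = A then (1 : ℝ) else 0) = (if W (a + i) = A (a + i) then 1 else 0) *
        ((if W (b + i) = A (b + i) then 1 else 0) * R) := by
    intro A hA
    have h1 : (if W = A then (1 : ℝ) else 0)
        = ∏ m, if W (m + i) = A (m + i) then (1 : ℝ) else 0 := by
      refine Eq.trans ?_ (Equiv.prod_comp (Equiv.addRight i)
        fun m => if W m = A m then (1 : ℝ) else 0).symm
      rw [Finset.prod_ite_zero]
      simp [funext_iff]
    rw [h1, prod_eq_mul_mul_prod_erase hab]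
    congr 2
    exact Finset.prod_congr rfl fun m hm => by rw [hA m hm]
  have hL : layerWeight q (arc i (e + 1)) W = wallFactor q / 2 * (wallFactor q / 2 * R) := by
    rw [layerWeight, ← Equiv.prod_comp (Equiv.addRight i), prod_eq_mul_mul_prod_erase hab]
    simp only [Equiv.coe_addRight, arc_add, arc_add_add_one, ha, hb, hva, hvb, gateWeight]
    have e1 : ¬((n : ℕ) - 1 < e + 1) := by omega
    have hw : (q : ℝ) / (q ^ 2 + 1) = wallFactor q / 2 := by
      unfold wallFactor
      ring
    simp only [Nat.lt_succ_self, if_true, lt_irrefl, if_false, swap_ne_one, swap_ne_one.symm, e1,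
      Nat.succ_pos, hw]
    congr 2
    refine Finset.prod_congr rfl fun m hm => ?_
    obtain ⟨h1, h2⟩ := hmem m hm
    have h3 : ((m : ℕ) < e + 1) ↔ (m : ℕ) < e := by omega
    rw [h2]
    simp only [h3, Nat.add_lt_add_iff_right, if_true]
  rw [hL, hind (arc i e), hind (arc (i - 1) (e + 1)), hind (arc i (e + 1)),
    hind (arc (i - 1) (e + 2))]
  · simp only [arc_add, arc_sub_one_add, ha, hb, hva, hvb]
    have e1 : ¬((n : ℕ) - 1 < e + 1) := by omega
    have e2 : ¬((n : ℕ) - 1 < e) := by omega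
    simp only [Nat.lt_succ_self, if_true, lt_irrefl, if_false, e1, e2, Nat.succ_pos]
    rcases perm_two_eq (W (a + i)) with h | h <;> rcases perm_two_eq (W (b + i)) with h' | h' <;>
      simp [h, h', swap_ne_one.symm] <;> ring
  all_goals
    intro m hm
    obtain ⟨h1, h2⟩ := hmem m hm
    have h3 : ((m : ℕ) < e + 1) ↔ (m : ℕ) < e := by omega
    simp only [arc_add, arc_sub_one_add, h2, Nat.add_lt_add_iff_right, h3]

lemma shiftBack_arc (i : Fin n) (d : ℕ) : shiftBack (arc i d) = arc (i + 1) d := by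
  funext j
  have h : j - 1 - i = j - (i + 1) := by abel
  simp [shiftBack, arc, h]

/-- The sum of all configurations with a single domain of length `d`. -/
noncomputable def arcState (n : ℕ+) (q : ℕ) (l : Fin 2) (d : ℕ) :
    EuclideanSpace ℂ (MomentIndex (2 * n) q 2) :=
  ∑ i : Fin n, permState q (spread l (arc i d))

/-- Summing over starting points makes the shift `i - 1` immaterial, so the outcomes merge into the
stencil `1, 2, 1` in the length. -/
lemma sum_layerWeight_arc_smul {E : Type*} [AddCommGroup E] [Module ℂ E] (q : ℕ) {e : ℕ}
    (he : e + 1 < n) (V : (Fin n → Equiv.Perm (Fin 2)) → E) :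
    ∑ i : Fin n, ∑ W, (layerWeight q (arc i (e + 1)) W : ℂ) • V W
      = (((wallFactor q / 2) ^ 2 : ℝ) : ℂ) • ((∑ i : Fin n, V (arc i e)) +
        (2 : ℂ) • (∑ i : Fin n, V (arc i (e + 1))) + ∑ i : Fin n, V (arc i (e + 2))) := by
  have h : ∀ i : Fin n, ∑ W, (layerWeight q (arc i (e + 1)) W : ℂ) • V W
      = (((wallFactor q / 2) ^ 2 : ℝ) : ℂ) • (V (arc i e) + V (arc (i - 1) (e + 1)) +
        V (arc i (e + 1)) + V (arc (i - 1) (e + 2))) := by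
    intro i
    simp only [layerWeight_arc q i he, Complex.ofReal_mul, Complex.ofReal_add, apply_ite
      Complex.ofReal, Complex.ofReal_one, Complex.ofReal_zero, mul_smul, add_smul, ite_smul,
      one_smul, zero_smul, ← Finset.smul_sum, Finset.sum_add_distrib, Finset.sum_ite_eq',
      Finset.mem_univ, if_true]
  have hs : ∀ d, ∑ i : Fin n, V (arc (i - 1) d) = ∑ i : Fin n, V (arc i d) := fun d =>
    Equiv.sum_comp (Equiv.subRight (1 : Fin n)) fun i => V (arc i d)
  simp only [h, ← Finset.smul_sum, Finset.sum_add_distrib, hs]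
  rw [two_smul, add_assoc (∑ i : Fin n, V (arc i e))]

lemma layerOp_one_arcState (hq : 2 ≤ q) {e : ℕ} (he : e + 1 < n) :
    layerOp n q 1 (arcState n q 0 (e + 1)) = (((wallFactor q / 2) ^ 2 : ℝ) : ℂ) •
      (arcState n q 1 e + (2 : ℂ) • arcState n q 1 (e + 1) + arcState n q 1 (e + 2)) := by
  rw [arcState, map_sum]
  simp only [layerOp_one_permState hq]
  exact sum_layerWeight_arc_smul q he _

lemma layerOp_zero_arcState (hq : 2 ≤ q) {e : ℕ} (he : e + 1 < n) :
    layerOp n q 0 (arcState n q 1 (e + 1)) = (((wallFactor q / 2) ^ 2 : ℝ) : ℂ) •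
      (arcState n q 0 e + (2 : ℂ) • arcState n q 0 (e + 1) + arcState n q 0 (e + 2)) := by
  rw [arcState, map_sum]
  simp only [layerOp_zero_permState hq]
  rw [sum_layerWeight_arc_smul q he]
  have hs : ∀ d, ∑ i : Fin n, permState q (spread 0 (arc (i + 1) d)) = arcState n q 0 d :=
    fun d => Equiv.sum_comp (Equiv.addRight (1 : Fin n)) fun i => permState q (spread 0 (arc i d))
  simp only [shiftBack_arc, hs]

lemma arc_zero (i : Fin n) : arc i 0 = fun _ => 1 := by
  funext j
  simp [arc]

lemma arc_self (i : Fin n) : arc i n = fun _ => Equiv.swap 0 1 := by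
  funext j
  simp [arc]

lemma layerOp_arcState_zero (hq : 2 ≤ q) (l l' : Fin 2) :
    layerOp n q l (arcState n q l' 0) = arcState n q l 0 := by
  rw [arcState, arcState, map_sum]
  refine Finset.sum_congr rfl fun i _ => ?_
  rw [arc_zero]
  exact layerOp_permState_const hq l 1

lemma layerOp_arcState_self (hq : 2 ≤ q) (l l' : Fin 2) :
    layerOp n q l (arcState n q l' n) = arcState n q l n := by
  rw [arcState, arcState, map_sum]
  refine Finset.sum_congr rfl fun i _ => ?_
  rw [arc_self]
  exact layerOp_permState_const hq l _

/-- The discrete Laplacian acts on a Dirichlet eigenfunction by its eigenvalue, up to boundary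
terms. -/
lemma sum_dirichlet {E : Type*} [AddCommGroup E] [Module ℂ E] (B : ℕ → E) (S : ℕ → ℂ) (c : ℂ)
    (m : ℕ) (hS : ∀ e, S e + S (e + 2) = 2 * c * S (e + 1)) (h0 : S 0 = 0) (hm : S (m + 1) = 0) :
    ∑ e ∈ Finset.range m, S (e + 1) • (B e + (2 : ℂ) • B (e + 1) + B (e + 2))
      = (2 + 2 * c) • ∑ e ∈ Finset.range m, S (e + 1) • B (e + 1) +
        (S 1 • B 0 + S m • B (m + 1)) := by
  -- In both reindexings a zero of `S` supplies the missing term at one end, and the other end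
  -- leaves a boundary term.
  have h1 : ∑ e ∈ Finset.range m, S (e + 1) • B e
      = ∑ e ∈ Finset.range m, S (e + 2) • B (e + 1) + S 1 • B 0 := by
    rw [← Finset.sum_range_succ' (fun e => S (e + 1) • B e), Finset.sum_range_succ, hm, zero_smul,
      add_zero]
  have h2 : ∑ e ∈ Finset.range m, S (e + 1) • B (e + 2)
      = ∑ e ∈ Finset.range m, S e • B (e + 1) + S m • B (m + 1) := by
    rw [← Finset.sum_range_succ (fun e => S e • B (e + 1)), Finset.sum_range_succ', h0, zero_smul,
      add_zero]
  simp only [smul_add, Finset.sum_add_distrib, h1, h2]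
  have h3 : ∑ e ∈ Finset.range m, S (e + 2) • B (e + 1) + ∑ e ∈ Finset.range m, S e • B (e + 1)
      = (2 * c) • ∑ e ∈ Finset.range m, S (e + 1) • B (e + 1) := by
    rw [← Finset.sum_add_distrib, Finset.smul_sum]
    refine Finset.sum_congr rfl fun e _ => ?_
    rw [← add_smul, add_comm, hS, mul_smul]
  have h4 : ∑ e ∈ Finset.range m, S (e + 1) • (2 : ℂ) • B (e + 1)
      = (2 : ℂ) • ∑ e ∈ Finset.range m, S (e + 1) • B (e + 1) := by
    rw [Finset.smul_sum]
    exact Finset.sum_congr rfl fun e _ => smul_comm _ _ _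
  rw [h4, add_smul, ← h3]
  abel

/-- The factor by which a layer contracts the slowest mode of a pair of domain walls. -/
noncomputable def pairFactor (q n : ℕ) : ℝ :=
  wallFactor q ^ 2 * ((1 + Real.cos (Real.pi / n)) / 2)

/-- The sine mode of a pair of domain walls, without its component along the unit eigenspace. -/
noncomputable def sineState (n : ℕ+) (q : ℕ) (l : Fin 2) :
    EuclideanSpace ℂ (MomentIndex (2 * n) q 2) :=
  ∑ e ∈ Finset.range (n - 1), (Real.sin (Real.pi / n * (e + 1 : ℕ)) : ℂ) • arcState n q l (e + 1)

/-- The function `sin(π d/n)` vanishes at `0` and `n` and has eigenvalue `2 + 2 cos(π/n)` under the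
stencil. The boundary terms land on constant configurations, with equal coefficients because
`sin(π(n-1)/n) = sin(π/n)`. -/
lemma layerOp_sineState {l l' : Fin 2}
    (h : ∀ {e : ℕ}, e + 1 < n → layerOp n q l (arcState n q l' (e + 1)) =
      (((wallFactor q / 2) ^ 2 : ℝ) : ℂ) •
        (arcState n q l e + (2 : ℂ) • arcState n q l (e + 1) + arcState n q l (e + 2))) :
    layerOp n q l (sineState n q l') = (pairFactor q n : ℂ) • sineState n q l +
      (((wallFactor q / 2) ^ 2 * Real.sin (Real.pi / n) : ℝ) : ℂ) •
        (arcState n q l 0 + arcState n q l n) := by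
  have hn := n.pos
  have hn0 : ((n : ℕ) : ℝ) ≠ 0 := by positivity
  have hm : (n : ℕ) - 1 + 1 = n := by omega
  have key := sum_dirichlet (arcState n q l)
    (fun d => (Real.sin (Real.pi / n * (d : ℕ)) : ℂ)) (Real.cos (Real.pi / n) : ℂ) (n - 1)
    (by
      intro e
      rw [← Complex.ofReal_add]
      have h1 : Real.sin (Real.pi / n * (e : ℕ)) + Real.sin (Real.pi / n * (e + 2 : ℕ))
          = 2 * Real.cos (Real.pi / n) * Real.sin (Real.pi / n * (e + 1 : ℕ)) := by
        rw [Real.sin_add_sin]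
        push_cast
        have e1 : (Real.pi / n * e + Real.pi / n * (e + 2)) / 2 = Real.pi / n * (e + 1) := by ring
        have e2 : (Real.pi / n * e - Real.pi / n * (e + 2)) / 2 = -(Real.pi / n) := by ring
        rw [e1, e2, Real.cos_neg]
        ring
      rw [h1]
      push_cast
      ring)
    (by simp)
    (by
      rw [hm, div_mul_cancel₀ _ hn0, Real.sin_pi]
      simp)
  have hlast : Real.sin (Real.pi / n * ((n : ℕ) - 1 : ℕ)) = Real.sin (Real.pi / n) := by
    rw [Nat.cast_sub hn, mul_sub, div_mul_cancel₀ _ hn0]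
    simp [Real.sin_pi_sub]
  rw [hlast, hm, Nat.cast_one, mul_one] at key
  rw [sineState, map_sum]
  have h2 : ∀ e ∈ Finset.range ((n : ℕ) - 1),
      layerOp n q l ((Real.sin (Real.pi / n * (e + 1 : ℕ)) : ℂ) • arcState n q l' (e + 1))
        = (((wallFactor q / 2) ^ 2 : ℝ) : ℂ) • ((Real.sin (Real.pi / n * (e + 1 : ℕ)) : ℂ) •
          (arcState n q l e + (2 : ℂ) • arcState n q l (e + 1) + arcState n q l (e + 2))) := by
    intro e he
    rw [Finset.mem_range] at he
    rw [map_smul, h (by omega), smul_comm]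
  rw [Finset.sum_congr rfl h2, ← Finset.smul_sum, key, smul_add, smul_smul, ← smul_add, smul_smul]
  congr 2
  · rw [pairFactor]
    push_cast
    ring
  · push_cast
    rfl

lemma pairFactor_nonneg (q : ℕ) (n : ℕ) : 0 ≤ pairFactor q n := by
  have h1 := Real.neg_one_le_cos (Real.pi / n)
  have h2 := sq_nonneg (wallFactor q)
  exact mul_nonneg h2 (by linarith)

lemma pairFactor_le (q : ℕ) (n : ℕ) : pairFactor q n ≤ wallFactor q ^ 2 := by
  have h1 := Real.cos_le_one (Real.pi / n)
  have h2 := sq_nonneg (wallFactor q)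
  exact mul_le_of_le_one_right h2 (by linarith)

lemma pairFactor_lt_one (hq : 2 ≤ q) (n : ℕ) : pairFactor q n < 1 :=
  (pairFactor_le q n).trans_lt
    (pow_lt_one₀ (wallFactor_nonneg q) (wallFactor_lt_one hq) (by norm_num))

lemma pairFactor_pos (hq : 2 ≤ q) {n : ℕ} (hn : 2 ≤ n) : 0 < pairFactor q n := by
  have h2 := wallFactor_pos hq
  have hn' : (2 : ℝ) ≤ n := by exact_mod_cast hn
  have h3 : 0 ≤ Real.cos (Real.pi / n) := by
    refine Real.cos_nonneg_of_neg_pi_div_two_le_of_le ?_ ?_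
    · have := Real.pi_pos
      have : 0 ≤ Real.pi / n := by positivity
      linarith
    · exact div_le_div_of_nonneg_left Real.pi_pos.le (by norm_num) hn'
  unfold pairFactor
  positivity

lemma tendsto_pairFactor (q : ℕ) :
    Tendsto (fun n : ℕ => pairFactor q n) atTop (𝓝 (wallFactor q ^ 2)) := by
  have h1 : Tendsto (fun n : ℕ => Real.pi / n) atTop (𝓝 0) :=
    tendsto_const_div_atTop_nhds_zero_nat Real.pi
  have h2 := (Real.continuous_cos.tendsto 0).comp h1
  rw [Real.cos_zero] at h2
  have h3 := ((h2.const_add 1).div_const 2).const_mul (wallFactor q ^ 2)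
  norm_num at h3
  exact h3

/-- The slowest mode of a pair of domain walls. -/
noncomputable def slowState (n : ℕ+) (q : ℕ) (l : Fin 2) :
    EuclideanSpace ℂ (MomentIndex (2 * n) q 2) :=
  sineState n q l + (((wallFactor q / 2) ^ 2 * Real.sin (Real.pi / n) / (pairFactor q n - 1) : ℝ)
    : ℂ) • (arcState n q l 0 + arcState n q l n)

/-- Constant configurations have eigenvalue `1`. With `s` the boundary coefficient and `λ` the pair
factor, the correction `x` must satisfy `s + x = λ x`, so `x = s/(λ - 1)`. -/
lemma layerOp_slowState (hq : 2 ≤ q) {l l' : Fin 2}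
    (h : ∀ {e : ℕ}, e + 1 < n → layerOp n q l (arcState n q l' (e + 1)) =
      (((wallFactor q / 2) ^ 2 : ℝ) : ℂ) •
        (arcState n q l e + (2 : ℂ) • arcState n q l (e + 1) + arcState n q l (e + 2))) :
    layerOp n q l (slowState n q l') = (pairFactor q n : ℂ) • slowState n q l := by
  have h1 : pairFactor q n - 1 ≠ 0 := (sub_neg.2 (pairFactor_lt_one hq n)).ne
  rw [slowState, slowState, map_add, map_smul, map_add, layerOp_sineState h,
    layerOp_arcState_zero hq, layerOp_arcState_self hq, smul_add ((pairFactor q n : ℝ) : ℂ),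
    add_assoc, ← add_smul,
    smul_smul, ← Complex.ofReal_add, ← Complex.ofReal_mul]
  congr 3
  field_simp
  ring

/-- The coefficient at a domain of length one is positive: the constant corrections do not reach it,
and the sines at the lengths `1, …, n - 1` are positive. -/
lemma slowState_ne_zero (hq : 2 ≤ q) (hn : 2 ≤ (n : ℕ)) (l : Fin 2) : slowState n q l ≠ 0 := by
  intro h0
  have hne : ∀ σ, arc (0 : Fin n) 1 ≠ fun _ => σ := by
    intro σ h
    have h1 := congrFun h 0
    have h2 := congrFun h 1
    rw [← h2] at h1
    simp [arc] at h1
    rw [h1] at hn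
    exact absurd hn (by decide)
  have hc : ∀ d, permCoeff hq (spread l (arc (0 : Fin n) 1)) (arcState n q l d)
      = ((∑ i : Fin n, if arc (0 : Fin n) 1 = arc i d then 1 else 0 : ℝ) : ℂ) := by
    intro d
    simp [arcState, permCoeff_permState, (spread_injective l).eq_iff]
  have h1 := congrArg (permCoeff hq (spread l (arc (0 : Fin n) 1))) h0
  rw [slowState, sineState, map_add, map_zero, map_smul, map_add, hc, hc, map_sum] at h1
  simp only [arc_zero, arc_self, hne, if_false, Finset.sum_const_zero, Complex.ofReal_zero,
    add_zero, map_smul, hc, smul_eq_mul, mul_zero] at h1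
  have h2 : (∑ e ∈ Finset.range ((n : ℕ) - 1), Real.sin (Real.pi / n * (e + 1 : ℕ)) *
      ∑ i : Fin n, if arc (0 : Fin n) 1 = arc i (e + 1) then (1 : ℝ) else 0) = 0 := by
    exact_mod_cast h1
  have hn' : (2 : ℝ) ≤ (n : ℕ) := by exact_mod_cast hn
  have hs : ∀ e ∈ Finset.range ((n : ℕ) - 1), 0 < Real.sin (Real.pi / n * (e + 1 : ℕ)) := by
    intro e he
    rw [Finset.mem_range] at he
    have := Real.pi_pos
    refine Real.sin_pos_of_pos_of_lt_pi (by positivity) ?_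
    rw [div_mul_eq_mul_div, div_lt_iff₀ (by positivity)]
    refine mul_lt_mul_of_pos_left ?_ Real.pi_pos
    exact_mod_cast (by omega : e + 1 < (n : ℕ))
  have hi : ∀ e, 0 ≤ ∑ i : Fin n, if arc (0 : Fin n) 1 = arc i (e + 1) then (1 : ℝ) else 0 :=
    fun e => Finset.sum_nonneg fun i _ => by split_ifs <;> norm_num
  have h3 := (Finset.sum_eq_zero_iff_of_nonneg fun e he =>
    mul_nonneg (hs e he).le (hi e)).1 h2 0 (Finset.mem_range.2 (by omega))
  rcases mul_eq_zero.1 h3 with h4 | h4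
  · exact (hs 0 (Finset.mem_range.2 (by omega))).ne' h4
  · have h5 := (Finset.sum_eq_zero_iff_of_nonneg fun i _ => by split_ifs <;> norm_num).1 h4 0
      (Finset.mem_univ _)
    simp at h5

lemma layerOp_zero_slowState (hq : 2 ≤ q) :
    layerOp n q 0 (slowState n q 1) = (pairFactor q n : ℂ) • slowState n q 0 :=
  layerOp_slowState hq (layerOp_zero_arcState hq)

lemma layerOp_one_slowState (hq : 2 ≤ q) :
    layerOp n q 1 (slowState n q 0) = (pairFactor q n : ℂ) • slowState n q 1 :=
  layerOp_slowState hq (layerOp_one_arcState hq)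

lemma transferMatrix_slowState (hq : 2 ≤ q) :
    transferMatrix n q 2 (slowState n q 1) = ((pairFactor q n ^ 2 : ℝ) : ℂ) • slowState n q 1 := by
  rw [transferMatrix_apply, layerOp_zero_slowState hq, map_smul, layerOp_one_slowState hq,
    smul_smul, sq, Complex.ofReal_mul]

end Arcs

/-! ### Integrals of products of independent matrices -/

section MatrixIntegral

variable {I α : Type*} [Fintype I] [DecidableEq I] [MeasurableSpace α]

/-- The entrywise integral of a matrix-valued function. -/
noncomputable def matrixIntegral (μ : Measure α) (f : α → Matrix I I ℂ) : Matrix I I ℂ :=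
  Matrix.of fun x y => ∫ a, f a x y ∂μ

/-- Entrywise integrability. -/
def MatrixIntegrable (μ : Measure α) (f : α → Matrix I I ℂ) : Prop :=
  ∀ x y, Integrable (fun a => f a x y) μ

/-- Independence as Fubini: the first factor is split off. Integrability is proved in the same
induction because splitting the integral of the product needs it. -/
lemma matrixIntegral_ofFn_prod (μ : Measure α) [IsProbabilityMeasure μ] (k : ℕ)
    (f : Fin k → α → Matrix I I ℂ) (hf : ∀ i, MatrixIntegrable μ (f i)) :
    MatrixIntegrable (Measure.pi fun _ : Fin k => μ)
        (fun u => (List.ofFn fun i => f i (u i)).prod) ∧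
      matrixIntegral (Measure.pi fun _ : Fin k => μ)
        (fun u => (List.ofFn fun i => f i (u i)).prod)
        = (List.ofFn fun i => matrixIntegral μ (f i)).prod := by
  induction k with
  | zero =>
    refine ⟨fun x y => ?_, ?_⟩
    · simp
    · ext x y
      simp [matrixIntegral]
  | succ k ih =>
    obtain ⟨h1, h2⟩ := ih (fun i => f i.succ) fun i => hf i.succ
    have hmp := measurePreserving_piFinSuccAbove (fun _ : Fin (k + 1) => μ) 0
    have hint : ∀ x y z, Integrable (fun p : α × (Fin k → α) => f 0 p.1 x z *
        (List.ofFn fun i : Fin k => f i.succ (p.2 i)).prod z y)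
        (μ.prod (Measure.pi fun _ : Fin k => μ)) := fun x y z => (hf 0 x z).mul_prod (h1 z y)
    have hexp : ∀ x y, (fun u : Fin (k + 1) → α => (List.ofFn fun i => f i (u i)).prod x y)
        = (fun p : α × (Fin k → α) => ∑ z, f 0 p.1 x z *
          (List.ofFn fun i : Fin k => f i.succ (p.2 i)).prod z y) ∘
            (MeasurableEquiv.piFinSuccAbove (fun _ : Fin (k + 1) => α) 0) := by
      intro x y
      funext u
      rw [List.ofFn_succ, List.prod_cons, Matrix.mul_apply]
      rfl
    refine ⟨fun x y => ?_, ?_⟩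
    · rw [hexp]
      exact (hmp.integrable_comp_emb (MeasurableEquiv.measurableEmbedding _)).2
        (integrable_finsetSum _ fun z _ => hint x y z)
    · ext x y
      rw [List.ofFn_succ, List.prod_cons, Matrix.mul_apply, ← h2]
      simp only [matrixIntegral, Matrix.of_apply]
      rw [hexp]
      refine Eq.trans (hmp.integral_comp' (g := fun p : α × (Fin k → α) => ∑ z, f 0 p.1 x z *
          (List.ofFn fun i : Fin k => f i.succ (p.2 i)).prod z y)) ?_
      change ∫ p, _ ∂(μ.prod (Measure.pi fun _ : Fin k => μ)) = _
      rw [integral_finsetSum _ fun z _ => hint x y z]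
      exact Finset.sum_congr rfl fun z _ => integral_prod_mul
        (fun a => f 0 a x z) (fun w : Fin k → α => (List.ofFn fun i : Fin k => f i.succ (w i)).prod z y)

lemma matrixIntegral_ofFn_reverse_prod (μ : Measure α) [IsProbabilityMeasure μ] (k : ℕ)
    (f : Fin k → α → Matrix I I ℂ) (hf : ∀ i, MatrixIntegrable μ (f i)) :
    MatrixIntegrable (Measure.pi fun _ : Fin k => μ)
        (fun u => (List.ofFn fun i => f i (u i)).reverse.prod) ∧
      matrixIntegral (Measure.pi fun _ : Fin k => μ)
        (fun u => (List.ofFn fun i => f i (u i)).reverse.prod)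
        = (List.ofFn fun i => matrixIntegral μ (f i)).reverse.prod := by
  have hrev : ∀ g : Fin k → Matrix I I ℂ,
      (List.ofFn g).reverse.prod = ((List.ofFn fun i => (g i)ᵀ).prod)ᵀ := by
    intro g
    rw [transpose_list_prod, List.map_ofFn]
    congr 2
  obtain ⟨h1, h2⟩ := matrixIntegral_ofFn_prod μ k (fun i a => (f i a)ᵀ) fun i x y => hf i y x
  refine ⟨fun x y => ?_, ?_⟩
  · simp only [hrev]
    exact h1 y x
  · simp only [hrev]
    have h3 : ∀ i, (matrixIntegral μ (f i))ᵀ = matrixIntegral μ fun a => (f i a)ᵀ := fun i => rfl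
    simp only [h3, ← h2]
    rfl

end MatrixIntegral

/-! ### The brickwork ensemble and its channel -/

section Ensemble

variable {n : ℕ+} {q t : ℕ}

/-- Makes the product `σ`-algebra on tuples of gates the Borel one, so that the circuit, being
continuous, is measurable. -/
instance {ι : Type*} [Fintype ι] [DecidableEq ι] :
    SecondCountableTopology (unitaryGroup ι ℂ) := by
  have : SecondCountableTopology (Matrix ι ι ℂ) :=
    inferInstanceAs (SecondCountableTopology (ι → ι → ℂ))
  exact TopologicalSpace.Subtype.secondCountableTopology _

lemma continuous_gateOn {N : ℕ} {a b : Fin N} (hab : a ≠ b) :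
    Continuous fun u : Gate q => gateOn hab u := by
  refine Continuous.subtype_mk (continuous_matrix fun X Y => ?_) _
  change Continuous fun u : Gate q => (u : Matrix (Fin q × Fin q) (Fin q × Fin q) ℂ) _ _ * _
  exact ((continuous_subtype_val (p := fun A : Matrix (Fin q × Fin q) (Fin q × Fin q) ℂ =>
    A ∈ unitaryGroup (Fin q × Fin q) ℂ)).matrix_elem _ _).mul continuous_const

lemma continuous_layerUnitary (l : Fin 2) : Continuous (layerUnitary n q l) := by
  unfold layerUnitary
  simp only [List.ofFn_eq_map]
  exact continuous_list_prod _ fun j _ => (continuous_gateOn _).comp (continuous_apply j)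

lemma continuous_circuitUnitary (k : ℕ) : Continuous (circuitUnitary n q k) := by
  unfold circuitUnitary
  simp only [List.ofFn_eq_map, ← List.map_reverse]
  refine continuous_list_prod _ fun i _ => ?_
  exact ((continuous_layerUnitary 1).comp ((continuous_apply 1).comp (continuous_apply i))).mul
    ((continuous_layerUnitary 0).comp ((continuous_apply 0).comp (continuous_apply i)))

/-- `U ↦ U^{⊗ t,t}` as a homomorphism. -/
noncomputable def momentRepHom (ι : Type*) [Fintype ι] [DecidableEq ι] (t : ℕ) :
    unitaryGroup ι ℂ →* Matrix ((Fin t → ι) × (Fin t → ι)) ((Fin t → ι) × (Fin t → ι)) ℂ where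
  toFun U := momentRep t (U : Matrix ι ι ℂ)
  map_one' := by rw [Submonoid.coe_one, momentRep_one]
  map_mul' U V := by rw [Submonoid.coe_mul, momentRep_mul]

lemma momentRepHom_apply {ι : Type*} [Fintype ι] [DecidableEq ι] (U : unitaryGroup ι ℂ) :
    momentRepHom ι t U = momentRep t (U : Matrix ι ι ℂ) := rfl

lemma matrixIntegral_layerUnitary (l : Fin 2) :
    MatrixIntegrable (Measure.pi fun _ : Fin n => haarU (Fin q × Fin q))
        (fun u => momentRepHom (Config (2 * n) q) t (layerUnitary n q l u)) ∧
      matrixIntegral (Measure.pi fun _ : Fin n => haarU (Fin q × Fin q))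
        (fun u => momentRepHom (Config (2 * n) q) t (layerUnitary n q l u))
        = averagedLayer n q t l := by
  have h : ∀ u : Fin n → Gate q, momentRepHom (Config (2 * n) q) t (layerUnitary n q l u)
      = (List.ofFn fun j => momentRepHom (Config (2 * n) q) t
          (gateOn (site_ne n (gateSite n l j)) (u j))).prod := by
    intro u
    rw [layerUnitary, map_list_prod, List.map_ofFn]
    rfl
  simp only [h]
  refine matrixIntegral_ofFn_prod (haarU (Fin q × Fin q)) n
    (fun j u => momentRepHom (Config (2 * n) q) t (gateOn (site_ne n (gateSite n l j)) u)) ?_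
  intro j x y
  exact ((continuous_momentRep t x y).comp (continuous_gateOn _)).integrable_of_hasCompactSupport
    (HasCompactSupport.of_compactSpace _)

lemma matrixIntegral_period :
    MatrixIntegrable (Measure.pi fun _ : Fin 2 => Measure.pi fun _ : Fin n =>
        haarU (Fin q × Fin q)) (fun u => momentRepHom (Config (2 * n) q) t
          (layerUnitary n q 1 (u 1) * layerUnitary n q 0 (u 0))) ∧
      matrixIntegral (Measure.pi fun _ : Fin 2 => Measure.pi fun _ : Fin n =>
        haarU (Fin q × Fin q)) (fun u => momentRepHom (Config (2 * n) q) t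
          (layerUnitary n q 1 (u 1) * layerUnitary n q 0 (u 0)))
        = averagedLayer n q t 1 * averagedLayer n q t 0 := by
  have h := matrixIntegral_ofFn_reverse_prod
    (Measure.pi fun _ : Fin n => haarU (Fin q × Fin q)) 2
    (fun l u => momentRepHom (Config (2 * n) q) t (layerUnitary n q l u))
    fun l => (matrixIntegral_layerUnitary l).1
  simpa [List.ofFn_succ, (matrixIntegral_layerUnitary _).2, map_mul] using h

/-- The moment matrix of the brickwork is a power of the transfer matrix. -/
theorem momentMatrix_brickworkEnsemble (n : ℕ+) (q t k : ℕ) :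
    momentMatrix t (brickworkEnsemble n q k)
      = (averagedLayer n q t 1 * averagedLayer n q t 0) ^ k := by
  have h := matrixIntegral_ofFn_reverse_prod
    (Measure.pi fun _ : Fin 2 => Measure.pi fun _ : Fin n => haarU (Fin q × Fin q)) k
    (fun _ u => momentRepHom (Config (2 * n) q) t
          (layerUnitary n q 1 (u 1) * layerUnitary n q 0 (u 0)))
    fun _ => matrixIntegral_period.1
  have h2 := h.2
  simp only [matrixIntegral_period.2, List.ofFn_const, List.reverse_replicate,
    List.prod_replicate] at h2
  rw [← h2]
  ext x y
  simp only [momentMatrix, matrixIntegral, Matrix.of_apply, brickworkEnsemble]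
  rw [integral_map (continuous_circuitUnitary k).measurable.aemeasurable
    (continuous_momentRep t x y).aestronglyMeasurable]
  refine integral_congr_ae (Eventually.of_forall fun u => ?_)
  dsimp only
  rw [← momentRepHom_apply, circuitUnitary, map_list_prod, List.map_reverse, List.map_ofFn]
  rfl

instance (n : ℕ+) (q k : ℕ) : IsProbabilityMeasure (brickworkEnsemble n q k) :=
  Measure.isProbabilityMeasure_map (continuous_circuitUnitary k).measurable.aemeasurable

/-- A matrix as a vector of `2 t` copies. -/
def vectorize {κ : Type*} (ρ : Matrix κ κ ℂ) : κ × κ → ℂ := fun p => ρ p.1 p.2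

/-- Vectorization turns `ρ ↦ A ρ A†` into multiplication by `A ⊗ A^*`. -/
lemma channel_apply {ι : Type*} [Fintype ι] [DecidableEq ι] (ν : Measure (unitaryGroup ι ℂ))
    [IsFiniteMeasure ν] (ρ : Matrix (Fin t → ι) (Fin t → ι) ℂ) (i j : Fin t → ι) :
    channel t ν ρ i j = (momentMatrix t ν *ᵥ vectorize ρ) (i, j) := by
  have h : ∀ U : unitaryGroup ι ℂ,
      (tensorPow t (U : Matrix ι ι ℂ) * ρ * (tensorPow t (U : Matrix ι ι ℂ))ᴴ) i j
        = ∑ p, momentRep t (U : Matrix ι ι ℂ) (i, j) p * vectorize ρ p := by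
    intro U
    rw [Fintype.sum_prod_type_right, Matrix.mul_apply]
    refine Finset.sum_congr rfl fun b _ => ?_
    rw [Matrix.mul_apply, Finset.sum_mul]
    refine Finset.sum_congr rfl fun a _ => ?_
    rw [momentRep_apply, conjTranspose_apply, vectorize]
    simp only [tensorPow, Matrix.of_apply, star_prod]
    ring
  change ∫ U, _ ∂ν = _
  simp only [h, Matrix.mulVec, dotProduct, momentMatrix, Matrix.of_apply]
  rw [integral_finsetSum _ fun z _ => (integrable_momentRep t _ _ z).mul_const _]
  simp only [integral_mul_const]

end Ensemble

/-! ### Global Haar average as the unit projection -/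

section HaarProjection

variable {n : ℕ+} {q : ℕ}

lemma permState_const (N q : ℕ) (σ : Equiv.Perm (Fin 2)) :
    (permState q (fun _ : Fin N => σ)).ofLp = ((q : ℂ)⁻¹) ^ N • permDelta (Config N q) σ := by
  funext x
  change (∏ i : Fin N, _) = _
  rw [Finset.prod_ite_zero]
  simp only [Finset.mem_univ, true_imp_iff, Real.sq_sqrt (Nat.cast_nonneg (α := ℝ) q),
    Complex.ofReal_inv, Complex.ofReal_natCast, Finset.prod_const, Finset.card_univ,
    Fintype.card_fin, Pi.smul_apply, permDelta, funext_iff, smul_eq_mul, mul_ite, mul_one, mul_zero]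
  exact if_congr forall_comm rfl rfl

lemma two_le_card_config (hq : 2 ≤ q) (n : ℕ+) : 2 ≤ Fintype.card (Config (2 * n) q) := by
  simp only [Fintype.card_fun, Fintype.card_fin]
  have := n.pos
  calc 2 ≤ q := hq
    _ ≤ q ^ (2 * (n : ℕ)) := Nat.le_self_pow (by omega) q

/-- The moment matrix of the Haar measure is the projection onto the unit eigenspace of the
transfer matrix. -/
theorem momentMatrix_haarU_config (hq : 2 ≤ q)
    (v : EuclideanSpace ℂ (MomentIndex (2 * n) q 2)) :
    toEuclideanLin (momentMatrix 2 (haarU (Config (2 * n) q))) v = unitProjection n q 2 v := by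
  have hq0 : (q : ℂ) ≠ 0 := by
    have : q ≠ 0 := by omega
    exact_mod_cast this
  symm
  -- The Haar average lands in the span of constant permutation states, which `T` fixes. Conversely,
  -- fixed vectors of `T` are such combinations, hence fixed by the Hermitian moment matrix, so the
  -- residual is orthogonal to them.
  refine Submodule.eq_starProjection_of_mem_of_inner_eq_zero ?_ ?_
  · rw [toLpLin_apply, momentMatrix_haarU_mulVec (two_le_card_config hq n), WithLp.toLp_sum]
    refine Submodule.sum_mem _ fun σ _ => ?_
    rw [WithLp.toLp_smul]
    refine Submodule.smul_mem _ _ ?_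
    have h : WithLp.toLp 2 (permDelta (Config (2 * n) q) σ)
        = ((q : ℂ) ^ (2 * (n : ℕ))) • permState q (fun _ : Fin (2 * n) => σ) := by
      ext x
      rw [WithLp.ofLp_smul, permState_const, smul_smul, ← mul_pow, mul_inv_cancel₀ hq0, one_pow,
        one_smul]
    rw [h]
    refine Submodule.smul_mem _ _ (Module.End.mem_eigenspace_iff.2 ?_)
    rw [transferMatrix_permState_const hq, one_smul]
  · intro w hw
    have hw1 : transferMatrix n q 2 w = w := by
      rw [Module.End.mem_eigenspace_iff.1 hw, one_smul]
    have hfix : toEuclideanLin (momentMatrix 2 (haarU (Config (2 * n) q))) w = w := by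
      obtain ⟨c, hc, h0⟩ := exists_const_of_transferMatrix_eq_self hq hw1
      rw [hc, map_sum]
      refine Finset.sum_congr rfl fun Z _ => ?_
      by_cases hZ : IsConst Z
      · obtain ⟨σ, rfl⟩ := hZ
        rw [map_smul]
        congr 1
        change toEuclideanLin _ (permState q fun _ => σ) = permState q fun _ => σ
        ext x
        rw [toLpLin_apply, permState_const, mulVec_smul, momentMatrix_mulVec_permDelta]
      · rw [eq_of_wallNorm_eq_zero h0 Z hZ]
        simp
    have hsymm := Matrix.isSymmetric_toEuclideanLin_iff.2
      (momentMatrix_haarU_isHermitian (two_le_card_config hq n))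
    rw [inner_sub_left, hsymm v w, hfix, sub_self]

/-- The difference between the channels of the brickwork and of the Haar measure. -/
theorem channel_sub_channel_apply (hq : 2 ≤ q) (n : ℕ+) (k : ℕ)
    (ρ : Matrix (Fin 2 → Config (2 * n) q) (Fin 2 → Config (2 * n) q) ℂ)
    (i j : Fin 2 → Config (2 * n) q) :
    (channel 2 (brickworkEnsemble n q k) - channel 2 (haarU (Config (2 * n) q))) ρ i j
      = ((transferMatrix n q 2 ^ k) (WithLp.toLp 2 (vectorize ρ)) -
          unitProjection n q 2 (WithLp.toLp 2 (vectorize ρ))) (i, j) := by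
  have hpow : ∀ (v : MomentIndex (2 * n) q 2 → ℂ), (transferMatrix n q 2 ^ k) (WithLp.toLp 2 v)
      = WithLp.toLp 2 ((averagedLayer n q 2 1 * averagedLayer n q 2 0) ^ k *ᵥ v) := by
    intro v
    induction k with
    | zero => simp
    | succ k ih =>
      rw [pow_succ', pow_succ', Module.End.mul_apply, ih, ← mulVec_mulVec]
      rfl
  rw [LinearMap.sub_apply, Matrix.sub_apply, channel_apply, channel_apply,
    momentMatrix_brickworkEnsemble, hpow, ← momentMatrix_haarU_config hq]
  rfl

end HaarProjection

/-! ### Trace norm against Hilbert–Schmidt norm -/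

section TraceNorm

variable {κ : Type*} [Fintype κ] [DecidableEq κ]

lemma traceNorm_eq_sum (X : Matrix κ κ ℂ) :
    traceNorm X = ∑ i : Fin (Fintype.card κ), (toEuclideanLin X).singularValues i := by
  rw [traceNorm, Finsupp.sum, LinearMap.support_singularValues]
  rw [Fin.sum_univ_eq_sum_range fun i => (toEuclideanLin X).singularValues i]
  refine Finset.sum_subset ?_ ?_
  · rw [Finset.range_subset_range]
    exact (Submodule.finrank_le _).trans_eq (by simp)
  · intro i _ hi
    rw [LinearMap.singularValues_eq_zero_iff_le_finrank_range]
    simpa using hi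

/-- Both sides are the trace of `X† X`. -/
lemma sum_sq_singularValues (X : Matrix κ κ ℂ) :
    ∑ i : Fin (Fintype.card κ), (toEuclideanLin X).singularValues i ^ 2
      = ∑ i, ∑ j, ‖X i j‖ ^ 2 := by
  have hd : Module.finrank ℂ (EuclideanSpace ℂ κ) = Fintype.card κ := by simp
  set T := toEuclideanLin X with hT
  have h1 := T.isSymmetric_adjoint_comp_self.re_trace_eq_sum_eigenvalues hd
  have h2 := LinearMap.trace_eq_sum_inner (LinearMap.adjoint T ∘ₗ T) (EuclideanSpace.basisFun κ ℂ)
  simp only [LinearMap.sq_singularValues_fin T hd]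
  rw [← h1, h2, map_sum, Finset.sum_comm]
  refine Finset.sum_congr rfl fun j _ => ?_
  rw [LinearMap.comp_apply, LinearMap.adjoint_inner_right, inner_self_eq_norm_sq,
    EuclideanSpace.norm_sq_eq]
  refine Finset.sum_congr rfl fun i _ => ?_
  simp [hT, toLpLin_apply]

lemma norm_vectorize_sq (X : Matrix κ κ ℂ) :
    ‖WithLp.toLp 2 (vectorize X)‖ ^ 2 = ∑ i, ∑ j, ‖X i j‖ ^ 2 := by
  rw [EuclideanSpace.norm_sq_eq, Fintype.sum_prod_type]
  rfl

lemma norm_vectorize_le_traceNorm (X : Matrix κ κ ℂ) :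
    ‖WithLp.toLp 2 (vectorize X)‖ ≤ traceNorm X := by
  have h0 : ∀ i : Fin (Fintype.card κ), 0 ≤ (toEuclideanLin X).singularValues i :=
    fun i => LinearMap.singularValues_nonneg _ _
  have h1 : 0 ≤ traceNorm X := by
    rw [traceNorm_eq_sum]
    exact Finset.sum_nonneg fun i _ => h0 i
  refine le_of_sq_le_sq ?_ h1
  rw [norm_vectorize_sq, ← sum_sq_singularValues, traceNorm_eq_sum]
  exact Finset.sum_sq_le_sq_sum_of_nonneg fun i _ => h0 i

lemma traceNorm_le (X : Matrix κ κ ℂ) :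
    traceNorm X ≤ Fintype.card κ * ‖WithLp.toLp 2 (vectorize X)‖ := by
  rw [traceNorm_eq_sum]
  have h : ∀ i ∈ (Finset.univ : Finset (Fin (Fintype.card κ))),
      (toEuclideanLin X).singularValues i ≤ ‖WithLp.toLp 2 (vectorize X)‖ := by
    intro i hi
    refine le_of_sq_le_sq ?_ (norm_nonneg _)
    rw [norm_vectorize_sq, ← sum_sq_singularValues]
    exact Finset.single_le_sum
      (f := fun i : Fin (Fintype.card κ) => (toEuclideanLin X).singularValues i ^ 2)
      (fun _ _ => sq_nonneg _) hi
  refine (Finset.sum_le_card_nsmul _ _ _ h).trans_eq ?_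
  simp

lemma norm_apply_le_norm_vectorize (X : Matrix κ κ ℂ) (i j : κ) :
    ‖X i j‖ ≤ ‖WithLp.toLp 2 (vectorize X)‖ :=
  PiLp.norm_apply_le (WithLp.toLp 2 (vectorize X)) (i, j)

lemma norm_vectorize_le {X : Matrix κ κ ℂ} {b : ℝ} (hb : 0 ≤ b) (h : ∀ i j, ‖X i j‖ ≤ b) :
    ‖WithLp.toLp 2 (vectorize X)‖ ≤ Fintype.card κ * b := by
  refine le_of_sq_le_sq ?_ (by positivity)
  rw [norm_vectorize_sq]
  calc ∑ i, ∑ j, ‖X i j‖ ^ 2 ≤ ∑ _i : κ, ∑ _j : κ, b ^ 2 :=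
        Finset.sum_le_sum fun i _ => Finset.sum_le_sum fun j _ =>
          pow_le_pow_left₀ (norm_nonneg _) (h i j) 2
    _ = (Fintype.card κ * b) ^ 2 := by
        simp only [Finset.sum_const, Finset.card_univ, nsmul_eq_mul]
        ring

lemma norm_vectorize_smul (c : ℂ) (X : Matrix κ κ ℂ) :
    ‖WithLp.toLp 2 (vectorize (c • X))‖ = ‖c‖ * ‖WithLp.toLp 2 (vectorize X)‖ := by
  have h : WithLp.toLp 2 (vectorize (c • X)) = c • WithLp.toLp 2 (vectorize X) := rfl
  rw [h, norm_smul]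

end TraceNorm

/-! ### Two-sided bounds on the diamond distance -/

section Diamond

variable {n : ℕ+} {q : ℕ}

/-- Crude norm comparisons suffice: factors depending on the dimension only enter the `o(log(1/ε))`
term. The bound `1 ≤ C` ensures `log C ≥ 0` later. -/
theorem exists_diamondNorm_le (hq : 2 ≤ q) (n : ℕ+) : ∃ C : ℝ, 1 ≤ C ∧ ∀ k : ℕ,
    diamondNorm (channel 2 (brickworkEnsemble n q k) - channel 2 (haarU (Config (2 * n) q)))
      ≤ ENNReal.ofReal (C * (wallFactor q ^ 4) ^ k) := by
  obtain ⟨B, hB, h⟩ := exists_norm_transferMatrix_pow_sub_le hq n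
  let D : ℝ := Fintype.card ((Fin 2 → Config (2 * n) q) × (Fin 2 → Config (2 * n) q))
  have hD : 0 ≤ D := Nat.cast_nonneg _
  have hl : 0 ≤ (wallFactor q ^ 4) := pow_nonneg (wallFactor_nonneg q) 4
  refine ⟨max 1 (D * (D * B)), le_max_left _ _, fun k => ?_⟩
  refine iSup₂_le fun X hX => ENNReal.ofReal_le_ofReal ?_
  have hlk : 0 ≤ (wallFactor q ^ 4) ^ k := pow_nonneg hl k
  have hX1 := (norm_vectorize_le_traceNorm X).trans hX
  have hent : ∀ p r, ‖tensorId (channel 2 (brickworkEnsemble n q k) -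
      channel 2 (haarU (Config (2 * n) q))) X p r‖ ≤ B * (wallFactor q ^ 4) ^ k := by
    intro p r
    rw [tensorId, Matrix.of_apply, channel_sub_channel_apply hq]
    refine (PiLp.norm_apply_le _ (p.1, r.1)).trans ((h k _).trans ?_)
    refine mul_le_of_le_one_right (mul_nonneg hB hlk) (le_trans ?_ hX1)
    -- A block of `X` has Hilbert–Schmidt norm at most that of `X`.
    refine le_of_sq_le_sq ?_ (norm_nonneg _)
    rw [norm_vectorize_sq, norm_vectorize_sq, Fintype.sum_prod_type]
    refine Finset.sum_le_sum fun i _ => ?_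
    refine le_trans ?_ (Finset.single_le_sum (f := fun a => ∑ s, ‖X (i, a) s‖ ^ 2)
      (fun _ _ => Finset.sum_nonneg fun _ _ => sq_nonneg _) (Finset.mem_univ p.2))
    rw [Fintype.sum_prod_type]
    refine Finset.sum_le_sum fun j _ => ?_
    exact Finset.single_le_sum (f := fun b => ‖X (i, p.2) (j, b)‖ ^ 2)
      (fun _ _ => sq_nonneg _) (Finset.mem_univ r.2)
  have h1 := norm_vectorize_le (mul_nonneg hB hlk) hent
  refine (traceNorm_le _).trans ((mul_le_mul_of_nonneg_left h1 hD).trans ?_)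
  change D * (D * (B * (wallFactor q ^ 4) ^ k)) ≤ _
  calc D * (D * (B * (wallFactor q ^ 4) ^ k)) = D * (D * B) * (wallFactor q ^ 4) ^ k := by ring
    _ ≤ _ := mul_le_mul_of_nonneg_right (le_max_right _ _) hlk

/-- Projecting `T v = μ v` gives `P₁ v = μ P₁ v` with `μ ≠ 1`. -/
lemma unitProjection_slowState (hq : 2 ≤ q) : unitProjection n q 2 (slowState n q 1) = 0 := by
  have h := unitProjection_transferMatrix hq (slowState n q 1)
  rw [transferMatrix_slowState hq, map_smul, ← sub_eq_zero] at h
  nth_rewrite 2 [← one_smul ℂ (unitProjection n q 2 (slowState n q 1))] at h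
  rw [← sub_smul] at h
  refine (smul_eq_zero.1 h).resolve_left (sub_ne_zero.2 ?_)
  have h1 : pairFactor q n ^ 2 < 1 :=
    pow_lt_one₀ (pairFactor_nonneg q n) (pairFactor_lt_one hq n) (by norm_num)
  exact_mod_cast h1.ne

lemma transferMatrix_pow_slowState (hq : 2 ≤ q) (k : ℕ) :
    (transferMatrix n q 2 ^ k) (slowState n q 1)
      = (((pairFactor q n ^ 2) ^ k : ℝ) : ℂ) • slowState n q 1 := by
  induction k with
  | zero => simp
  | succ k ih =>
    rw [pow_succ', Module.End.mul_apply, ih, map_smul, transferMatrix_slowState hq, smul_smul,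
      ← Complex.ofReal_mul, ← pow_succ]

/-- The test input is the slow mode, read as a matrix, tensored with a rank-one projection on the
ancilla. The Haar channel annihilates it and each period multiplies it by the slow eigenvalue. -/
theorem exists_le_diamondNorm (hq : 2 ≤ q) (hn : 2 ≤ (n : ℕ)) : ∃ δ : ℝ, 0 < δ ∧ ∀ k : ℕ,
    ENNReal.ofReal (δ * (pairFactor q n ^ 2) ^ k) ≤
      diamondNorm (channel 2 (brickworkEnsemble n q k) - channel 2 (haarU (Config (2 * n) q))) := by
  have : NeZero q := ⟨by omega⟩
  let a₀ : Fin 2 → Config (2 * n) q := fun _ _ => 0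
  let V : Matrix (Fin 2 → Config (2 * n) q) (Fin 2 → Config (2 * n) q) ℂ :=
    Matrix.of fun i j => slowState n q 1 (i, j)
  have hV : WithLp.toLp 2 (vectorize V) = slowState n q 1 := rfl
  let X : Matrix ((Fin 2 → Config (2 * n) q) × (Fin 2 → Config (2 * n) q))
      ((Fin 2 → Config (2 * n) q) × (Fin 2 → Config (2 * n) q)) ℂ :=
    Matrix.of fun p r => if p.2 = a₀ ∧ r.2 = a₀ then V p.1 r.1 else 0
  have hX0 : 0 < ‖WithLp.toLp 2 (vectorize X)‖ := by
    obtain ⟨x, hx⟩ : ∃ x, slowState n q 1 x ≠ 0 := by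
      by_contra hcon
      push Not at hcon
      exact slowState_ne_zero hq hn 1 (by ext x; exact hcon x)
    refine lt_of_lt_of_le (norm_pos_iff.2 hx)
      (le_trans (le_of_eq ?_) (norm_apply_le_norm_vectorize X (x.1, a₀) (x.2, a₀)))
    simp [X, V]
  have hΦ : ∀ (c : ℂ) (k : ℕ), tensorId (channel 2 (brickworkEnsemble n q k) -
      channel 2 (haarU (Config (2 * n) q))) (c • X)
      = (((pairFactor q n ^ 2) ^ k : ℝ) : ℂ) • (c • X) := by
    intro c k
    ext p r
    rw [tensorId, Matrix.of_apply]
    have hblock : (Matrix.of fun i j => (c • X) (i, p.2) (j, r.2))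
        = (if p.2 = a₀ ∧ r.2 = a₀ then c else 0) • V := by
      ext i j
      simp only [Matrix.of_apply, Matrix.smul_apply, X, smul_eq_mul]
      split_ifs <;> simp
    rw [hblock, map_smul, Matrix.smul_apply, channel_sub_channel_apply hq, hV,
      transferMatrix_pow_slowState hq, unitProjection_slowState hq, sub_zero, WithLp.ofLp_smul]
    simp only [Pi.smul_apply, Matrix.smul_apply, smul_eq_mul, X, V, Matrix.of_apply]
    split_ifs <;> ring
  let D : ℝ := Fintype.card ((Fin 2 → Config (2 * n) q) × (Fin 2 → Config (2 * n) q))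
  have hD : 0 < D := Nat.cast_pos.2 Fintype.card_pos
  let c : ℝ := (D * ‖WithLp.toLp 2 (vectorize X)‖)⁻¹
  have hc : 0 < c := inv_pos.2 (mul_pos hD hX0)
  refine ⟨c * ‖WithLp.toLp 2 (vectorize X)‖, mul_pos hc hX0, fun k => ?_⟩
  have hk : 0 ≤ (pairFactor q n ^ 2) ^ k := pow_nonneg (sq_nonneg _) k
  have hle : traceNorm ((c : ℂ) • X) ≤ 1 := by
    refine (traceNorm_le _).trans_eq ?_
    rw [norm_vectorize_smul, Complex.norm_real, Real.norm_of_nonneg hc.le]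
    change D * ((D * ‖WithLp.toLp 2 (vectorize X)‖)⁻¹ * ‖WithLp.toLp 2 (vectorize X)‖) = 1
    field_simp
  refine le_trans (ENNReal.ofReal_le_ofReal ?_) (le_iSup₂ (f := fun X (_ : traceNorm X ≤ 1) =>
    ENNReal.ofReal (traceNorm (tensorId (channel 2 (brickworkEnsemble n q k) -
      channel 2 (haarU (Config (2 * n) q))) X))) ((c : ℂ) • X) hle)
  rw [hΦ]
  refine le_trans (le_of_eq ?_) (norm_vectorize_le_traceNorm _)
  rw [norm_vectorize_smul, norm_vectorize_smul, Complex.norm_real, Complex.norm_real,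
    Real.norm_of_nonneg hc.le, Real.norm_of_nonneg hk]
  ring

end Diamond

/-! ### The optimal design constant -/

section DesignConstant

variable {n : ℕ+} {q : ℕ}

lemma tendsto_log_one_div : Tendsto (fun ε : ℝ => Real.log (1 / ε)) (𝓝[>] 0) atTop := by
  simp only [one_div]
  exact Real.tendsto_log_atTop.comp tendsto_inv_nhdsGT_zero

theorem isDesignConstant_inv_log (hq : 2 ≤ q) (n : ℕ+) :
    IsDesignConstant q 2 n (-Real.log (wallFactor q ^ 4))⁻¹ := by
  obtain ⟨C, hC, h⟩ := exists_diamondNorm_le hq n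
  have hl0 : 0 < wallFactor q ^ 4 := pow_pos (wallFactor_pos hq) 4
  have hl1 : wallFactor q ^ 4 < 1 :=
    pow_lt_one₀ (wallFactor_nonneg q) (wallFactor_lt_one hq) (by norm_num)
  generalize wallFactor q ^ 4 = lam at h hl0 hl1
  have hL : 0 < -Real.log lam := neg_pos.2 (Real.log_neg hl0 hl1)
  have hlogC : 0 ≤ Real.log C := Real.log_nonneg hC
  refine ⟨fun _ => Real.log C * (-Real.log lam)⁻¹ + 1, ?_, fun ε hε hε1 => ?_⟩
  · exact isLittleO_const_left.2 (Or.inr (tendsto_norm_atTop_atTop.comp tendsto_log_one_div))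
  · have hx : 0 ≤ Real.log (1 / ε) := Real.log_nonneg (by rw [le_div_iff₀ hε]; linarith)
    refine ⟨⌈(Real.log (1 / ε) + Real.log C) * (-Real.log lam)⁻¹⌉₊, ?_, fun k hk => ?_⟩
    · have := Nat.ceil_lt_add_one (a := (Real.log (1 / ε) + Real.log C) * (-Real.log lam)⁻¹)
        (by positivity)
      refine this.le.trans_eq ?_
      ring
    · refine (h k).trans (ENNReal.ofReal_le_ofReal ?_)
      have h1 : (Real.log (1 / ε) + Real.log C) * (-Real.log lam)⁻¹ ≤ k :=
        (Nat.le_ceil _).trans (by exact_mod_cast hk)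
      rw [← div_eq_mul_inv, div_le_iff₀ hL] at h1
      rw [← Real.log_le_log_iff (by positivity) hε, Real.log_mul (by positivity) (by positivity),
        Real.log_pow]
      rw [one_div, Real.log_inv] at h1
      linarith

/-- At the promised number `K` of periods the lower bound forces `L K ≥ log(1/ε) + log δ`, where `L`
is minus the logarithm of the slow eigenvalue. If `L C < 1`, this fails for small `ε`. -/
theorem le_of_isDesignConstant (hq : 2 ≤ q) (hn : 2 ≤ (n : ℕ)) {C : ℝ}
    (hC : IsDesignConstant q 2 n C) : (-Real.log (pairFactor q n ^ 2))⁻¹ ≤ C := by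
  obtain ⟨δ, hδ, h⟩ := exists_le_diamondNorm hq hn
  obtain ⟨r, hr, hK⟩ := hC
  have hl0 : 0 < pairFactor q n ^ 2 := pow_pos (pairFactor_pos hq hn) 2
  have hl1 : pairFactor q n ^ 2 < 1 :=
    pow_lt_one₀ (pairFactor_nonneg q n) (pairFactor_lt_one hq n) (by norm_num)
  generalize pairFactor q n ^ 2 = lam at h hl0 hl1
  have hL : 0 < -Real.log lam := neg_pos.2 (Real.log_neg hl0 hl1)
  set L := -Real.log lam with hLdef
  by_contra hlt
  push Not at hlt
  have hCL : 0 < 1 - L * C := by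
    have := mul_lt_mul_of_pos_left hlt hL
    rw [mul_inv_cancel₀ hL.ne'] at this
    linarith
  -- The gap `1 - L C` is split in halves: one absorbs `L r(ε)`, the other absorbs `-log δ` once
  -- `log(1/ε)` is large.
  have hη : 0 < (1 - L * C) / 2 / L := by positivity
  have hev := hr.bound hη
  have hev2 := tendsto_log_one_div.eventually_gt_atTop (max 0 (-Real.log δ / ((1 - L * C) / 2)))
  have hev3 : ∀ᶠ ε : ℝ in 𝓝[>] 0, 0 < ε ∧ ε < 1 := Ioo_mem_nhdsGT one_pos
  obtain ⟨ε, ⟨h1, h2⟩, hε, hε1⟩ := ((hev.and hev2).and hev3).exists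
  have hx0 : 0 < Real.log (1 / ε) := (le_max_left _ _).trans_lt h2
  have hx1 := (le_max_right _ _).trans_lt h2
  obtain ⟨K, hK1, hK2⟩ := hK ε hε hε1
  have h3 := (h K).trans (hK2 K le_rfl)
  rw [ENNReal.ofReal_le_ofReal_iff hε.le] at h3
  rw [← Real.log_le_log_iff (by positivity) hε, Real.log_mul (by positivity) (by positivity),
    Real.log_pow] at h3
  have h4 : Real.log ε = -Real.log (1 / ε) := by rw [one_div, Real.log_inv, neg_neg]
  rw [h4] at h3
  rw [Real.norm_eq_abs, Real.norm_of_nonneg hx0.le] at h1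
  set x := Real.log (1 / ε)
  have h5 : L * r ε ≤ (1 - L * C) / 2 * x := by
    have := mul_le_mul_of_nonneg_left ((le_abs_self _).trans h1) hL.le
    refine this.trans_eq ?_
    field_simp
  have h6 : L * K ≤ L * (C * x + r ε) := mul_le_mul_of_nonneg_left hK1 hL.le
  rw [div_lt_iff₀ (by positivity)] at hx1
  have h7 : x + Real.log δ ≤ L * K := by
    rw [hLdef]
    linarith
  nlinarith

theorem designConstant_eq (hq : 2 ≤ q) :
    designConstant q 2 = ENNReal.ofReal (-Real.log (wallFactor q ^ 4))⁻¹ := by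
  have hl0 : 0 < wallFactor q ^ 4 := pow_pos (wallFactor_pos hq) 4
  have hl1 : wallFactor q ^ 4 < 1 :=
    pow_lt_one₀ (wallFactor_nonneg q) (wallFactor_lt_one hq) (by norm_num)
  have hL : 0 < -Real.log (wallFactor q ^ 4) := neg_pos.2 (Real.log_neg hl0 hl1)
  apply le_antisymm
  · refine iSup_le fun n => iInf₂_le_of_le (Real.toNNReal (-Real.log (wallFactor q ^ 4))⁻¹) ?_ ?_
    · rw [Real.coe_toNNReal _ (inv_nonneg.2 hL.le)]
      exact isDesignConstant_inv_log hq n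
    · exact le_rfl
  · have h1 : Tendsto (fun n : ℕ => pairFactor q n ^ 2) atTop (𝓝 (wallFactor q ^ 4)) := by
      have := (tendsto_pairFactor q).pow 2
      rwa [← pow_mul] at this
    have h2 := ENNReal.tendsto_ofReal ((h1.log hl0.ne').neg.inv₀ hL.ne')
    refine le_of_tendsto h2 (eventually_atTop.2 ⟨2, fun n hn => ?_⟩)
    refine le_trans ?_ (le_iSup (designConstantAt q 2) ⟨n, by omega⟩)
    refine le_iInf₂ fun C hC => ?_
    have h3 := le_of_isDesignConstant hq (by exact hn) hC
    exact ENNReal.ofReal_le_of_le_toReal (by simpa using h3)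

end DesignConstant

/-! ### Subleading eigenvalues and singular values -/

section Subleading

variable {n : ℕ+} {q : ℕ}

lemma adjoint_transferMatrix (hq : 2 ≤ q) (v : EuclideanSpace ℂ (MomentIndex (2 * n) q 2)) :
    LinearMap.adjoint (transferMatrix n q 2) v = layerOp n q 0 (layerOp n q 1 v) := by
  refine ext_inner_left ℂ fun w => ?_
  rw [LinearMap.adjoint_inner_right, transferMatrix_apply, layerOp_isSymmetric hq 1,
    layerOp_isSymmetric hq 0]

/-- With `A` and `B` the layers `0` and `1`, `T = B A` and `T† T = A B A`. If `A B A v = s² v` with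
`s ≠ 0`, then `A v = v` and `B v` is an eigenvector of `T` for `s²`, so the eigenvalue bound
applies. -/
theorem singularValues_le (hq : 2 ≤ q) (i : ℕ) (h1 : (transferMatrix n q 2).singularValues i ≠ 1) :
    (transferMatrix n q 2).singularValues i ≤ wallFactor q ^ 2 := by
  have hw := wallFactor_nonneg q
  set s := (transferMatrix n q 2).singularValues i with hs
  have hs0 : 0 ≤ s := LinearMap.singularValues_nonneg _ _
  rcases hs0.eq_or_lt with h0 | h0
  · rw [← h0]
    positivity
  have hi : i < Module.finrank ℂ (EuclideanSpace ℂ (MomentIndex (2 * n) q 2)) := by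
    by_contra hcon
    -- Beyond the dimension the sequence of singular values takes the default value `0`.
    rw [not_lt] at hcon
    rw [LinearMap.singularValues_of_finrank_le _ hcon] at hs
    exact h0.ne' hs
  obtain ⟨v, hv⟩ :=
    ((transferMatrix n q 2).hasEigenvalue_adjoint_comp_self_sq_singularValues hi).exists_hasEigenvector
  have hv1 := hv.apply_eq_smul
  rw [LinearMap.comp_apply, adjoint_transferMatrix hq, transferMatrix_apply,
    layerOp_layerOp hq 1, ← hs] at hv1
  have hs2 : ((s : ℂ) ^ 2) ≠ 0 := pow_ne_zero _ (by exact_mod_cast h0.ne')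
  have hP0 : layerOp n q 0 v = v := by
    have h2 := congrArg (layerOp n q 0) hv1
    rw [layerOp_layerOp hq 0, hv1, map_smul] at h2
    exact (smul_right_injective _ hs2 h2).symm
  rw [hP0] at hv1
  have hT : transferMatrix n q 2 (layerOp n q 1 v) = ((s : ℂ) ^ 2) • layerOp n q 1 v := by
    rw [transferMatrix_apply, hv1, map_smul]
    rfl
  have hne : layerOp n q 1 v ≠ 0 := by
    intro h
    rw [h, map_zero] at hv1
    exact (smul_eq_zero.1 hv1.symm).elim hs2 hv.2
  have hev : Module.End.HasEigenvalue (transferMatrix n q 2) ((s : ℂ) ^ 2) :=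
    Module.End.hasEigenvalue_of_hasEigenvector
      ⟨Module.End.mem_eigenspace_iff.2 hT, hne⟩
  have hle := norm_eigenvalue_le hq hev (by
    intro h
    have h3 : s ^ 2 = 1 := by exact_mod_cast h
    exact h1 ((pow_eq_one_iff_of_nonneg hs0 two_ne_zero).1 h3))
  rw [norm_pow, Complex.norm_real, Real.norm_of_nonneg hs0] at hle
  refine le_of_sq_le_sq (hle.trans_eq ?_) (by positivity)
  ring

/-- The layers exchange the slow states of the two layers, each time with the same factor, so the
slow state of layer `0` is an eigenvector of `T† T` for the square of that factor. -/
theorem exists_singularValues_eq_pairFactor (hq : 2 ≤ q) (hn : 2 ≤ (n : ℕ)) :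
    ∃ i, (transferMatrix n q 2).singularValues i = pairFactor q n := by
  have h0 := pairFactor_pos hq hn
  have h0' : (pairFactor q n : ℂ) ≠ 0 := by exact_mod_cast h0.ne'
  have hP0 : layerOp n q 0 (slowState n q 0) = slowState n q 0 := by
    have h := congrArg (layerOp n q 0) (layerOp_zero_slowState (n := n) hq)
    rw [layerOp_layerOp hq, layerOp_zero_slowState hq, map_smul] at h
    exact (smul_right_injective _ h0' h).symm
  have hev : Module.End.HasEigenvalue
      (LinearMap.adjoint (transferMatrix n q 2) ∘ₗ transferMatrix n q 2)
      ((pairFactor q n : ℂ) ^ 2) := by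
    refine Module.End.hasEigenvalue_of_hasEigenvector (x := slowState n q 0)
      ⟨Module.End.mem_eigenspace_iff.2 ?_, slowState_ne_zero hq hn 0⟩
    rw [LinearMap.comp_apply, adjoint_transferMatrix hq, transferMatrix_apply, layerOp_layerOp hq,
      hP0, layerOp_one_slowState hq, map_smul, layerOp_zero_slowState hq, smul_smul, sq]
  obtain ⟨i, hi⟩ :=
    (transferMatrix n q 2).isSymmetric_adjoint_comp_self.exists_eigenvalues_eq rfl hev
  refine ⟨i, ?_⟩
  rw [LinearMap.singularValues_fin _ rfl]
  have h3 : (transferMatrix n q 2).isSymmetric_adjoint_comp_self.eigenvalues rfl i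
      = pairFactor q n ^ 2 := by
    have h4 := hi
    rw [← Complex.ofReal_pow] at h4
    exact Complex.ofReal_injective h4
  rw [h3, Real.sqrt_sq h0.le]

lemma isLUB_of_pairFactor {f : ℕ+ → ℝ} {k : ℕ}
    (h1 : ∀ n, f n ≤ (wallFactor q ^ 2) ^ k)
    (h2 : ∀ n : ℕ+, 2 ≤ (n : ℕ) → pairFactor q n ^ k ≤ f n) :
    IsLUB (Set.range f) ((wallFactor q ^ 2) ^ k) := by
  refine ⟨?_, fun b hb => ?_⟩
  · rintro _ ⟨n, rfl⟩
    exact h1 n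
  · refine le_of_tendsto ((tendsto_pairFactor q).pow k) (eventually_atTop.2 ⟨2, fun n hn => ?_⟩)
    exact (h2 ⟨n, by omega⟩ hn).trans (hb ⟨_, rfl⟩)

theorem isLUB_subleadingEigenvalue (hq : 2 ≤ q) :
    IsLUB (Set.range fun n : ℕ+ => subleadingEigenvalue (transferMatrix n q 2))
      (wallFactor q ^ 4) := by
  have hup : ∀ n : ℕ+, ∀ r ∈ {r : ℝ | ∃ μ : ℂ, Module.End.HasEigenvalue (transferMatrix n q 2) μ ∧
      μ ≠ 1 ∧ r = ‖μ‖}, r ≤ (wallFactor q ^ 2) ^ 2 := by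
    rintro n _ ⟨μ, hμ, h1, rfl⟩
    rw [← pow_mul]
    exact norm_eigenvalue_le hq hμ h1
  rw [show wallFactor q ^ 4 = (wallFactor q ^ 2) ^ 2 by ring]
  refine isLUB_of_pairFactor (fun n => Real.sSup_le (hup n) (by positivity)) fun n hn => ?_
  refine le_csSup ⟨_, hup n⟩ ⟨((pairFactor q n ^ 2 : ℝ) : ℂ), ?_, ?_, ?_⟩
  · exact Module.End.hasEigenvalue_of_hasEigenvector (x := slowState n q 1)
      ⟨Module.End.mem_eigenspace_iff.2 (transferMatrix_slowState hq), slowState_ne_zero hq hn 1⟩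
  · have h1 : pairFactor q n ^ 2 < 1 :=
      pow_lt_one₀ (pairFactor_nonneg q n) (pairFactor_lt_one hq n) (by norm_num)
    exact_mod_cast h1.ne
  · rw [Complex.norm_real, Real.norm_of_nonneg (sq_nonneg _)]

theorem isLUB_subleadingSingularValue (hq : 2 ≤ q) :
    IsLUB (Set.range fun n : ℕ+ => subleadingSingularValue (transferMatrix n q 2))
      (wallFactor q ^ 2) := by
  have hup : ∀ n : ℕ+, ∀ r ∈ Set.range (transferMatrix n q 2).singularValues \ {1},
      r ≤ (wallFactor q ^ 2) ^ 1 := by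
    rintro n _ ⟨⟨i, rfl⟩, h1⟩
    rw [pow_one]
    exact singularValues_le hq i h1
  rw [← pow_one (wallFactor q ^ 2)]
  refine isLUB_of_pairFactor (fun n => Real.sSup_le (hup n) (by positivity)) fun n hn => ?_
  obtain ⟨i, hi⟩ := exists_singularValues_eq_pairFactor hq hn
  rw [pow_one]
  exact le_csSup ⟨_, hup n⟩ ⟨⟨i, hi⟩, (pairFactor_lt_one hq n).ne⟩

end Subleading

/-! ### Overlaps of permutation product states -/

section Overlaps

variable {n : ℕ+} {q : ℕ}

lemma star_averagedLayer (hq : 2 ≤ q) (l : Fin 2) (x y : MomentIndex (2 * n) q 2) :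
    star (averagedLayer n q 2 l x y) = averagedLayer n q 2 l x y := by
  have hr : ∀ (σ : Equiv.Perm (Fin 2)) (z : PairIndex q 2),
      star (permDelta (Fin q × Fin q) σ z) = permDelta (Fin q × Fin q) σ z := by
    intro σ z
    simp only [permDelta]
    split_ifs <;> simp
  rw [averagedLayer_eq]
  change star (∏ j : Fin n, momentMatrix 2 (haarU (Fin q × Fin q)) _ _)
    = ∏ j : Fin n, momentMatrix 2 (haarU (Fin q × Fin q)) _ _
  rw [star_prod]
  refine Finset.prod_congr rfl fun j _ => ?_
  rw [momentMatrix_haarU_apply (two_le_card_pair hq), star_sum]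
  refine Finset.sum_congr rfl fun σ _ => ?_
  rw [star_sum]
  refine Finset.sum_congr rfl fun τ _ => ?_
  rw [star_mul', star_mul', hr, hr]
  congr 1
  exact Complex.conj_ofReal _

lemma star_layerOp (hq : 2 ≤ q) (l : Fin 2) {v : EuclideanSpace ℂ (MomentIndex (2 * n) q 2)}
    (hv : ∀ x, star (v x) = v x) (x : MomentIndex (2 * n) q 2) :
    star (layerOp n q l v x) = layerOp n q l v x := by
  change star (∑ y, averagedLayer n q 2 l x y * v y) = ∑ y, averagedLayer n q 2 l x y * v y
  rw [star_sum]
  exact Finset.sum_congr rfl fun y _ => by rw [star_mul', star_averagedLayer hq, hv]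

lemma star_transferMatrix_pow_permState (hq : 2 ≤ q) (X : Fin (2 * n) → Equiv.Perm (Fin 2)) (p : ℕ) :
    ∀ x, star ((transferMatrix n q 2 ^ p) (permState q X) x)
      = (transferMatrix n q 2 ^ p) (permState q X) x := by
  induction p with
  | zero =>
    intro x
    rw [pow_zero, Module.End.one_apply]
    change star (∏ i : Fin (2 * n), _) = ∏ i : Fin (2 * n), _
    rw [star_prod]
    refine Finset.prod_congr rfl fun i _ => ?_
    split_ifs
    · exact Complex.conj_ofReal _
    · exact star_zero _
  | succ p ih =>
    rw [pow_succ', Module.End.mul_apply, transferMatrix_apply]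
    exact star_layerOp hq 1 (star_layerOp hq 0 ih)

lemma inner_im_eq_zero {I : Type*} [Fintype I] {v w : EuclideanSpace ℂ I}
    (hv : ∀ x, star (v x) = v x) (hw : ∀ x, star (w x) = w x) : (inner ℂ v w).im = 0 := by
  rw [← Complex.conj_eq_iff_im, PiLp.inner_apply, map_sum]
  refine Finset.sum_congr rfl fun x _ => ?_
  have h1 := hv x
  have h2 := hw x
  simp only [RCLike.inner_apply, map_mul] at *
  change star (w x) * star (star (v x)) = w x * star (v x)
  rw [h1, h2, h1]

/-- The order on `ℂ` demands equal imaginary parts, so beyond the norm bound both overlaps have to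
be shown real. -/
theorem exists_inner_transferMatrix_pow_le (hq : 2 ≤ q) (n : ℕ+)
    (X X' : Fin (2 * n) → Equiv.Perm (Fin 2)) : ∃ c : ℝ, ∀ p : ℕ,
      inner ℂ (permState q X') ((transferMatrix n q 2 ^ p) (permState q X)) ≤
        inner ℂ (permState q X') (unitProjection n q 2 (permState q X)) +
          ((c * (wallFactor q ^ 4) ^ p : ℝ) : ℂ) := by
  obtain ⟨B, hB, h⟩ := exists_norm_transferMatrix_pow_sub_le hq n
  have hl0 : 0 ≤ wallFactor q ^ 4 := pow_nonneg (wallFactor_nonneg q) 4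
  have hl1 : wallFactor q ^ 4 < 1 :=
    pow_lt_one₀ (wallFactor_nonneg q) (wallFactor_lt_one hq) (by norm_num)
  set c := ‖permState q X'‖ * (B * ‖permState q X‖) with hc
  have hbound : ∀ p : ℕ,
      ‖inner ℂ (permState q X') ((transferMatrix n q 2 ^ p) (permState q X)) -
        inner ℂ (permState q X') (unitProjection n q 2 (permState q X))‖
        ≤ c * (wallFactor q ^ 4) ^ p := by
    intro p
    rw [← inner_sub_right]
    refine (norm_inner_le_norm _ _).trans
      ((mul_le_mul_of_nonneg_left (h p _) (norm_nonneg _)).trans_eq ?_)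
    rw [hc]
    ring
  have him : ∀ p : ℕ,
      (inner ℂ (permState q X') ((transferMatrix n q 2 ^ p) (permState q X))).im = 0 :=
    fun p => inner_im_eq_zero (star_transferMatrix_pow_permState hq X' 0)
      (star_transferMatrix_pow_permState hq X p)
  -- The overlap with the projection is a limit of real overlaps of the iterates.
  have him' : (inner ℂ (permState q X') (unitProjection n q 2 (permState q X))).im = 0 := by
    have h1 : ∀ p : ℕ, |(inner ℂ (permState q X') (unitProjection n q 2 (permState q X))).im|
        ≤ c * (wallFactor q ^ 4) ^ p := by
      intro p
      have h2 := (Complex.abs_im_le_norm _).trans (hbound p)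
      rwa [Complex.sub_im, him, zero_sub, abs_neg] at h2
    have h3 := (tendsto_pow_atTop_nhds_zero_of_lt_one hl0 hl1).const_mul c
    rw [mul_zero] at h3
    exact abs_nonpos_iff.1 (ge_of_tendsto' h3 h1)
  refine ⟨c, fun p => ?_⟩
  rw [Complex.le_def, Complex.add_re, Complex.add_im, Complex.ofReal_re, Complex.ofReal_im, him,
    him']
  refine ⟨?_, by simp⟩
  have h2 := (Complex.re_le_norm _).trans (hbound p)
  rw [Complex.sub_re] at h2
  linarith

end Overlaps

lemma neg_log_wallFactor_pow (q : ℕ) :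
    -Real.log (wallFactor q ^ 4) = 4 * Real.log ((q ^ 2 + 1) / (2 * q)) := by
  have h : ((q : ℝ) ^ 2 + 1) / (2 * q) = (wallFactor q)⁻¹ := by rw [wallFactor, inv_div]
  rw [h, Real.log_inv, Real.log_pow]
  push_cast
  ring

end RandomCircuit

theorem mainTheorem9 (q : ℕ) (hq : 2 ≤ q) :
    -- overlaps of permutation product states decay at rate `λ₁ = (2q/(q²+1))⁴`
    (∀ (n : ℕ+) (X X' : Fin (2 * n) → Equiv.Perm (Fin 2)), ∃ c : ℝ, ∀ p : ℕ,
      Real.log (2 * n : ℕ) / (-Real.log ((2 * q / (q ^ 2 + 1) : ℝ) ^ 4)) + 1 < p →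
        inner ℂ (permState q X') ((transferMatrix n q 2 ^ p) (permState q X)) ≤
          inner ℂ (permState q X') (unitProjection n q 2 (permState q X)) +
            ((c * ((2 * q / (q ^ 2 + 1) : ℝ) ^ 4) ^ p : ℝ) : ℂ)) ∧
    -- every eigenvalue of `T` other than `1` is at most `λ₁`, for every number of sites
    (∀ (n : ℕ+) (μ : ℂ), Module.End.HasEigenvalue (transferMatrix n q 2) μ → μ ≠ 1 →
      ‖μ‖ ≤ (2 * q / (q ^ 2 + 1) : ℝ) ^ 4) ∧
    -- and the bound is sharp over all numbers of sites
    IsLUB (Set.range fun n : ℕ+ => subleadingEigenvalue (transferMatrix n q 2))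
      ((2 * q / (q ^ 2 + 1) : ℝ) ^ 4) ∧
    -- `s_* = (2q/(q²+1))²`
    IsLUB (Set.range fun n : ℕ+ => subleadingSingularValue (transferMatrix n q 2))
      ((2 * q / (q ^ 2 + 1) : ℝ) ^ 2) ∧
    -- `C(q,2) = (4 log ((q²+1)/(2q)))⁻¹`
    (∀ n : ℕ+, IsDesignConstant q 2 n (4 * Real.log ((q ^ 2 + 1) / (2 * q)))⁻¹) ∧
    designConstant q 2 = ENNReal.ofReal ((4 * Real.log ((q ^ 2 + 1) / (2 * q)))⁻¹) := by
  refine ⟨fun n X X' => ?_, fun n μ hμ h1 => norm_eigenvalue_le hq hμ h1,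
    isLUB_subleadingEigenvalue hq, isLUB_subleadingSingularValue hq, fun n => ?_, ?_⟩
  · obtain ⟨c, hc⟩ := exists_inner_transferMatrix_pow_le hq n X X'
    exact ⟨c, fun p _ => hc p⟩
  · rw [← neg_log_wallFactor_pow]
    exact isDesignConstant_inv_log hq n
  · rw [← neg_log_wallFactor_pow]
    exact designConstant_eq hq
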